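/- Let $(\mathcal M,\tau)$ be a von Neumann algebra on a Hilbert space with a normal tracial state, and let $\mathbf X_i=(X_{i1},\dots,X_{ir(i)})$, $1\le i\le n$, be finite tuples of self-adjoint elements of $\mathcal M$. Write $M_N^{\mathrm{sa}}$ for the self-adjoint $N\times N$ complex matrices, $\|\cdot\|_\infty$ for the operator norm, $\mathrm{tr}_N$ for the normalized trace and $\gamma_{\mathrm U(N)}$ for the Haar probability measure on the unitary group $\mathrm U(N)$. For $R\in(0,\infty]$, $N,m\in\mathbb N$ and $\delta>0$ let $\Gamma_R(N,m,\delta)$ be the set of all $(\mathbf A_i)_{i=1}^n\in\prod_{i=1}^n(M_N^{\mathrm{sa}})^{r(i)}$ with $\|A_{ij}\|_\infty\le R$ for all $i,j$ and $$\big|\mathrm{tr}_N(A_{i_1j_1}\cdots A_{i_lj_l})-\tau(X_{i_1j_1}\cdots X_{i_lj_l})\big|<\delta$$ whenever $1\le l\le m$, $1\le i_k\le n$ and $1\le j_k\le r(i_k)$. Put $\Phi_N((U_i)_i,(\mathbf A_i)_i):=(U_i\mathbf A_iU_i^*)_i$ for $(U_i)_i\in \mathrm U(N)^n$. With $\log 0:=-\infty$,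 set $$\chi_{\mathrm{orb},R}(\mathbf X_1,\dots,\mathbf X_n):=\lim_{\substack{m\to\infty\\ \delta\searrow0}}\ \limsup_{N\to\infty}\ \frac1{N^2}\ \sup_\mu\ \log\Big((\gamma_{\mathrm U(N)}^{\otimes n}\otimes\mu)\big(\Phi_N^{-1}(\Gamma_R(N,m,\delta))\big)\Big),$$ where $\mu$ runs over all Borel probability measures on $\prod_{i=1}^n(M_N^{\mathrm{sa}})^{r(i)}$ and the limit is also the infimum over $m\in\mathbb N$, $\delta>0$; and set $\chi_{\mathrm{orb}}(\mathbf X_1,\dots,\mathbf X_n):=\sup_{0<R<\infty}\chi_{\mathrm{orb},R}(\mathbf X_1,\dots,\mathbf X_n)$. For $(\mathbf A_i)_i\in\prod_{i=1}^n(M_N^{\mathrm{sa}})^{r(i)}$ let $\Gamma_{\mathrm{orb}}((\mathbf A_i)_i;N,m,\delta)$ be the set of all $(U_i)_i\in \mathrm U(N)^n$ with $(U_i\mathbf A_iU_i^*)_i\in\Gamma_\infty(N,m,\delta)$. **Proposition 2.3.** Assume that for every $i$ the von Neumann algebra $W^*(\mathbf X_i)$ generated by $\mathbf X_i$ is hyperfinite,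 i.e. generated by an increasing sequence of finite-dimensional $*$-subalgebras. Then there exist multi-matrices $\Xi_i(N)=(\xi_{ij}(N))_{j=1}^{r(i)}\in(M_N^{\mathrm{sa}})^{r(i)}$ ($1\le i\le n$, $N\in\mathbb N$) such that $$\|\xi_{ij}(N)\|_\infty\le\|X_{ij}\|_\infty\qquad\text{and}\qquad\lim_{N\to\infty}\mathrm{tr}_N(P(\Xi_i(N)))=\tau(P(\mathbf X_i))$$ for all $i$, $j$ and every non-commutative polynomial $P$ in $r(i)$ variables. For every such choice of the $\Xi_i(N)$ and every $R\in(0,\infty]$ with $R\ge\max_{i,j}\|X_{ij}\|_\infty$, $$\chi_{\mathrm{orb},R}(\mathbf X_1,\dots,\mathbf X_n)=\lim_{\substack{m\to\infty\\ \delta\searrow0}}\ \limsup_{N\to\infty}\ \frac1{N^2}\log\Big(\gamma_{\mathrm U(N)}^{\otimes n}\big(\Gamma_{\mathrm{orb}}((\Xi_i(N))_{i=1}^n;N,m,\delta)\big)\Big).$$ The right-hand side is the original (Hiai--Miyamoto--Ueda) definition of the orbital free entropy, and $\chi_{\mathrm{orb}}(\mathbf X_1,\dots,\mathbf X_n)$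 is equal to it as well. -/

import Mathlib

open Filter Topology MeasureTheory Set
open scoped ENNReal ComplexOrder

noncomputable section

namespace OrbitalFreeEntropy

/-! ### Von Neumann algebras, normal tracial states, hyperfiniteness -/

section VonNeumann

variable {H : Type*} [NormedAddCommGroup H] [InnerProductSpace ℂ H] [CompleteSpace H]

/-- The von Neumann algebra `W*(S)` on `H` generated by a set `S` of bounded operators: the double
commutant of `S ∪ S*`. -/
def generatedVN (S : Set (H →L[ℂ] H)) : VonNeumannAlgebra H where
  toStarSubalgebra :=
    StarSubalgebra.centralizer ℂ (StarSubalgebra.centralizer ℂ S : Set (H →L[ℂ] H))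
  centralizer_centralizer' := by
    change Set.centralizer (Set.centralizer
      (StarSubalgebra.centralizer ℂ (StarSubalgebra.centralizer ℂ S : Set (H →L[ℂ] H)) :
        Set (H →L[ℂ] H))) = (StarSubalgebra.centralizer ℂ
        (StarSubalgebra.centralizer ℂ S : Set (H →L[ℂ] H)) : Set (H →L[ℂ] H))
    rw [StarSubalgebra.coe_centralizer]
    exact Set.centralizer_centralizer_centralizer _

/-- `W*(S)` is the smallest von Neumann algebra on `H` that contains `S`. -/
theorem generatedVN_le_iff (S : Set (H →L[ℂ] H)) (N : VonNeumannAlgebra H) :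
    generatedVN S ≤ N ↔ S ⊆ (N : Set (H →L[ℂ] H)) := by
  have hcoe : (generatedVN S : Set (H →L[ℂ] H)) =
      Set.centralizer (Set.centralizer (S ∪ star S)) := by
    change (StarSubalgebra.centralizer ℂ (StarSubalgebra.centralizer ℂ S : Set (H →L[ℂ] H)) :
      Set (H →L[ℂ] H)) = _
    have hs : star (StarSubalgebra.centralizer ℂ S : Set (H →L[ℂ] H)) =
        (StarSubalgebra.centralizer ℂ S : Set (H →L[ℂ] H)) := by
      ext x
      simp only [Set.mem_star, SetLike.mem_coe]
      exact star_mem_iff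
    rw [StarSubalgebra.coe_centralizer, hs, Set.union_self, StarSubalgebra.coe_centralizer]
  constructor
  · intro h x hx
    apply h
    change x ∈ (generatedVN S : Set (H →L[ℂ] H))
    rw [hcoe]
    exact Set.subset_centralizer_centralizer (Or.inl hx)
  · intro h x hx
    change x ∈ (generatedVN S : Set (H →L[ℂ] H)) at hx
    rw [hcoe] at hx
    change x ∈ (N : Set (H →L[ℂ] H))
    rw [← N.centralizer_centralizer]
    refine Set.centralizer_subset (Set.centralizer_subset ?_) hx
    rintro y (hy | hy)
    · exact h hy
    · have h1 : star y ∈ N := h hy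
      have h2 : star (star y) ∈ N := star_mem h1
      rwa [star_star] at h2

/-- A von Neumann algebra is hyperfinite if it is generated, as a von Neumann algebra, by an
increasing sequence of finite-dimensional (unital) *-subalgebras. -/
def IsHyperfinite (N : VonNeumannAlgebra H) : Prop :=
  ∃ B : ℕ → StarSubalgebra ℂ (H →L[ℂ] H), Monotone B ∧
    (∀ k, FiniteDimensional ℂ (B k)) ∧
    generatedVN (⋃ k, (B k : Set (H →L[ℂ] H))) = N

/-- `τ` is a normal tracial state on the von Neumann algebra `M`. Normality is continuity for the
ultraweak topology, i.e. `τ x = ∑ₖ ⟨ξₖ, x ηₖ⟩` with square-summable sequences of vectors. Together,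
`(M, τ)` is a tracial W*-probability space (faithfulness of `τ` is not required). -/
structure IsNormalTracialState (M : VonNeumannAlgebra H)
    (τ : M.toStarSubalgebra →ₗ[ℂ] ℂ) : Prop where
  map_one : τ 1 = 1
  nonneg : ∀ x, 0 ≤ τ (star x * x)
  trace : ∀ x y, τ (x * y) = τ (y * x)
  normal : ∃ ξ η : ℕ → H, (Summable fun k => ‖ξ k‖ ^ 2) ∧ (Summable fun k => ‖η k‖ ^ 2) ∧
    ∀ x : M.toStarSubalgebra, HasSum (fun k => inner ℂ (ξ k) ((x : H →L[ℂ] H) (η k))) (τ x)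

end VonNeumann

/-! ### Matrices -/

/-- The unitary group `U(N)`. -/
abbrev U (N : ℕ) : Type := Matrix.unitaryGroup (Fin N) ℂ

/-- The real vector space of self-adjoint `N × N` matrices. -/
abbrev Msa (N : ℕ) : Type := selfAdjoint (Matrix (Fin N) (Fin N) ℂ)

instance (N : ℕ) : MeasurableSpace (U N) := borel _

instance (N : ℕ) : BorelSpace (U N) := ⟨rfl⟩

instance (N : ℕ) : MeasurableSpace (Msa N) := borel _

instance (N : ℕ) : BorelSpace (Msa N) := ⟨rfl⟩

instance (N : ℕ) : CompactSpace (U N) := by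
  refine isCompact_iff_compactSpace.1
    (?_ : IsCompact (unitary (Matrix (Fin N) (Fin N) ℂ) : Set (Matrix (Fin N) (Fin N) ℂ)))
  have hK : IsCompact (Set.univ.pi fun _ : Fin N => Set.univ.pi fun _ : Fin N =>
      Metric.closedBall (0 : ℂ) 1) :=
    isCompact_univ_pi fun _ => isCompact_univ_pi fun _ => isCompact_closedBall 0 1
  refine IsCompact.of_isClosed_subset hK
    (isClosed_unitary (R := Matrix (Fin N) (Fin N) ℂ)) ?_
  intro V hV i _ j _
  simpa using entry_norm_bound_of_unitary hV i j

/-- The Haar probability measure on `U(N)`. -/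
def haarU (N : ℕ) : Measure (U N) := Measure.haarMeasure ⊤

instance (N : ℕ) : IsProbabilityMeasure (haarU N) := ⟨by
  simpa [haarU] using Measure.haarMeasure_self (K₀ := (⊤ : TopologicalSpace.PositiveCompacts (U N)))⟩

/-- The operator norm of a matrix acting on the Euclidean space `ℂ^N`. -/
def opNorm {N : ℕ} (A : Matrix (Fin N) (Fin N) ℂ) : ℝ :=
  ‖Matrix.toEuclideanCLM (n := Fin N) (𝕜 := ℂ) A‖

/-- The normalized trace. -/
def ntr {N : ℕ} (A : Matrix (Fin N) (Fin N) ℂ) : ℂ := (N : ℂ)⁻¹ * A.trace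

/-- Conjugation `U A U*` of a self-adjoint matrix by a unitary. -/
def conj {N : ℕ} (V : U N) (A : Msa N) : Msa N :=
  ⟨(V : Matrix (Fin N) (Fin N) ℂ) * (A : Matrix (Fin N) (Fin N) ℂ) *
    star (V : Matrix (Fin N) (Fin N) ℂ), IsSelfAdjoint.conjugate A.2 _⟩

/-- `n`-tuples of self-adjoint multi-matrices, the `i`-th one consisting of `r i` matrices. -/
abbrev MultiMat {n : ℕ} (r : Fin n → ℕ) (N : ℕ) : Type := (i : Fin n) → Fin (r i) → Msa N

instance (N : ℕ) : SecondCountableTopology (Msa N) :=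
  have : SecondCountableTopology (Matrix (Fin N) (Fin N) ℂ) :=
    inferInstanceAs (SecondCountableTopology (Fin N → Fin N → ℂ))
  Topology.IsInducing.subtypeVal.secondCountableTopology

instance (N : ℕ) : SecondCountableTopology (U N) :=
  have : SecondCountableTopology (Matrix (Fin N) (Fin N) ℂ) :=
    inferInstanceAs (SecondCountableTopology (Fin N → Fin N → ℂ))
  Topology.IsInducing.subtypeVal.secondCountableTopology

/-- The product σ-algebra on `MultiMat r N` is the Borel one. -/
instance {n : ℕ} (r : Fin n → ℕ) (N : ℕ) : BorelSpace (MultiMat r N) :=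
  inferInstance

/-- The map `Φ_N((U_i), (A_i)) = (U_i A_i U_i*)`. -/
def Phi {n : ℕ} {r : Fin n → ℕ} {N : ℕ} (p : (Fin n → U N) × MultiMat r N) : MultiMat r N :=
  fun i j => conj (p.1 i) (p.2 i j)

/-! ### Orbital free entropy -/

section Entropy

variable {H : Type*} [NormedAddCommGroup H] [InnerProductSpace ℂ H] [CompleteSpace H]
  {M : VonNeumannAlgebra H} (τ : M.toStarSubalgebra →ₗ[ℂ] ℂ)
  {n : ℕ} {r : Fin n → ℕ} (X : (i : Fin n) → Fin (r i) → M.toStarSubalgebra)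

/-- The matricial microstates `Γ_R(X₁ ⊔ ⋯ ⊔ Xₙ; N, m, δ)`, `R ∈ [0, ∞]`. A word in the letters
`(i, j)` of length between `1` and `m` is a non-empty list of pairs. -/
def microstates (R : ℝ≥0∞) (N m : ℕ) (δ : ℝ) : Set (MultiMat r N) :=
  {A | (∀ i j, ENNReal.ofReal (opNorm (A i j : Matrix (Fin N) (Fin N) ℂ)) ≤ R) ∧
    ∀ w : List (Σ i : Fin n, Fin (r i)), w ≠ [] → w.length ≤ m →
      ‖ntr (w.map fun p => (A p.1 p.2 : Matrix (Fin N) (Fin N) ℂ)).prod -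
        τ (w.map fun p => X p.1 p.2).prod‖ < δ}

/-- The orbital microstates `Γ_orb(X₁, …, Xₙ : (A_i); N, m, δ)`. -/
def orbMicrostates {N : ℕ} (A : MultiMat r N) (m : ℕ) (δ : ℝ) : Set (Fin n → U N) :=
  {V | Phi (V, A) ∈ microstates τ X ∞ N m δ}

/-- `χ_{orb,R}(X₁, …, Xₙ; N, m, δ; μ)`. Here `ENNReal.log 0 = ⊥`. -/
def chiOrbMu (R : ℝ≥0∞) (N m : ℕ) (δ : ℝ) (μ : Measure (MultiMat r N)) : EReal :=
  ENNReal.log (((Measure.pi fun _ : Fin n => haarU N).prod μ)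
    (Phi ⁻¹' microstates τ X R N m δ))

/-- `χ_{orb,R}(X₁, …, Xₙ; N, m, δ)`: the supremum over all Borel probability measures. -/
def chiOrbN (R : ℝ≥0∞) (N m : ℕ) (δ : ℝ) : EReal :=
  ⨆ (μ : Measure (MultiMat r N)) (_ : IsProbabilityMeasure μ), chiOrbMu τ X R N m δ μ

/-- `χ_{orb,R}(X₁, …, Xₙ; m, δ)`. -/
def chiOrbMDelta (R : ℝ≥0∞) (m : ℕ) (δ : ℝ) : EReal :=
  limsup (fun N : ℕ => ((((N : ℝ) ^ 2)⁻¹ : ℝ) : EReal) * chiOrbN τ X R N m δ) atTop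

/-- `χ_{orb,R}(X₁, …, Xₙ)`: the infimum over `m` and `δ > 0`, which is the limit as `m → ∞`,
`δ ↘ 0` by `tendsto_chiOrbR` below. -/
def chiOrbR (R : ℝ≥0∞) : EReal :=
  ⨅ (m : ℕ) (δ : ℝ) (_ : 0 < δ), chiOrbMDelta τ X R m δ

/-- The orbital free entropy `χ_orb(X₁, …, Xₙ)`, without any hyperfiniteness assumption. -/
def chiOrb : EReal :=
  ⨆ (R : ℝ≥0∞) (_ : 0 < R) (_ : R < ∞), chiOrbR τ X R

/-- `Ξ i N j = ξ_{ij}(N)` are self-adjoint `N × N` matrices with `‖ξ_{ij}(N)‖ ≤ ‖X_{ij}‖`, such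
that for each `i` the multi-matrices `Ξ_i(N)` converge in moments to `X_i` as `N → ∞`. -/
structure IsApproximating (Ξ : (i : Fin n) → (N : ℕ) → Fin (r i) → Msa N) : Prop where
  norm_le : ∀ i N j, opNorm (Ξ i N j : Matrix (Fin N) (Fin N) ℂ) ≤ ‖(X i j : H →L[ℂ] H)‖
  tendsto : ∀ (i : Fin n) (P : FreeAlgebra ℂ (Fin (r i))),
    Tendsto (fun N : ℕ =>
        ntr (FreeAlgebra.lift ℂ (fun j => (Ξ i N j : Matrix (Fin N) (Fin N) ℂ)) P))
      atTop (𝓝 (τ (FreeAlgebra.lift ℂ (X i) P)))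

/-- `limsup_N N⁻² log γ^{⊗n}(Γ_orb(X₁, …, Xₙ : (Ξ_i(N)); N, m, δ))`. -/
def chiOrbOldMDelta (Ξ : (i : Fin n) → (N : ℕ) → Fin (r i) → Msa N) (m : ℕ) (δ : ℝ) : EReal :=
  limsup (fun N : ℕ => ((((N : ℝ) ^ 2)⁻¹ : ℝ) : EReal) *
    ENNReal.log ((Measure.pi fun _ : Fin n => haarU N)
      (orbMicrostates τ X (fun i => Ξ i N) m δ))) atTop

/-- The original (Hiai–Miyamoto–Ueda) orbital free entropy, computed from the approximating
multi-matrices `Ξ_i(N)`: the infimum over `m` and `δ > 0`, which is the limit as `m → ∞`,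
`δ ↘ 0` by `tendsto_chiOrbOld` below. -/
def chiOrbOld (Ξ : (i : Fin n) → (N : ℕ) → Fin (r i) → Msa N) : EReal :=
  ⨅ (m : ℕ) (δ : ℝ) (_ : 0 < δ), chiOrbOldMDelta τ X Ξ m δ

/-! ### The infima are limits -/

theorem microstates_mono (R : ℝ≥0∞) (N : ℕ) {m m' : ℕ} {δ δ' : ℝ} (hm : m' ≤ m) (hδ : δ ≤ δ') :
    microstates τ X R N m δ ⊆ microstates τ X R N m' δ' :=
  fun _ hA => ⟨hA.1, fun w h0 hw => (hA.2 w h0 (hw.trans hm)).trans_le hδ⟩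

theorem tendsto_of_monotone (f : ℕ → ℝ → EReal)
    (hf : ∀ m m' δ δ', m' ≤ m → δ ≤ δ' → f m δ ≤ f m' δ') :
    Tendsto (fun p : ℕ × ℝ => f p.1 p.2) (atTop ×ˢ 𝓝[>] 0)
      (𝓝 (⨅ (m : ℕ) (δ : ℝ) (_ : 0 < δ), f m δ)) := by
  refine tendsto_order.2 ⟨fun a ha => ?_, fun a ha => ?_⟩
  · have h : ∀ᶠ p : ℕ × ℝ in atTop ×ˢ 𝓝[>] 0, 0 < p.2 :=
      tendsto_snd.eventually (eventually_mem_nhdsWithin (a := (0 : ℝ)) (s := Ioi 0))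
    filter_upwards [h] with p hp
    exact ha.trans_le (iInf_le_of_le p.1 (iInf_le_of_le p.2 (iInf_le _ hp)))
  · simp only [iInf_lt_iff] at ha
    obtain ⟨m, δ, hδ, hlt⟩ := ha
    have h1 : ∀ᶠ p : ℕ × ℝ in atTop ×ˢ 𝓝[>] (0 : ℝ), m ≤ p.1 :=
      tendsto_fst.eventually (eventually_ge_atTop m)
    have h2 : ∀ᶠ p : ℕ × ℝ in atTop ×ˢ 𝓝[>] (0 : ℝ), p.2 < δ :=
      tendsto_snd.eventually (eventually_nhdsWithin_of_eventually_nhds (eventually_lt_nhds hδ))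
    filter_upwards [h1, h2] with p hp1 hp2
    exact (hf _ _ _ _ hp1 hp2.le).trans_lt hlt

theorem tendsto_chiOrbR (R : ℝ≥0∞) :
    Tendsto (fun p : ℕ × ℝ => chiOrbMDelta τ X R p.1 p.2) (atTop ×ˢ 𝓝[>] 0)
      (𝓝 (chiOrbR τ X R)) := by
  refine tendsto_of_monotone _ fun m m' δ δ' hm hδ => limsup_le_limsup ?_
  refine Eventually.of_forall fun N => mul_le_mul_of_nonneg_left ?_ ?_
  · exact iSup₂_mono fun μ _ => ENNReal.log_monotone
      (measure_mono (preimage_mono (microstates_mono τ X R N hm hδ)))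
  · exact_mod_cast inv_nonneg.2 (sq_nonneg (N : ℝ))

theorem tendsto_chiOrbOld (Ξ : (i : Fin n) → (N : ℕ) → Fin (r i) → Msa N) :
    Tendsto (fun p : ℕ × ℝ => chiOrbOldMDelta τ X Ξ p.1 p.2) (atTop ×ˢ 𝓝[>] 0)
      (𝓝 (chiOrbOld τ X Ξ)) := by
  refine tendsto_of_monotone _ fun m m' δ δ' hm hδ => limsup_le_limsup ?_
  refine Eventually.of_forall fun N => mul_le_mul_of_nonneg_left ?_ ?_
  · exact ENNReal.log_monotone
      (measure_mono fun V hV => microstates_mono τ X ∞ N hm hδ hV)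
  · exact_mod_cast inv_nonneg.2 (sq_nonneg (N : ℝ))

end Entropy

end OrbitalFreeEntropy

end

/-!
Only the *unitary orbits* of the components of a microstate matter for the orbital free entropy, and
for a hyperfinite tuple there is asymptotically only one unitary orbit of microstates (Jung). This is
the content of `HasFrameApprox.eventually_exists_unitary`: if two bounded tuples of `N × N` matrices
have nearly the moments of the hyperfinite tuple `X`, then a unitary intertwines them up to a small
error in the normalized Hilbert–Schmidt norm, uniformly in `N`.

To see this, approximate `X` in the 2-norm by a tuple in a finite-dimensional *-algebra, spanned by
products `uᵢ uₗ*` of partial isometries (`IsNormalTracialState.hasFrameApprox`). The `uᵢ` are 2-norm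
limits of polynomials in `X` (a double commutant argument) that are bounded uniformly on *all*
self-adjoint tuples of a given norm; the bounded transform `2x(1 + x* x)⁻¹`, which fixes partial
isometries, takes the place of Kaplansky's density theorem. Evaluated at microstates, these
polynomials satisfy the relations of the `uᵢ` approximately, in 2-norm. Such approximate frames `u`,
`v` in `M_N(ℂ)` with the same traces are nearly conjugate (`IsApproxFrame.exists_unitary`): match the
spectral subspaces of `uₛ* uₛ` and `vₛ* vₛ` by a unitary `Zₛ` for one `s` in each class, put
`T = ∑ uᵢ Z_{c i} vᵢ*`, and replace the near-isometry `T` by a unitary.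

Conversely a frame of matrix units has matrix models, in which a projection of trace `t` becomes one
of rank `⌊t N⌋`; cutting these off at the norms of the `X k` gives the approximating multi-matrices
(`HasFrameApprox.exists_approximating`). Cutting off is harmless for arbitrary microstates
(`eventually_exists_truncation`), so that no norm bound, `R = ∞`, is needed.

For the entropies, let `A` be a multi-matrix that has an orbital microstate. Its components are
microstates of the `X i`, hence nearly conjugate to the `Ξ i` by unitaries `W i`, and right translation
by `W` carries the orbital microstates of `A` into those of `Ξ` for slightly weaker tolerances
(`exists_eventually_orbMicrostates_subset`). As the Haar measure is right-invariant, averaging over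
`A` with respect to any `μ` gives `chiOrbR_le_chiOrbOld`. The choice of the Dirac measure at `Ξ` gives
the reverse inequality.
-/

namespace OrbitalFreeEntropy

/-! ### The 2-norm of a tracial state -/

section TracialState

variable {𝒜 : Type*} [CStarAlgebra 𝒜]

/-- A (not necessarily faithful) tracial state on a unital C*-algebra. -/
structure IsTracialState (φ : 𝒜 →ₗ[ℂ] ℂ) : Prop where
  map_one : φ 1 = 1
  nonneg : ∀ x, 0 ≤ φ (star x * x)
  trace : ∀ x y, φ (x * y) = φ (y * x)

/-- The 2-norm `‖x‖₂ = φ(x* x)^{1/2}` of a tracial state. It is a seminorm. -/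
noncomputable def norm2 (φ : 𝒜 →ₗ[ℂ] ℂ) (x : 𝒜) : ℝ := √(φ (star x * x)).re

variable {φ : 𝒜 →ₗ[ℂ] ℂ}

theorem norm2_nonneg (x : 𝒜) : 0 ≤ norm2 φ x := Real.sqrt_nonneg _

namespace IsTracialState

variable (hφ : IsTracialState φ)
include hφ

theorem re_nonneg (x : 𝒜) : 0 ≤ (φ (star x * x)).re := (Complex.le_def.1 (hφ.nonneg x)).1

theorem im_eq_zero (x : 𝒜) : (φ (star x * x)).im = 0 :=
  ((Complex.le_def.1 (hφ.nonneg x)).2).symm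

theorem norm2_sq (x : 𝒜) : norm2 φ x ^ 2 = (φ (star x * x)).re :=
  Real.sq_sqrt (hφ.re_nonneg x)

theorem ofReal_norm2_sq (x : 𝒜) : ((norm2 φ x ^ 2 : ℝ) : ℂ) = φ (star x * x) := by
  rw [hφ.norm2_sq]
  exact Complex.ext rfl (hφ.im_eq_zero x).symm

/-- A positive functional is Hermitian. -/
theorem map_star_mul (x y : 𝒜) : φ (star y * x) = star (φ (star x * y)) := by
  have h1 := hφ.im_eq_zero (x + y)
  have h2 := hφ.im_eq_zero (x + Complex.I • y)
  have hx := hφ.im_eq_zero x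
  have hy := hφ.im_eq_zero y
  simp only [star_add, star_smul, add_mul, mul_add, map_add, smul_mul_assoc, mul_smul_comm,
    map_smul, smul_eq_mul, Complex.star_def, Complex.conj_I, Complex.add_im, Complex.mul_im,
    Complex.neg_im, Complex.neg_re, Complex.I_re, Complex.I_im, hx, hy, Complex.mul_re] at h1 h2
  apply Complex.ext
  · simp only [Complex.star_def, Complex.conj_re]
    linarith
  · simp only [Complex.star_def, Complex.conj_im]
    linarith

theorem preInnerCore : ∃ c : PreInnerProductSpace.Core ℂ 𝒜,
    ∀ x y, c.inner x y = φ (star x * y) :=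
  ⟨{ inner := fun x y => φ (star x * y)
     conj_inner_symm := fun x y => (hφ.map_star_mul y x).symm
     re_inner_nonneg := fun x => hφ.re_nonneg x
     add_left := fun x y z => by simp [add_mul]
     smul_left := fun x y r => by simp }, fun _ _ => rfl⟩

/-- The Cauchy–Schwarz inequality. -/
theorem norm_map_star_mul_le (x y : 𝒜) : ‖φ (star x * y)‖ ≤ norm2 φ x * norm2 φ y := by
  obtain ⟨c, hc⟩ := hφ.preInnerCore
  have h := @InnerProductSpace.Core.inner_mul_inner_self_le ℂ 𝒜 _ _ _ c x y
  change ‖c.inner x y‖ * ‖c.inner y x‖ ≤ (c.inner x x).re * (c.inner y y).re at h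
  rw [hc, hc, hc, hc, hφ.map_star_mul x y, norm_star, ← hφ.norm2_sq, ← hφ.norm2_sq,
    ← mul_pow, ← sq] at h
  exact (sq_le_sq₀ (norm_nonneg _) (mul_nonneg (norm2_nonneg _) (norm2_nonneg _))).1 h

theorem norm2_star (x : 𝒜) : norm2 φ (star x) = norm2 φ x := by
  rw [norm2, norm2, star_star, hφ.trace]

theorem norm_map_mul_le (x y : 𝒜) : ‖φ (x * y)‖ ≤ norm2 φ x * norm2 φ y := by
  simpa [hφ.norm2_star] using hφ.norm_map_star_mul_le (star x) y

theorem norm2_one : norm2 φ 1 = 1 := by simp [norm2, hφ.map_one]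

theorem norm_map_le (x : 𝒜) : ‖φ x‖ ≤ norm2 φ x := by
  simpa [hφ.norm2_one] using hφ.norm_map_mul_le 1 x

theorem norm2_add_le (x y : 𝒜) : norm2 φ (x + y) ≤ norm2 φ x + norm2 φ y := by
  refine abs_le_of_sq_le_sq' ?_ (add_nonneg (norm2_nonneg _) (norm2_nonneg _)) |>.2
  have h1 := (Complex.re_le_norm _).trans (hφ.norm_map_star_mul_le x y)
  have h2 := (Complex.re_le_norm _).trans (hφ.norm_map_star_mul_le y x)
  have : norm2 φ (x + y) ^ 2 = norm2 φ x ^ 2 + (φ (star x * y)).re + (φ (star y * x)).re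
      + norm2 φ y ^ 2 := by
    simp only [hφ.norm2_sq, star_add, add_mul, mul_add, map_add, Complex.add_re]
    ring
  rw [this]
  nlinarith

end IsTracialState

theorem norm2_smul (c : ℂ) (x : 𝒜) : norm2 φ (c • x) = ‖c‖ * norm2 φ x := by
  have : (φ (star (c • x) * (c • x))).re = ‖c‖ ^ 2 * (φ (star x * x)).re := by
    rw [star_smul, smul_mul_assoc, mul_smul_comm, smul_smul, map_smul, smul_eq_mul,
      Complex.star_def, ← Complex.normSq_eq_conj_mul_self, Complex.re_ofReal_mul,
      Complex.normSq_eq_norm_sq]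
  rw [norm2, norm2, this, Real.sqrt_mul (sq_nonneg _), Real.sqrt_sq (norm_nonneg _)]

@[simp] theorem norm2_zero : norm2 φ (0 : 𝒜) = 0 := by simp [norm2]

@[simp] theorem norm2_neg (x : 𝒜) : norm2 φ (-x) = norm2 φ x := by simp [norm2]

theorem norm2_sub_comm (x y : 𝒜) : norm2 φ (x - y) = norm2 φ (y - x) := by
  rw [← norm2_neg, neg_sub]

namespace IsTracialState

variable (hφ : IsTracialState φ)
include hφ

theorem norm2_sub_le (x y : 𝒜) : norm2 φ (x - y) ≤ norm2 φ x + norm2 φ y := by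
  simpa [sub_eq_add_neg] using hφ.norm2_add_le x (-y)

theorem norm2_sub_le_add (x y z : 𝒜) :
    norm2 φ (x - z) ≤ norm2 φ (x - y) + norm2 φ (y - z) := by
  simpa using hφ.norm2_add_le (x - y) (y - z)

theorem norm2_sum_le {ι : Type*} (s : Finset ι) (f : ι → 𝒜) :
    norm2 φ (∑ i ∈ s, f i) ≤ ∑ i ∈ s, norm2 φ (f i) := by
  classical
  induction s using Finset.induction_on with
  | empty => simp
  | insert a s ha ih =>
    rw [Finset.sum_insert ha, Finset.sum_insert ha]
    exact (hφ.norm2_add_le _ _).trans (by gcongr)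

theorem norm2_mul_le (x y : 𝒜) : norm2 φ (x * y) ≤ ‖x‖ * norm2 φ y := by
  let _ := CStarAlgebra.spectralOrder 𝒜
  have := CStarAlgebra.spectralOrderedRing 𝒜
  have h0 : 0 ≤ algebraMap ℝ 𝒜 (‖x‖ ^ 2) - star x * x :=
    sub_nonneg.2 CStarAlgebra.star_mul_le_algebraMap_norm_sq
  obtain ⟨s, hs⟩ := CStarAlgebra.nonneg_iff_eq_star_mul_self.1 h0
  have h1 := hφ.re_nonneg (s * y)
  have h2 : star (s * y) * (s * y) =
      ((‖x‖ ^ 2 : ℝ) : ℂ) • (star y * y) - star (x * y) * (x * y) := by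
    calc star (s * y) * (s * y) = star y * (star s * s) * y := by simp [mul_assoc]
      _ = _ := by
        rw [← hs, Algebra.algebraMap_eq_smul_one, mul_sub, sub_mul, mul_smul_comm, mul_one,
          smul_mul_assoc, Complex.coe_smul]
        simp [mul_assoc]
  rw [h2, map_sub, map_smul, smul_eq_mul, Complex.sub_re, Complex.re_ofReal_mul,
    ← hφ.norm2_sq, ← hφ.norm2_sq, ← mul_pow, sub_nonneg] at h1
  exact (sq_le_sq₀ (norm2_nonneg _) (mul_nonneg (norm_nonneg _) (norm2_nonneg _))).1 h1

theorem norm2_mul_le' (x y : 𝒜) : norm2 φ (x * y) ≤ norm2 φ x * ‖y‖ := by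
  rw [← hφ.norm2_star, star_mul, mul_comm (norm2 φ x), ← norm_star y, ← hφ.norm2_star x]
  exact hφ.norm2_mul_le _ _

theorem norm2_le (x : 𝒜) : norm2 φ x ≤ ‖x‖ := by
  simpa [hφ.norm2_one] using hφ.norm2_mul_le x 1

/-- The telescoping induction: the prefix `v` collects the letters of `w` already passed. -/
theorem norm_map_word_sub_le_aux {κ : Type*} {a b : κ → 𝒜} {L c ε : ℝ} {m : ℕ} (hc : 1 ≤ c)
    (hε : 0 ≤ ε) (hL : ∀ v : List κ, v.length < m → norm2 φ (v.map a).prod ≤ L)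
    (hb : ∀ k, ‖b k‖ ≤ c) (hab : ∀ k, norm2 φ (a k - b k) ≤ ε) (w : List κ) :
    ∀ v : List κ, v.length + w.length ≤ m →
    ‖φ ((v.map a).prod * (w.map a).prod) - φ ((v.map a).prod * (w.map b).prod)‖ ≤
      w.length * (L * (ε * c ^ m)) := by
  induction w with
  | nil => simp
  | cons x w ih =>
    intro v hv
    simp only [List.length_cons] at hv
    have h1 := ih (v ++ [x]) (by simp; omega)
    have hn : ∀ u : List κ, ‖(u.map b).prod‖ ≤ c ^ u.length * ‖(1 : 𝒜)‖ := by
      intro u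
      induction u with
      | nil => simp
      | cons y u ihu =>
        simp only [List.map_cons, List.prod_cons, List.length_cons, pow_succ']
        exact (norm_mul_le _ _).trans (by rw [mul_assoc]; gcongr; exact hb y)
    have h2 : ‖φ ((v.map a).prod * ((a x - b x) * (w.map b).prod))‖ ≤ L * (ε * c ^ m) := by
      refine (hφ.norm_map_mul_le _ _).trans ?_
      have hL0 : 0 ≤ L := (norm2_nonneg _).trans (hL [] (by simp; omega))
      gcongr
      · exact norm2_nonneg _
      · exact hL v (by omega)
      · refine (hφ.norm2_mul_le' _ _).trans ?_
        gcongr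
        · exact hab x
        · refine (hn w).trans ?_
          have : ‖(1 : 𝒜)‖ ≤ 1 := by
            rcases subsingleton_or_nontrivial 𝒜 with h | h
            · rw [Subsingleton.elim (1 : 𝒜) 0]; simp
            · exact CStarRing.norm_one.le
          refine (mul_le_of_le_one_right (by positivity) this).trans ?_
          exact pow_le_pow_right₀ hc (by omega)
    have h3 : φ ((v.map a).prod * ((x :: w).map a).prod) -
        φ ((v.map a).prod * ((x :: w).map b).prod) =
        (φ (((v ++ [x]).map a).prod * (w.map a).prod) -
          φ (((v ++ [x]).map a).prod * (w.map b).prod)) +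
        φ ((v.map a).prod * ((a x - b x) * (w.map b).prod)) := by
      rw [← map_sub, ← map_sub, ← map_add]
      congr 1
      simp only [List.map_cons, List.prod_cons, List.map_append, List.map_nil, List.prod_append,
        List.prod_nil, mul_one]
      noncomm_ring
    rw [h3]
    refine (norm_add_le _ _).trans ?_
    push_cast [List.length_cons]
    linarith

/-- Words in two tuples `a`, `b` have close traces if `a` and `b` are close in 2-norm, `b` is
bounded in norm, and words in `a` are bounded in 2-norm. This telescoping argument needs no bound on
`‖a‖`, which is what makes microstates without a norm cut-off accessible. -/
theorem norm_map_word_sub_le {κ : Type*} {a b : κ → 𝒜} {L c ε : ℝ} {m : ℕ} (hc : 1 ≤ c)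
    (hε : 0 ≤ ε) (hL : ∀ v : List κ, v.length < m → norm2 φ (v.map a).prod ≤ L)
    (hb : ∀ k, ‖b k‖ ≤ c) (hab : ∀ k, norm2 φ (a k - b k) ≤ ε) {w : List κ} (hw : w.length ≤ m) :
    ‖φ (w.map a).prod - φ (w.map b).prod‖ ≤ m * (L * (ε * c ^ m)) := by
  rcases w with _ | ⟨x, w⟩
  · simp only [List.map_nil, sub_self, norm_zero]
    rcases m with _ | m
    · simp
    · have hL0 : 0 ≤ L := (norm2_nonneg _).trans (hL [] (by simp))
      positivity
  · have h := hφ.norm_map_word_sub_le_aux hc hε hL hb hab (x :: w) [] (by simpa using hw)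
    simp only [List.map_nil, List.prod_nil, one_mul] at h
    refine h.trans ?_
    have hL0 : 0 ≤ L := (norm2_nonneg _).trans (hL [] (by simp at hw ⊢; omega))
    gcongr

end IsTracialState

end TracialState

/-! ### A bounded transform replacing Kaplansky's density theorem -/

section BoundedTransform

variable {𝒜 : Type*} [CStarAlgebra 𝒜]

theorem norm_one_le_one : ‖(1 : 𝒜)‖ ≤ 1 := by
  rcases subsingleton_or_nontrivial 𝒜 with h | h
  · rw [Subsingleton.elim (1 : 𝒜) 0]; simp
  · exact CStarRing.norm_one.le

/-- The elements `(1 + x* x)⁻¹` exist, are contractions, and are uniformly approximated by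
polynomials in `x* x`, in terms of an upper bound of `‖x‖²` only. -/
theorem exists_inv_one_add_star_mul_self (x : 𝒜) {C : ℝ} (hC : ‖x‖ ^ 2 ≤ C) :
    ∃ y : 𝒜, (1 + star x * x) * y = 1 ∧ y * (1 + star x * x) = 1 ∧ star y = y ∧ ‖y‖ ≤ 1 ∧
      ∀ n : ℕ, ‖y - (((1 + C : ℝ) : ℂ)⁻¹ • ∑ k ∈ Finset.range n,
        (((1 + C : ℝ) : ℂ)⁻¹ • (((C : ℝ) : ℂ) • 1 - star x * x)) ^ k)‖ ≤ (C / (1 + C)) ^ n := by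
  have hC0 : 0 ≤ C := (sq_nonneg _).trans hC
  have hC1 : 0 < 1 + C := by linarith
  have hCC : ((1 + C : ℝ) : ℂ) ≠ 0 := by exact_mod_cast hC1.ne'
  set D : ℂ := ((1 + C : ℝ) : ℂ) with hD
  set s : 𝒜 := star x * x with hs
  set a : 𝒜 := D⁻¹ • (((C : ℝ) : ℂ) • 1 - s) with ha
  have hsa : IsSelfAdjoint s := IsSelfAdjoint.star_mul_self x
  have ha_sa : star a = a := by
    simp only [ha, hD, star_smul, star_sub, star_one, hsa.star_eq, Complex.star_def, map_inv₀,
      Complex.conj_ofReal]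
  have hnorm : ‖((C : ℝ) : ℂ) • (1 : 𝒜) - s‖ ≤ C := by
    let _ := CStarAlgebra.spectralOrder 𝒜
    have := CStarAlgebra.spectralOrderedRing 𝒜
    have h1 : ((C : ℝ) : ℂ) • (1 : 𝒜) = algebraMap ℝ 𝒜 C := by
      rw [Algebra.algebraMap_eq_smul_one, Complex.coe_smul]
    have h2 : 0 ≤ s := star_mul_self_nonneg x
    have h3 : s ≤ algebraMap ℝ 𝒜 C :=
      CStarAlgebra.star_mul_le_algebraMap_norm_sq.trans (algebraMap_mono 𝒜 hC)
    rw [h1]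
    exact ((CStarAlgebra.mem_Icc_algebraMap_iff_norm_le hC0).1
      ⟨sub_nonneg.2 h3, sub_le_self _ h2⟩).2
  have hθ : ‖a‖ ≤ C / (1 + C) := by
    rw [ha, norm_smul, norm_inv, hD, Complex.norm_real, Real.norm_of_nonneg hC1.le,
      inv_mul_eq_div]
    gcongr
  have hθ1 : C / (1 + C) < 1 := by rw [div_lt_one hC1]; linarith
  have ha1 : ‖a‖ < 1 := hθ.trans_lt hθ1
  set v : 𝒜ˣ := Units.oneSub a ha1 with hv
  have hv1 : (v : 𝒜) = 1 - a := rfl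
  have h1s : 1 + s = D • (v : 𝒜) := by
    rw [hv1, ha, smul_sub, smul_inv_smul₀ hCC, hD]
    push_cast
    rw [add_smul, one_smul]
    abel
  have hvn : ‖((v⁻¹ : 𝒜ˣ) : 𝒜)‖ ≤ 1 + C := by
    have h1 : ((v⁻¹ : 𝒜ˣ) : 𝒜) = 1 + a * ((v⁻¹ : 𝒜ˣ) : 𝒜) := by
      have := v.mul_inv
      rw [hv1, sub_mul, one_mul] at this
      rw [← this]; abel
    have h2 : ‖((v⁻¹ : 𝒜ˣ) : 𝒜)‖ ≤ 1 + C / (1 + C) * ‖((v⁻¹ : 𝒜ˣ) : 𝒜)‖ := by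
      conv_lhs => rw [h1]
      refine (norm_add_le _ _).trans (add_le_add norm_one_le_one ?_)
      exact (norm_mul_le _ _).trans (by gcongr)
    have h3 : C / (1 + C) = 1 - 1 / (1 + C) := by field_simp; ring
    rw [h3] at h2
    have h4 : 1 / (1 + C) * ‖((v⁻¹ : 𝒜ˣ) : 𝒜)‖ ≤ 1 := by linarith
    rwa [one_div, inv_mul_le_iff₀ hC1, mul_one] at h4
  have hDn : ‖D⁻¹‖ = (1 + C)⁻¹ := by
    rw [norm_inv, hD, Complex.norm_real, Real.norm_of_nonneg hC1.le]
  have hyn : ‖D⁻¹ • ((v⁻¹ : 𝒜ˣ) : 𝒜)‖ ≤ 1 := by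
    rw [norm_smul, hDn, inv_mul_le_iff₀ hC1, mul_one]
    exact hvn
  refine ⟨D⁻¹ • ((v⁻¹ : 𝒜ˣ) : 𝒜), ?_, ?_, ?_, hyn, fun n => ?_⟩
  · rw [h1s, smul_mul_smul_comm, mul_inv_cancel₀ hCC, v.mul_inv, one_smul]
  · rw [h1s, smul_mul_smul_comm, inv_mul_cancel₀ hCC, v.inv_mul, one_smul]
  · have h1 : star ((v⁻¹ : 𝒜ˣ) : 𝒜) = ((v⁻¹ : 𝒜ˣ) : 𝒜) := by
      rw [← Units.coe_star_inv]
      congr 2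
      ext
      rw [Units.coe_star, hv1, star_sub, star_one, ha_sa]
    rw [star_smul, h1, hD, Complex.star_def, map_inv₀, Complex.conj_ofReal]
  · have h1 : ((v⁻¹ : 𝒜ˣ) : 𝒜) - ∑ k ∈ Finset.range n, a ^ k = ((v⁻¹ : 𝒜ˣ) : 𝒜) * a ^ n := by
      have h2 := mul_neg_geom_sum a n
      have h3 : ∑ k ∈ Finset.range n, a ^ k = ((v⁻¹ : 𝒜ˣ) : 𝒜) * (1 - a ^ n) := by
        rw [← h2, ← hv1, ← mul_assoc, v.inv_mul, one_mul]
      rw [h3, mul_sub, mul_one, sub_sub_cancel]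
    rw [← smul_sub, h1, ← smul_mul_assoc]
    have h4 : ‖a ^ n‖ ≤ (C / (1 + C)) ^ n := by
      rcases n with _ | n
      · simpa using norm_one_le_one (𝒜 := 𝒜)
      · exact (norm_pow_le' a n.succ_pos).trans (by gcongr)
    refine (norm_mul_le _ _).trans ?_
    exact (mul_le_mul hyn h4 (norm_nonneg _) zero_le_one).trans_eq (one_mul _)

/-- The bounded transform `x ↦ 2x(1 + x* x)⁻¹` from the proof of Kaplansky's density theorem. -/
noncomputable def bddTransform (x : 𝒜) : 𝒜 := 2 * x * Ring.inverse (1 + star x * x)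

theorem inverse_spec (x : 𝒜) :
    (1 + star x * x) * Ring.inverse (1 + star x * x) = 1 ∧
    Ring.inverse (1 + star x * x) * (1 + star x * x) = 1 ∧
    star (Ring.inverse (1 + star x * x)) = Ring.inverse (1 + star x * x) ∧
    ‖Ring.inverse (1 + star x * x)‖ ≤ 1 ∧ ∀ (C : ℝ), ‖x‖ ^ 2 ≤ C →
      ∀ n : ℕ, ‖Ring.inverse (1 + star x * x) - (((1 + C : ℝ) : ℂ)⁻¹ • ∑ k ∈ Finset.range n,
        (((1 + C : ℝ) : ℂ)⁻¹ • (((C : ℝ) : ℂ) • 1 - star x * x)) ^ k)‖ ≤ (C / (1 + C)) ^ n := by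
  have key : ∀ y : 𝒜, (1 + star x * x) * y = 1 → y * (1 + star x * x) = 1 →
      Ring.inverse (1 + star x * x) = y := by
    intro y h1 h2
    exact Ring.inverse_unit (⟨1 + star x * x, y, h1, h2⟩ : 𝒜ˣ)
  obtain ⟨y, h1, h2, h3, h4, -⟩ := exists_inv_one_add_star_mul_self x le_rfl
  rw [key y h1 h2]
  refine ⟨h1, h2, h3, h4, fun C hC n => ?_⟩
  obtain ⟨y', h1', h2', -, -, h5'⟩ := exists_inv_one_add_star_mul_self x hC
  rw [← key y h1 h2, key y' h1' h2']
  exact h5' n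

theorem bddTransform_eq {z w : 𝒜} (h : w * (1 + star z * z) = 2 * z) : bddTransform z = w := by
  rw [bddTransform, ← h, mul_assoc, (inverse_spec z).1, mul_one]

theorem bddTransform_of_partialIsometry {u : 𝒜} (h : u * star u * u = u) :
    bddTransform u = u :=
  bddTransform_eq (by rw [mul_add, ← mul_assoc, h, mul_one, two_mul])

theorem norm_mul_inverse_le (x : 𝒜) : ‖x * Ring.inverse (1 + star x * x)‖ ≤ 3 / 2 := by
  obtain ⟨h1, h2, h3, h4, -⟩ := inverse_spec x
  set y := Ring.inverse (1 + star x * x)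
  have h5 : star (x * y) * (x * y) = (1 - y) * y := by
    rw [star_mul, h3]
    calc y * star x * (x * y) = (y * (1 + star x * x) - y) * y := by noncomm_ring
      _ = (1 - y) * y := by rw [h2]
  have h6 : ‖x * y‖ * ‖x * y‖ ≤ 2 := by
    rw [← CStarRing.norm_star_mul_self, h5]
    refine (norm_mul_le _ _).trans ?_
    have : ‖1 - y‖ ≤ 2 := (norm_sub_le _ _).trans (by linarith [norm_one_le_one (𝒜 := 𝒜)])
    nlinarith [norm_nonneg (1 - y), norm_nonneg y]
  nlinarith [norm_nonneg (x * y)]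

theorem norm_bddTransform_le (x : 𝒜) : ‖bddTransform x‖ ≤ 3 := by
  have := norm_mul_inverse_le x
  rw [bddTransform, mul_assoc, two_mul]
  exact (norm_add_le _ _).trans (by linarith)

theorem norm_mul_inverse_mul_star_le (x : 𝒜) :
    ‖x * Ring.inverse (1 + star x * x) * star x‖ ≤ 3 := by
  have h0 := norm_mul_inverse_le x
  obtain ⟨h1, h2, h3, h4, -⟩ := inverse_spec x
  set y := Ring.inverse (1 + star x * x)
  set b := x * y * star x with hb
  have hbs : star b = b := by simp [hb, h3, mul_assoc]
  have h5 : star b * b = b - (x * y) * star (x * y) := by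
    rw [hbs, star_mul, h3, hb]
    calc x * y * star x * (x * y * star x)
        = x * (y * (1 + star x * x) - y) * y * star x := by noncomm_ring
      _ = x * y * star x - x * y * (y * star x) := by rw [h2]; noncomm_ring
  have h6 : ‖b‖ * ‖b‖ ≤ ‖b‖ + 9 / 4 := by
    rw [← CStarRing.norm_star_mul_self, h5]
    refine (norm_sub_le _ _).trans ?_
    rw [CStarRing.norm_self_mul_star]
    nlinarith [norm_nonneg (x * y)]
  nlinarith [norm_nonneg b]

/-- The bounded transform is Lipschitz for the 2-norm of a tracial state. -/
theorem IsTracialState.norm2_bddTransform_sub_le {φ : 𝒜 →ₗ[ℂ] ℂ} (hφ : IsTracialState φ)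
    (x z : 𝒜) : norm2 φ (bddTransform x - bddTransform z) ≤ 13 * norm2 φ (x - z) := by
  have hx3 := norm_mul_inverse_mul_star_le x
  have hxy := norm_mul_inverse_le x
  have hz := norm_mul_inverse_le z
  obtain ⟨h1, h2, -, -, -⟩ := inverse_spec x
  obtain ⟨k1, k2, -, k4, -⟩ := inverse_spec z
  rw [bddTransform, bddTransform]
  set y := Ring.inverse (1 + star x * x)
  set w := Ring.inverse (1 + star z * z)
  have h5 : y - w = y * (star x * (z - x) + star (z - x) * z) * w := by
    calc y - w = y * ((1 + star z * z) * w) - (y * (1 + star x * x)) * w := by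
          rw [k1, h2, mul_one, one_mul]
      _ = _ := by rw [star_sub]; noncomm_ring
  have h6 : 2 * x * y - 2 * z * w = (2 : ℂ) • ((x - z) * w + ((x * y * star x) * ((z - x) * w)
      + (x * y) * (star (z - x) * (z * w)))) := by
    have h7 : x * (y - w) =
        (x * y * star x) * ((z - x) * w) + (x * y) * (star (z - x) * (z * w)) := by
      rw [h5]; noncomm_ring
    rw [← h7, two_smul]
    noncomm_ring
  have e1 : norm2 φ ((x - z) * w) ≤ norm2 φ (x - z) :=
    (hφ.norm2_mul_le' _ _).trans (mul_le_of_le_one_right (norm2_nonneg _) k4)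
  have e2 : norm2 φ ((z - x) * w) ≤ norm2 φ (x - z) := by
    rw [norm2_sub_comm x z]
    exact (hφ.norm2_mul_le' _ _).trans (mul_le_of_le_one_right (norm2_nonneg _) k4)
  have e3 : norm2 φ (star (z - x) * (z * w)) ≤ norm2 φ (x - z) * (3 / 2) := by
    refine (hφ.norm2_mul_le' _ _).trans ?_
    rw [hφ.norm2_star, norm2_sub_comm x z]
    gcongr
    exact norm2_nonneg _
  have e4 : norm2 φ ((x * y * star x) * ((z - x) * w)) ≤ 3 * norm2 φ (x - z) :=
    (hφ.norm2_mul_le _ _).trans (by gcongr; exact norm2_nonneg _)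
  have e5 : norm2 φ ((x * y) * (star (z - x) * (z * w))) ≤
      3 / 2 * (norm2 φ (x - z) * (3 / 2)) :=
    (hφ.norm2_mul_le _ _).trans (by gcongr; exact norm2_nonneg _)
  rw [h6, norm2_smul]
  have e6 := hφ.norm2_add_le ((x - z) * w) ((x * y * star x) * ((z - x) * w)
      + (x * y) * (star (z - x) * (z * w)))
  have e7 := hφ.norm2_add_le ((x * y * star x) * ((z - x) * w))
    ((x * y) * (star (z - x) * (z * w)))
  have e8 := norm2_nonneg (φ := φ) (x - z)
  rw [Complex.norm_ofNat]
  linarith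

/-- Polynomial approximants of the bounded transform; `x'` plays the role of `x*`. They make sense
in every algebra, in particular in a free algebra. -/
noncomputable def bddApprox {R : Type*} [Ring R] [Algebra ℂ R] (C : ℝ) (n : ℕ) (x x' : R) : R :=
  2 * x * (((1 + C : ℝ) : ℂ)⁻¹ • ∑ k ∈ Finset.range n,
    (((1 + C : ℝ) : ℂ)⁻¹ • (((C : ℝ) : ℂ) • 1 - x' * x)) ^ k)

theorem map_bddApprox {R S : Type*} [Ring R] [Algebra ℂ R] [Ring S] [Algebra ℂ S]
    (f : R →ₐ[ℂ] S) (C : ℝ) (n : ℕ) (x x' : R) :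
    f (bddApprox C n x x') = bddApprox C n (f x) (f x') := by
  simp only [bddApprox, map_mul, map_smul, map_sum, map_pow, map_sub, map_one, map_ofNat]

theorem norm_bddTransform_sub_bddApprox_le {x : 𝒜} {C : ℝ} (hC : ‖x‖ ^ 2 ≤ C) (n : ℕ) :
    ‖bddTransform x - bddApprox C n x (star x)‖ ≤ 2 * (1 + C) * (C / (1 + C)) ^ n := by
  have hC0 : 0 ≤ C := (sq_nonneg _).trans hC
  rw [bddTransform, bddApprox, ← mul_sub]
  have hx : ‖2 * x‖ ≤ 2 * (1 + C) := by
    rw [two_mul]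
    refine (norm_add_le _ _).trans ?_
    nlinarith [sq_nonneg (‖x‖ - 1)]
  exact (norm_mul_le _ _).trans
    (mul_le_mul hx ((inverse_spec x).2.2.2.2 C hC n) (norm_nonneg _) (by positivity))

theorem exists_forall_norm_bddApprox_error_le (C : ℝ) (hC : 0 ≤ C) {ε : ℝ} (hε : 0 < ε) :
    ∃ n : ℕ, 2 * (1 + C) * (C / (1 + C)) ^ n ≤ ε := by
  have h1 : C / (1 + C) < 1 := by rw [div_lt_one (by linarith)]; linarith
  have h2 := (tendsto_pow_atTop_nhds_zero_of_lt_one (by positivity) h1).const_mul (2 * (1 + C))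
  rw [mul_zero] at h2
  exact ((h2.eventually (gt_mem_nhds hε)).exists).imp fun n hn => hn.le

end BoundedTransform

/-! ### Non-commutative polynomials in self-adjoint variables -/

section Polynomials

/-- `AdjointBound c P Q K`: the polynomial `Q` is the formal adjoint of `P` (the variables being
self-adjoint), and `K` bounds the norm of `P` at tuples of elements of norm at most `c`. As a
relation it can be used for C*-algebras in different universes. -/
inductive AdjointBound {κ : Type*} (c : ℝ) :
    FreeAlgebra ℂ κ → FreeAlgebra ℂ κ → ℝ → Prop
  | const (z : ℂ) : AdjointBound c (algebraMap ℂ _ z) (algebraMap ℂ _ (star z)) ‖z‖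
  | var (k : κ) : AdjointBound c (FreeAlgebra.ι ℂ k) (FreeAlgebra.ι ℂ k) c
  | add {P P' Q Q' : FreeAlgebra ℂ κ} {K K' : ℝ} : AdjointBound c P Q K →
      AdjointBound c P' Q' K' → AdjointBound c (P + P') (Q + Q') (K + K')
  | mul {P P' Q Q' : FreeAlgebra ℂ κ} {K K' : ℝ} : AdjointBound c P Q K →
      AdjointBound c P' Q' K' → AdjointBound c (P * P') (Q' * Q) (K * K')

variable {κ : Type*}

theorem AdjointBound.exists (c : ℝ) (P : FreeAlgebra ℂ κ) : ∃ Q K, AdjointBound c P Q K := by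
  induction P using FreeAlgebra.induction with
  | grade0 z => exact ⟨_, _, .const z⟩
  | grade1 k => exact ⟨_, _, .var k⟩
  | mul P P' h h' =>
    obtain ⟨Q, K, h⟩ := h
    obtain ⟨Q', K', h'⟩ := h'
    exact ⟨_, _, h.mul h'⟩
  | add P P' h h' =>
    obtain ⟨Q, K, h⟩ := h
    obtain ⟨Q', K', h'⟩ := h'
    exact ⟨_, _, h.add h'⟩

theorem AdjointBound.lift_eq_star {c : ℝ} {P Q : FreeAlgebra ℂ κ} {K : ℝ}
    (h : AdjointBound c P Q K) {𝒜 : Type*} [CStarAlgebra 𝒜] {A : κ → 𝒜}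
    (hA : ∀ k, IsSelfAdjoint (A k)) :
    FreeAlgebra.lift ℂ A Q = star (FreeAlgebra.lift ℂ A P) := by
  induction h with
  | const z => simp [Algebra.algebraMap_eq_smul_one]
  | var k => simp [(hA k).star_eq]
  | add _ _ h h' => simp [h, h']
  | mul _ _ h h' => simp [h, h']

theorem AdjointBound.norm_lift_le {c : ℝ} {P Q : FreeAlgebra ℂ κ} {K : ℝ}
    (h : AdjointBound c P Q K) {𝒜 : Type*} [CStarAlgebra 𝒜] {A : κ → 𝒜}
    (hA : ∀ k, ‖A k‖ ≤ c) : ‖FreeAlgebra.lift ℂ A P‖ ≤ K := by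
  induction h with
  | const z =>
    rw [AlgHom.commutes, Algebra.algebraMap_eq_smul_one, norm_smul]
    exact mul_le_of_le_one_right (norm_nonneg _) norm_one_le_one
  | var k => simpa using hA k
  | add _ _ h h' =>
    rw [map_add]
    exact (norm_add_le _ _).trans (add_le_add h h')
  | mul _ _ h h' =>
    rw [map_mul]
    exact (norm_mul_le _ _).trans (mul_le_mul h h' (norm_nonneg _) ((norm_nonneg _).trans h))

/-- The polynomial `R` takes values of norm at most `4` at all self-adjoint tuples `A` with
`‖A k‖ ≤ c`, in every C*-algebra; as in `AdjointBound`, this is expressed through its form. -/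
def UniformlyBounded (c : ℝ) (R : FreeAlgebra ℂ κ) : Prop :=
  ∃ (P Q : FreeAlgebra ℂ κ) (K : ℝ) (n : ℕ), AdjointBound c P Q K ∧
    2 * (1 + K ^ 2) * (K ^ 2 / (1 + K ^ 2)) ^ n ≤ 1 ∧ R = bddApprox (K ^ 2) n P Q

theorem lift_bddApprox {c : ℝ} {P Q : FreeAlgebra ℂ κ} {K : ℝ} (h : AdjointBound c P Q K)
    {𝒜 : Type*} [CStarAlgebra 𝒜] {A : κ → 𝒜} (hA : ∀ k, IsSelfAdjoint (A k))
    (hc : ∀ k, ‖A k‖ ≤ c) (n : ℕ) :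
    ‖bddTransform (FreeAlgebra.lift ℂ A P) -
      FreeAlgebra.lift ℂ A (bddApprox (K ^ 2) n P Q)‖ ≤
      2 * (1 + K ^ 2) * (K ^ 2 / (1 + K ^ 2)) ^ n := by
  rw [map_bddApprox, h.lift_eq_star hA]
  exact norm_bddTransform_sub_bddApprox_le
    (pow_le_pow_left₀ (norm_nonneg _) (h.norm_lift_le hc) 2) n

theorem UniformlyBounded.norm_lift_le {c : ℝ} {R : FreeAlgebra ℂ κ} (h : UniformlyBounded c R)
    {𝒜 : Type*} [CStarAlgebra 𝒜] {A : κ → 𝒜} (hA : ∀ k, IsSelfAdjoint (A k))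
    (hc : ∀ k, ‖A k‖ ≤ c) : ‖FreeAlgebra.lift ℂ A R‖ ≤ 4 := by
  obtain ⟨P, Q, K, n, h, hn, rfl⟩ := h
  have h1 := (lift_bddApprox h hA hc n).trans hn
  have h2 := norm_bddTransform_le (FreeAlgebra.lift ℂ A P)
  have h3 := norm_sub_norm_le (FreeAlgebra.lift ℂ A (bddApprox (K ^ 2) n P Q))
    (bddTransform (FreeAlgebra.lift ℂ A P))
  rw [norm_sub_rev] at h3
  linarith

/-- If polynomials in `X` approximate `z` in 2-norm, then uniformly bounded polynomials in `X`
approximate the bounded transform of `z` in 2-norm. -/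
theorem IsTracialState.exists_uniformlyBounded {𝒜 : Type*} [CStarAlgebra 𝒜] {φ : 𝒜 →ₗ[ℂ] ℂ}
    (hφ : IsTracialState φ) {X : κ → 𝒜} (hX : ∀ k, IsSelfAdjoint (X k)) {c : ℝ}
    (hc : ∀ k, ‖X k‖ ≤ c) {z : 𝒜}
    (hz : ∀ ε : ℝ, 0 < ε → ∃ P, norm2 φ (FreeAlgebra.lift ℂ X P - z) < ε) {ε : ℝ} (hε : 0 < ε) :
    ∃ R, UniformlyBounded c R ∧ norm2 φ (FreeAlgebra.lift ℂ X R - bddTransform z) < ε := by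
  obtain ⟨P, hP⟩ := hz (ε / 26) (by positivity)
  obtain ⟨Q, K, h⟩ := AdjointBound.exists c P
  obtain ⟨n, hn⟩ := exists_forall_norm_bddApprox_error_le (K ^ 2) (sq_nonneg K)
    (ε := min 1 (ε / 2)) (by positivity)
  refine ⟨_, ⟨P, Q, K, n, h, hn.trans (min_le_left _ _), rfl⟩, ?_⟩
  have h1 := (hφ.norm2_le _).trans ((lift_bddApprox h hX hc n).trans (hn.trans (min_le_right _ _)))
  have h2 := hφ.norm2_bddTransform_sub_le (FreeAlgebra.lift ℂ X P) z
  have h3 := hφ.norm2_sub_le_add (FreeAlgebra.lift ℂ X (bddApprox (K ^ 2) n P Q))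
    (bddTransform (FreeAlgebra.lift ℂ X P)) (bddTransform z)
  rw [norm2_sub_comm] at h1
  linarith

/-- The law of `A` under `ψ` is close to the law of `X` under `φ`: all moments of order at most `m`
differ by less than `δ`. -/
def MomentClose {𝒜 ℬ : Type*} [Ring 𝒜] [Algebra ℂ 𝒜] [Ring ℬ] [Algebra ℂ ℬ]
    (φ : 𝒜 →ₗ[ℂ] ℂ) (X : κ → 𝒜) (ψ : ℬ →ₗ[ℂ] ℂ) (A : κ → ℬ) (m : ℕ) (δ : ℝ) : Prop :=
  ∀ w : List κ, w.length ≤ m → ‖ψ (w.map A).prod - φ (w.map X).prod‖ < δ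

theorem mem_span_words (P : FreeAlgebra ℂ κ) :
    P ∈ Submodule.span ℂ (Set.range fun w : List κ => (w.map (FreeAlgebra.ι ℂ)).prod) := by
  have h : P ∈ Subalgebra.toSubmodule (Algebra.adjoin ℂ (Set.range (FreeAlgebra.ι ℂ (X := κ)))) := by
    rw [FreeAlgebra.adjoin_range_ι]; trivial
  rw [Algebra.adjoin_eq_span] at h
  refine Submodule.span_mono ?_ h
  intro x hx
  obtain ⟨l, hl, rfl⟩ := Submonoid.exists_list_of_mem_closure hx
  have : l ∈ Set.range (List.map (FreeAlgebra.ι ℂ (X := κ))) := by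
    rw [Set.range_list_map]; exact hl
  obtain ⟨w, rfl⟩ := this
  exact ⟨w, rfl⟩

theorem exists_momentClose_bound (P : FreeAlgebra ℂ κ) : ∃ (K : ℝ) (m : ℕ), 0 ≤ K ∧
    ∀ {𝒜 : Type*} {ℬ : Type*} [Ring 𝒜] [Algebra ℂ 𝒜] [Ring ℬ] [Algebra ℂ ℬ]
      (φ : 𝒜 →ₗ[ℂ] ℂ) (X : κ → 𝒜) (ψ : ℬ →ₗ[ℂ] ℂ) (A : κ → ℬ) (δ : ℝ),
      MomentClose φ X ψ A m δ →
      ‖ψ (FreeAlgebra.lift ℂ A P) - φ (FreeAlgebra.lift ℂ X P)‖ ≤ K * δ := by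
  refine Submodule.span_induction (p := fun P _ => ∃ (K : ℝ) (m : ℕ), 0 ≤ K ∧
    ∀ {𝒜 : Type _} {ℬ : Type _} [Ring 𝒜] [Algebra ℂ 𝒜] [Ring ℬ] [Algebra ℂ ℬ]
      (φ : 𝒜 →ₗ[ℂ] ℂ) (X : κ → 𝒜) (ψ : ℬ →ₗ[ℂ] ℂ) (A : κ → ℬ) (δ : ℝ),
      MomentClose φ X ψ A m δ →
      ‖ψ (FreeAlgebra.lift ℂ A P) - φ (FreeAlgebra.lift ℂ X P)‖ ≤ K * δ)
    ?_ ?_ ?_ ?_ (mem_span_words P)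
  · rintro _ ⟨w, rfl⟩
    refine ⟨1, w.length, zero_le_one, fun φ X ψ A δ h => ?_⟩
    simpa [map_list_prod, Function.comp_def] using (h w le_rfl).le
  · exact ⟨0, 0, le_rfl, fun φ X ψ A δ h => by simp⟩
  · rintro P Q - - ⟨K, m, hK, h⟩ ⟨K', m', hK', h'⟩
    refine ⟨K + K', max m m', add_nonneg hK hK', fun φ X ψ A δ hc => ?_⟩
    have h1 := h φ X ψ A δ fun w hw => hc w (hw.trans (le_max_left _ _))
    have h2 := h' φ X ψ A δ fun w hw => hc w (hw.trans (le_max_right _ _))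
    simp only [map_add, add_sub_add_comm, add_mul]
    exact (norm_add_le _ _).trans (add_le_add h1 h2)
  · rintro z P - ⟨K, m, hK, h⟩
    refine ⟨‖z‖ * K, m, by positivity, fun φ X ψ A δ hc => ?_⟩
    have h1 := h φ X ψ A δ hc
    simp only [map_smul, ← smul_sub, norm_smul, mul_assoc]
    gcongr

end Polynomials

/-! ### The double commutant theorem in the 2-norm -/

section DoubleCommutant

variable {H : Type*} [NormedAddCommGroup H] [InnerProductSpace ℂ H]

/-- The amplification of an operator on `H` to the Hilbert sum of copies of `H`. -/
noncomputable def amplify (α : Type*) (T : H →L[ℂ] H) :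
    lp (fun _ : α => H) 2 →L[ℂ] lp (fun _ : α => H) 2 :=
  lp.mapCLM 2 (fun _ => T) (norm_nonneg T) fun _ => le_rfl

@[simp] theorem amplify_apply (α : Type*) (T : H →L[ℂ] H) (f : lp (fun _ : α => H) 2) (i : α) :
    amplify α T f i = T (f i) := rfl

theorem inner_amplify [CompleteSpace H] {α : Type*} (T : H →L[ℂ] H) (f g : lp (fun _ : α => H) 2) :
    inner ℂ (amplify α T f) g = inner ℂ f (amplify α (star T) g) := by
  rw [lp.inner_eq_tsum, lp.inner_eq_tsum]
  refine tsum_congr fun i => ?_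
  rw [amplify_apply, amplify_apply, ContinuousLinearMap.star_eq_adjoint,
    ContinuousLinearMap.adjoint_inner_right]

/-- The linear map `d ↦ (d ζᵢ)ᵢ`. -/
noncomputable def amplifyAt {α : Type*} (ζ : lp (fun _ : α => H) 2) :
    (H →L[ℂ] H) →ₗ[ℂ] lp (fun _ : α => H) 2 where
  toFun T := amplify α T ζ
  map_add' S T := by ext i; simp
  map_smul' c T := by ext i; simp

theorem lp_single_map {α : Type*} [DecidableEq α] (T : H →L[ℂ] H) (i : α) (x : H) :
    amplify α T (lp.single 2 i x) = lp.single 2 i (T x) := by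
  ext j
  by_cases h : j = i
  · subst h; simp
  · simp [h]

/-- **Double commutant theorem**: elements of the double commutant of `𝒟` are approximated by
elements of `𝒟` in the ultrastrong topology. -/
theorem exists_norm_amplify_sub_lt [CompleteSpace H] {α : Type*} (𝒟 : StarSubalgebra ℂ (H →L[ℂ] H))
    {z : H →L[ℂ] H} (hz : z ∈ Set.centralizer (Set.centralizer (𝒟 : Set (H →L[ℂ] H))))
    (ζ : lp (fun _ : α => H) 2) {ε : ℝ} (hε : 0 < ε) :
    ∃ d ∈ 𝒟, ‖amplify α (z - d) ζ‖ < ε := by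
  classical
  set K₀ : Submodule ℂ (lp (fun _ : α => H) 2) :=
    (Subalgebra.toSubmodule 𝒟.toSubalgebra).map (amplifyAt ζ) with hK₀
  have memK₀ : ∀ v, v ∈ K₀ ↔ ∃ d ∈ 𝒟, amplify α d ζ = v := fun v => by
    rw [hK₀, Submodule.mem_map]; rfl
  set K := K₀.topologicalClosure with hK
  have hcomplete : CompleteSpace K := K₀.isClosed_topologicalClosure.completeSpace_coe
  set P := K.starProjection with hP
  have hinv : ∀ d ∈ 𝒟, ∀ v ∈ K, amplify α d v ∈ K := by
    intro d hd v hv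
    have h1 : MapsTo (amplify α d) (K₀ : Set _) (K₀ : Set _) := by
      intro v hv
      obtain ⟨e, he, rfl⟩ := (memK₀ v).1 hv
      exact (memK₀ _).2 ⟨d * e, mul_mem hd he, by ext i; simp⟩
    exact h1.closure (amplify α d).continuous hv
  have hcomm : ∀ d ∈ 𝒟, ∀ v, P (amplify α d v) = amplify α d (P v) := by
    intro d hd v
    refine Submodule.eq_starProjection_of_mem_of_inner_eq_zero
      (hinv d hd _ (K.starProjection_apply_mem v)) fun w hw => ?_
    rw [← map_sub, inner_amplify]
    exact K.starProjection_inner_eq_zero v _ (hinv _ (star_mem hd) w hw)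
  -- The matrix entries of the projection onto `K` lie in the commutant of `𝒟`.
  have hentry : ∀ (i j : α) (x : H),
      P (lp.single 2 i (z x)) j = z (P (lp.single 2 i x) j) := by
    intro i j x
    set e : H →L[ℂ] H := (lp.evalCLM ℂ (fun _ : α => H) 2 j) ∘L P ∘L
      (lp.singleContinuousLinearMap ℂ (fun _ : α => H) 2 i) with he
    have hea : ∀ y, e y = P (lp.single 2 i y) j := fun y => rfl
    have hmem : e ∈ Set.centralizer (𝒟 : Set (H →L[ℂ] H)) := by
      intro d hd
      ext y
      change d (e y) = e (d y)
      rw [hea, hea, ← lp_single_map, hcomm d hd, amplify_apply]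
    have := hz e hmem
    have h2 := congrArg (fun T : H →L[ℂ] H => T x) this
    change e (z x) = z (e x) at h2
    rw [hea, hea] at h2
    exact h2
  have hz1 : ∀ v, P (amplify α z v) = amplify α z (P v) := by
    intro v
    have hs := lp.hasSum_single (p := 2) (by norm_num) v
    have h1 := (hs.mapL (amplify α z)).mapL P
    have h2 := (hs.mapL P).mapL (amplify α z)
    refine h1.unique (h2.congr_fun fun i => ?_)
    ext j
    rw [lp_single_map, hentry, amplify_apply]
  have hζ : ζ ∈ K := K₀.le_topologicalClosure ((memK₀ ζ).2 ⟨1, one_mem _, by ext i; simp⟩)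
  have hzζ : amplify α z ζ ∈ K := by
    have := hz1 ζ
    rw [hP, K.starProjection_eq_self_iff.2 hζ] at this
    exact K.starProjection_eq_self_iff.1 this
  obtain ⟨v, hv, hvε⟩ := Metric.mem_closure_iff.1 hzζ ε hε
  obtain ⟨d, hd, rfl⟩ := (memK₀ v).1 hv
  refine ⟨d, hd, ?_⟩
  have hsub : amplify α (z - d) ζ = amplify α z ζ - amplify α d ζ := by ext i; simp
  rwa [hsub, ← dist_eq_norm]

end DoubleCommutant

theorem isClosed_toStarSubalgebra {H : Type*} [NormedAddCommGroup H] [InnerProductSpace ℂ H]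
    [CompleteSpace H] (M : VonNeumannAlgebra H) :
    IsClosed (M.toStarSubalgebra : Set (H →L[ℂ] H)) := by
  change IsClosed (M : Set (H →L[ℂ] H))
  rw [← M.centralizer_centralizer]
  exact Set.isClosed_centralizer _

-- This makes `M.toStarSubalgebra` a `CStarAlgebra`.
attribute [local instance] isClosed_toStarSubalgebra

section Normal

variable {H : Type*} [NormedAddCommGroup H] [InnerProductSpace ℂ H] [CompleteSpace H]

theorem coe_generatedVN (S : Set (H →L[ℂ] H)) :
    (generatedVN S : Set (H →L[ℂ] H)) = Set.centralizer (Set.centralizer (S ∪ star S)) := by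
  change (StarSubalgebra.centralizer ℂ (StarSubalgebra.centralizer ℂ S : Set (H →L[ℂ] H)) :
    Set (H →L[ℂ] H)) = _
  have hs : star (StarSubalgebra.centralizer ℂ S : Set (H →L[ℂ] H)) =
      (StarSubalgebra.centralizer ℂ S : Set (H →L[ℂ] H)) := by
    ext x
    simp only [Set.mem_star, SetLike.mem_coe]
    exact star_mem_iff
  rw [StarSubalgebra.coe_centralizer, hs, Set.union_self, StarSubalgebra.coe_centralizer]

variable {M : VonNeumannAlgebra H} {τ : M.toStarSubalgebra →ₗ[ℂ] ℂ}

theorem IsNormalTracialState.isTracialState (hτ : IsNormalTracialState M τ) :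
    IsTracialState τ := ⟨hτ.map_one, hτ.nonneg, hτ.trace⟩

/-- A *-subalgebra `𝒟` is dense in the von Neumann algebra it generates for the 2-norm of a normal
tracial state. -/
theorem IsNormalTracialState.exists_norm2_sub_lt (hτ : IsNormalTracialState M τ)
    (𝒟 : StarSubalgebra ℂ (H →L[ℂ] H)) (h𝒟 : 𝒟 ≤ M.toStarSubalgebra)
    {z : M.toStarSubalgebra} (hz : (z : H →L[ℂ] H) ∈ generatedVN (𝒟 : Set (H →L[ℂ] H)))
    {ε : ℝ} (hε : 0 < ε) :
    ∃ d : M.toStarSubalgebra, (d : H →L[ℂ] H) ∈ 𝒟 ∧ norm2 τ (d - z) < ε := by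
  obtain ⟨ξ, η, hξ, hη, hsum⟩ := hτ.normal
  have hmem : Memℓp (Sum.elim ξ η) 2 := by
    refine memℓp_gen ?_
    have : (fun i => ‖Sum.elim ξ η i‖ ^ (2 : ℝ≥0∞).toReal) =
        Sum.elim (fun k => ‖ξ k‖ ^ 2) (fun k => ‖η k‖ ^ 2) := by
      ext (i | i) <;> simp
    rw [this]
    exact Summable.sum _ hξ hη
  have hz' : (z : H →L[ℂ] H) ∈ Set.centralizer (Set.centralizer (𝒟 : Set (H →L[ℂ] H))) := by
    have h1 : (z : H →L[ℂ] H) ∈ (generatedVN (𝒟 : Set (H →L[ℂ] H)) : Set (H →L[ℂ] H)) := hz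
    have h2 : (𝒟 : Set (H →L[ℂ] H)) ∪ star (𝒟 : Set (H →L[ℂ] H)) = 𝒟 := by
      refine Set.union_eq_self_of_subset_right fun x hx => ?_
      simpa using star_mem (s := 𝒟) hx
    rwa [coe_generatedVN, h2] at h1
  obtain ⟨d, hd, hdε⟩ := exists_norm_amplify_sub_lt 𝒟 hz'
    (⟨Sum.elim ξ η, hmem⟩ : lp (fun _ : ℕ ⊕ ℕ => H) 2) (ε := ε / 2) (by positivity)
  refine ⟨⟨d, h𝒟 hd⟩, hd, ?_⟩
  rw [norm2_sub_comm]
  set T : M.toStarSubalgebra := z - ⟨d, h𝒟 hd⟩ with hT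
  have hTc : (T : H →L[ℂ] H) = z - d := rfl
  set f := amplify (ℕ ⊕ ℕ) ((z : H →L[ℂ] H) - d)
    (⟨Sum.elim ξ η, hmem⟩ : lp (fun _ : ℕ ⊕ ℕ => H) 2) with hf
  have hfs : HasSum (fun i => ‖f i‖ ^ 2) (‖f‖ ^ 2) := by
    have := lp.hasSum_norm (p := 2) (by norm_num) f
    simpa using this
  have h1 := hsum (star T * T)
  have hl : ∑' k, ‖f (Sum.inl k)‖ ^ 2 ≤ ‖f‖ ^ 2 := by
    rw [← hfs.tsum_eq]
    exact tsum_comp_le_tsum_of_inj hfs.summable (fun _ => sq_nonneg _) Sum.inl_injective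
  have hr : ∑' k, ‖f (Sum.inr k)‖ ^ 2 ≤ ‖f‖ ^ 2 := by
    rw [← hfs.tsum_eq]
    exact tsum_comp_le_tsum_of_inj hfs.summable (fun _ => sq_nonneg _) Sum.inr_injective
  have hsl := hfs.summable.comp_injective (Sum.inl_injective (α := ℕ) (β := ℕ))
  have hsr := hfs.summable.comp_injective (Sum.inr_injective (α := ℕ) (β := ℕ))
  have h2 : ‖τ (star T * T)‖ ≤ ‖f‖ ^ 2 + ‖f‖ ^ 2 := by
    refine (h1.norm_le_of_bounded (hsl.hasSum.add hsr.hasSum) fun k => ?_).trans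
      (add_le_add hl hr)
    have h3 : inner ℂ (ξ k) (((star T * T : M.toStarSubalgebra) : H →L[ℂ] H) (η k)) =
        inner ℂ (f (Sum.inl k)) (f (Sum.inr k)) := by
      change inner ℂ (ξ k) ((star (T : H →L[ℂ] H)) ((T : H →L[ℂ] H) (η k))) = _
      rw [ContinuousLinearMap.star_eq_adjoint, ContinuousLinearMap.adjoint_inner_right, hTc]
      rfl
    rw [h3]
    refine (norm_inner_le_norm _ _).trans ?_
    simp only [Function.comp]
    nlinarith [sq_nonneg (‖f (Sum.inl k)‖ - ‖f (Sum.inr k)‖), sq_nonneg (‖f (Sum.inl k)‖),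
      sq_nonneg (‖f (Sum.inr k)‖)]
  have h4 : norm2 τ T ^ 2 < ε ^ 2 := by
    rw [hτ.isTracialState.norm2_sq]
    have h5 := (Complex.re_le_norm _).trans h2
    nlinarith [norm_nonneg f]
  exact lt_of_pow_lt_pow_left₀ 2 hε.le h4

end Normal

/-! ### Matrix units in finite-dimensional C*-algebras -/

/-- A system of partial isometries `u i`, `i ∈ ι`, partitioned into classes by `c` (each class has a
representative, and `c i` is the one of `i`): the `u i` have a common initial projection within
each class, and their final projections form a partition of unity. The products `u i * star (u l)`
with `c i = c l` are then matrix units of a finite-dimensional *-algebra. -/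
structure IsMatrixUnitFrame {ι R : Type*} [Fintype ι] [Ring R] [StarRing R] (c : ι → ι)
    (u : ι → R) : Prop where
  orthogonal : ∀ i j, i ≠ j → star (u i) * u j = 0
  initial : ∀ i, star (u i) * u i = star (u (c i)) * u (c i)
  partial_isometry : ∀ i, u i * star (u i) * u i = u i
  sum_final : ∑ i, u i * star (u i) = 1

/-- The element `∑ y_il u_i u_l*`. -/
def frameSum {ι R : Type*} [Fintype ι] [Ring R] [Algebra ℂ R] [Star R]
    (u : ι → R) (y : Matrix ι ι ℂ) : R := ∑ i, ∑ l, y i l • (u i * star (u l))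

section FiniteDimensional

variable {𝒞 : Type*} [CStarAlgebra 𝒞]

/-- A projection with scalar corner. -/
def IsMinimalProj (p : 𝒞) : Prop :=
  IsStarProjection p ∧ ∀ a, IsSelfAdjoint a → p * a = a → ∃ t : ℝ, a = (t : ℂ) • p

theorem finite_spectrum_of_isSelfAdjoint [FiniteDimensional ℂ 𝒞] {a : 𝒞}
    (ha : IsSelfAdjoint a) : (spectrum ℝ a).Finite := by
  have : FiniteDimensional ℝ 𝒞 := FiniteDimensional.complexToReal 𝒞
  refine (Module.End.finite_spectrum (Algebra.lmul ℝ 𝒞 a)).subset fun t ht htu => ht ?_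
  have h1 : algebraMap ℝ (Module.End ℝ 𝒞) t - Algebra.lmul ℝ 𝒞 a =
      Algebra.lmul ℝ 𝒞 (algebraMap ℝ 𝒞 t - a) := by
    rw [map_sub, AlgHom.commutes]
  rw [spectrum.mem_resolventSet_iff, h1] at htu
  obtain ⟨b, hb⟩ := ((Module.End.isUnit_iff _).1 htu).2 1
  change (algebraMap ℝ 𝒞 t - a) * b = 1 at hb
  have hsa : star (algebraMap ℝ 𝒞 t - a) = algebraMap ℝ 𝒞 t - a := by
    rw [star_sub, ha.star_eq, ← algebraMap_star_comm, star_trivial]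
  have hb' : star b * (algebraMap ℝ 𝒞 t - a) = 1 := by
    have := congrArg star hb
    rwa [star_mul, hsa, star_one] at this
  exact isUnit_iff_exists_and_exists.2 ⟨⟨b, hb⟩, ⟨star b, hb'⟩⟩

/-- A projection without proper non-zero subprojections has a scalar corner. -/
theorem isMinimalProj_of_forall [FiniteDimensional ℂ 𝒞] {p : 𝒞} (hp : IsStarProjection p)
    (hmin : ∀ q, IsStarProjection q → p * q = q → q = 0 ∨ q = p) : IsMinimalProj p := by
  refine ⟨hp, fun a ha hpa => ?_⟩
  have hfin := finite_spectrum_of_isSelfAdjoint ha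
  have hcont : ∀ f : ℝ → ℝ, ContinuousOn f (spectrum ℝ a) := fun f => hfin.continuousOn f
  by_cases h : ∃ t ∈ spectrum ℝ a, t ≠ 0
  · obtain ⟨t, ht, ht0⟩ := h
    set f : ℝ → ℝ := fun s => if s = t then 1 else 0 with hf
    have he1 : cfc f a * cfc f a = cfc f a := by
      rw [← cfc_mul f f a (hcont _) (hcont _)]
      congr 1
      ext s
      simp [hf]
    have he : IsStarProjection (cfc f a) := ⟨he1, cfc_predicate f a⟩
    have hae : a * cfc f a = t • cfc f a := by
      have h := cfc_mul (fun s : ℝ => s) f a (hcont _) (hcont _)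
      rw [cfc_id' ℝ a] at h
      rw [← h, ← cfc_smul t f a (hcont _)]
      congr 1
      ext s
      by_cases hs : s = t <;> simp [hf, hs]
    have hpe : p * cfc f a = cfc f a := by
      have : cfc f a = a * (t⁻¹ • cfc f a) := by
        rw [mul_smul_comm, hae, smul_smul, inv_mul_cancel₀ ht0, one_smul]
      rw [this, ← mul_assoc, hpa]
    have hne : cfc f a ≠ 0 := by
      intro h0
      have h1 : (1 : ℝ) ∈ spectrum ℝ (cfc f a) := by
        rw [cfc_map_spectrum f a (hf := hcont _)]
        exact ⟨t, ht, by simp [hf]⟩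
      rw [h0] at h1
      have hnt : Nontrivial 𝒞 := by
        by_contra hnt
        rw [not_nontrivial_iff_subsingleton] at hnt
        rw [spectrum.of_subsingleton] at ht
        exact ht
      rw [spectrum.zero_eq] at h1
      simp at h1
    have hep : cfc f a = p := (hmin _ he hpe).resolve_left hne
    refine ⟨t, ?_⟩
    have hap : a * p = a := by
      have := congrArg star hpa
      rwa [star_mul, ha.star_eq, hp.isSelfAdjoint.star_eq] at this
    rw [hep, hap] at hae
    rw [hae, Complex.coe_smul]
  · push Not at h
    refine ⟨0, ?_⟩
    have : cfc (fun s : ℝ => s) a = cfc (fun _ : ℝ => (0 : ℝ)) a :=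
      cfc_congr fun s hs => h s hs
    rw [cfc_id' ℝ a] at this
    rw [this]
    simp

/-- Non-zero pairwise orthogonal projections. -/
def IsOrthoProj {D : ℕ} (p : Fin D → 𝒞) : Prop :=
  (∀ i, IsStarProjection (p i) ∧ p i ≠ 0) ∧ ∀ i j, i ≠ j → p i * p j = 0

theorem IsOrthoProj.le_finrank [FiniteDimensional ℂ 𝒞] {D : ℕ} {p : Fin D → 𝒞}
    (hp : IsOrthoProj p) : D ≤ Module.finrank ℂ 𝒞 := by
  have : LinearIndependent ℂ p := by
    rw [Fintype.linearIndependent_iff]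
    intro g hg i
    have h1 : p i * ∑ j, g j • p j = g i • p i := by
      rw [Finset.mul_sum, Finset.sum_eq_single i]
      · rw [mul_smul_comm, (hp.1 i).1.isIdempotentElem.eq]
      · intro j _ hj
        rw [mul_smul_comm, hp.2 i j hj.symm, smul_zero]
      · simp
    rw [hg, mul_zero] at h1
    exact (smul_eq_zero.1 h1.symm).resolve_right (hp.1 i).2
  simpa using this.fintype_card_le_finrank

theorem IsOrthoProj.cons {D : ℕ} {p : Fin D → 𝒞} (hp : IsOrthoProj p) {q : 𝒞}
    (hq : IsStarProjection q) (hq0 : q ≠ 0) (hqp : ∀ i, p i * q = 0) :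
    IsOrthoProj (Fin.cons q p : Fin (D + 1) → 𝒞) := by
  have hqp' : ∀ i, q * p i = 0 := fun i => by
    have := congrArg star (hqp i)
    rwa [star_mul, hq.isSelfAdjoint.star_eq, (hp.1 i).1.isSelfAdjoint.star_eq, star_zero] at this
  constructor
  · intro i
    refine Fin.cases ⟨hq, hq0⟩ (fun i => ?_) i
    simpa using hp.1 i
  · intro i j
    refine Fin.cases ?_ (fun i => ?_) i <;> refine Fin.cases ?_ (fun j => ?_) j
    · simp
    · simpa using fun _ => hqp' j
    · simpa using hqp i
    · simpa using hp.2 i j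

theorem exists_minimalProj_partition (𝒞 : Type*) [CStarAlgebra 𝒞] [FiniteDimensional ℂ 𝒞] :
    ∃ (D : ℕ) (p : Fin D → 𝒞), (∀ i, IsMinimalProj (p i)) ∧ (∀ i j, i ≠ j → p i * p j = 0) ∧
      ∑ i, p i = 1 := by
  classical
  set S : ℕ → Prop := fun D => ∃ p : Fin D → 𝒞, IsOrthoProj p with hS
  have h0 : S 0 := ⟨fun i => i.elim0, fun i => i.elim0, fun i => i.elim0⟩
  have hbd : ∀ D, S D → D ≤ Module.finrank ℂ 𝒞 := fun D ⟨p, hp⟩ => hp.le_finrank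
  set D := Nat.findGreatest S (Module.finrank ℂ 𝒞) with hD
  obtain ⟨p, hp⟩ : S D := Nat.findGreatest_spec (Nat.zero_le _) h0
  have hmax : ¬ S (D + 1) := fun h => by
    have := Nat.le_findGreatest (hbd _ h) h
    omega
  refine ⟨D, p, fun i => ?_, hp.2, ?_⟩
  · refine isMinimalProj_of_forall (hp.1 i).1 fun q hq hpq => ?_
    by_contra hcon
    push Not at hcon
    -- A proper subprojection `q` of `p i` would yield the longer family with `p i` split in two.
    have hqp : q * p i = q := by
      have := congrArg star hpq
      rwa [star_mul, hq.isSelfAdjoint.star_eq, (hp.1 i).1.isSelfAdjoint.star_eq] at this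
    have hsub : IsStarProjection (p i - q) := hq.sub_of_mul_eq_left (hp.1 i).1 hqp
    have hother : ∀ j, j ≠ i → p j * q = 0 := fun j hj => by
      rw [← hpq, ← mul_assoc, hp.2 j i hj, zero_mul]
    have hp' : IsOrthoProj (Function.update p i (p i - q)) := by
      constructor
      · intro j
        by_cases hj : j = i
        · subst hj
          simpa using ⟨hsub, sub_ne_zero.2 hcon.2.symm⟩
        · simpa [hj] using hp.1 j
      · intro j k hjk
        by_cases hj : j = i
        · subst hj
          have hk : k ≠ j := hjk.symm
          have : q * p k = 0 := by rw [← hqp, mul_assoc, hp.2 j k hjk, mul_zero]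
          simp [hk, sub_mul, this, hp.2 j k hjk]
        · by_cases hk : k = i
          · subst hk
            simp [hj, mul_sub, hother j hj, hp.2 j k hj]
          · simp [hj, hk, hp.2 j k hjk]
    refine hmax ⟨_, hp'.cons hq hcon.1 fun j => ?_⟩
    by_cases hj : j = i
    · subst hj
      simp [sub_mul, hpq, hq.isIdempotentElem.eq]
    · simp [hj, hother j hj]
  · by_contra hne
    have hpe : ∀ j, p j * ∑ i, p i = p j := fun j => by
      rw [Finset.mul_sum, Finset.sum_eq_single j, (hp.1 j).1.isIdempotentElem.eq]
      · intro k _ hk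
        exact hp.2 j k hk.symm
      · simp
    have he : IsStarProjection (∑ i, p i) := by
      refine ⟨?_, ?_⟩
      · rw [IsIdempotentElem, Finset.sum_mul]
        exact Finset.sum_congr rfl fun j _ => hpe j
      · rw [IsSelfAdjoint, star_sum]
        exact Finset.sum_congr rfl fun j _ => (hp.1 j).1.isSelfAdjoint
    refine hmax ⟨_, hp.cons he.one_sub (sub_ne_zero.2 (Ne.symm hne)) fun j => ?_⟩
    rw [mul_sub, mul_one, hpe, sub_self]

/-- Corners between minimal projections contain partial isometries unless they vanish. -/
theorem exists_partialIsometry_of_isMinimalProj {p q x : 𝒞} (hp : IsMinimalProj p)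
    (hq : IsMinimalProj q) (hx : x ≠ 0) (hpx : p * x = x) (hxq : x * q = x) :
    ∃ u : 𝒞, star u * u = q ∧ u * star u = p := by
  have hqx : q * star x = star x := by
    have := congrArg star hxq
    rwa [star_mul, hq.1.isSelfAdjoint.star_eq] at this
  obtain ⟨s, hs⟩ := hq.2 (star x * x) (IsSelfAdjoint.star_mul_self x) (by rw [← mul_assoc, hqx])
  obtain ⟨t, ht⟩ := hp.2 (x * star x) (IsSelfAdjoint.mul_star_self x) (by rw [← mul_assoc, hpx])
  have hst : t = s := by
    have h1 : ((t : ℂ) - (s : ℂ)) • x = 0 := by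
      have h2 : (x * star x) * x = x * (star x * x) := mul_assoc _ _ _
      rw [hs, ht, smul_mul_assoc, mul_smul_comm, hpx, hxq] at h2
      rw [sub_smul, h2, sub_self]
    have := (smul_eq_zero.1 h1).resolve_right hx
    exact_mod_cast sub_eq_zero.1 this
  have hxx : star x * x ≠ 0 := fun h => hx (CStarRing.star_mul_self_eq_zero_iff x |>.1 h)
  have hs0 : 0 < s := by
    let _ := CStarAlgebra.spectralOrder 𝒞
    have := CStarAlgebra.spectralOrderedRing 𝒞
    have hq0 : 0 ≤ q := by
      rw [← hq.1.isIdempotentElem.eq]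
      conv_rhs => rw [← hq.1.isSelfAdjoint.star_eq, hq.1.isSelfAdjoint.star_eq]
      nth_rewrite 1 [← hq.1.isSelfAdjoint.star_eq]
      exact star_mul_self_nonneg q
    by_contra hneg
    push Not at hneg
    apply hxx
    apply le_antisymm _ (star_mul_self_nonneg x)
    rw [hs, Complex.coe_smul]
    exact smul_nonpos_of_nonpos_of_nonneg hneg hq0
  have hsq : ((√s : ℝ) : ℂ)⁻¹ * ((√s : ℝ) : ℂ)⁻¹ * (s : ℂ) = 1 := by
    have h1 : (√s)⁻¹ * (√s)⁻¹ * s = 1 := by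
      rw [← mul_inv, Real.mul_self_sqrt hs0.le, inv_mul_cancel₀ hs0.ne']
    exact_mod_cast h1
  refine ⟨((√s : ℝ) : ℂ)⁻¹ • x, ?_, ?_⟩
  · rw [star_smul, smul_mul_smul_comm, Complex.star_def, map_inv₀, Complex.conj_ofReal, hs,
      smul_smul, hsq, one_smul]
  · rw [star_smul, smul_mul_smul_comm, Complex.star_def, map_inv₀, Complex.conj_ofReal, ht, hst,
      smul_smul, hsq, one_smul]

theorem mul_eq_of_star_mul_self_isStarProjection {u q : 𝒞} (hq : IsStarProjection q)
    (hu : star u * u = q) : u * q = u := by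
  have h1 : star (u * q - u) * (u * q - u) = 0 := by
    rw [star_sub, star_mul, hq.isSelfAdjoint.star_eq]
    calc (q * star u - star u) * (u * q - u)
        = q * (star u * u) * q - q * (star u * u) - (star u * u) * q + star u * u := by
          noncomm_ring
      _ = 0 := by simp [hu, hq.isIdempotentElem.eq]
  exact sub_eq_zero.1 ((CStarRing.star_mul_self_eq_zero_iff _).1 h1)

/-- A finite-dimensional C*-algebra is spanned by the matrix units of a frame: `u i` connects the
`i`-th projection of a maximal orthogonal family to the representative of its equivalence class. -/
theorem exists_matrixUnitFrame (𝒞 : Type*) [CStarAlgebra 𝒞] [FiniteDimensional ℂ 𝒞] :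
    ∃ (D : ℕ) (c : Fin D → Fin D) (u : Fin D → 𝒞), IsMatrixUnitFrame c u ∧
      ∀ y : 𝒞, ∃ Y : Matrix (Fin D) (Fin D) ℂ, (∀ i l, c i ≠ c l → Y i l = 0) ∧
        frameSum u Y = y := by
  obtain ⟨D, p, hmin, horth, hsum⟩ := exists_minimalProj_partition 𝒞
  have hid : ∀ i, p i * p i = p i := fun i => (hmin i).1.isIdempotentElem.eq
  have hsa : ∀ i, star (p i) = p i := fun i => (hmin i).1.isSelfAdjoint.star_eq
  -- Two projections are equivalent if some partial isometry connects them.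
  let rel : Setoid (Fin D) :=
    { r := fun i j => ∃ u : 𝒞, star u * u = p j ∧ u * star u = p i
      iseqv :=
        { refl := fun i => ⟨p i, by rw [hsa, hid], by rw [hsa, hid]⟩
          symm := fun {i j} ⟨u, h1, h2⟩ => ⟨star u, by rw [star_star, h2], by rw [star_star, h1]⟩
          trans := fun {i j k} ⟨u, h1, h2⟩ ⟨v, h3, h4⟩ => by
            have hu := mul_eq_of_star_mul_self_isStarProjection (hmin j).1 h1
            have hv := mul_eq_of_star_mul_self_isStarProjection (u := star v) (hmin j).1
              (by rw [star_star, h4])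
            refine ⟨u * v, ?_, ?_⟩
            · calc star (u * v) * (u * v) = star v * (star u * u) * v := by
                    rw [star_mul]; noncomm_ring
                _ = p k := by rw [h1, hv, h3]
            · calc u * v * star (u * v) = u * (v * star v) * star u := by
                    rw [star_mul]; noncomm_ring
                _ = p i := by rw [h4, hu, h2] } }
  let c : Fin D → Fin D := fun i => (Quotient.mk rel i).out
  have hc : ∀ i, rel.r i (c i) := fun i => rel.symm (Quotient.mk_out (s := rel) i)
  have hcc : ∀ i j, rel.r i j → c i = c j := fun i j h => by
    change (Quotient.mk rel i).out = (Quotient.mk rel j).out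
    rw [Quotient.sound (s := rel) h]
  choose u hu1 hu2 using hc
  have hup : ∀ i, u i * p (c i) = u i := fun i =>
    mul_eq_of_star_mul_self_isStarProjection (hmin _).1 (hu1 i)
  have hpu : ∀ i, p i * u i = u i := fun i => by rw [← hu2, mul_assoc, hu1, hup]
  have hpu' : ∀ i, star (u i) * p i = star (u i) := fun i => by
    have := congrArg star (hpu i)
    rwa [star_mul, hsa] at this
  have hup' : ∀ i, p (c i) * star (u i) = star (u i) := fun i => by
    have := congrArg star (hup i)
    rwa [star_mul, hsa] at this
  refine ⟨D, c, u, ⟨fun i j hij => ?_, fun i => ?_, fun i => ?_, ?_⟩, fun y => ?_⟩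
  · rw [← hpu' i, ← hpu j, mul_assoc, ← mul_assoc (p i), horth i j hij, zero_mul, mul_zero]
  · rw [hu1, hu1, ← hcc i (c i) ⟨u i, hu1 i, hu2 i⟩]
  · rw [hu2, hpu]
  · rw [← hsum]
    exact Finset.sum_congr rfl fun i _ => hu2 i
  · have hscalar : ∀ (i : Fin D) (x : 𝒞), p i * x = x → x * p i = x → ∃ z : ℂ, x = z • p i := by
      intro i x h1 h2
      have h1' : star x * p i = star x := by
        have := congrArg star h1
        rwa [star_mul, hsa] at this
      have h2' : p i * star x = star x := by
        have := congrArg star h2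
        rwa [star_mul, hsa] at this
      obtain ⟨s, hs⟩ := (hmin i).2 (x + star x) (IsSelfAdjoint.add_star_self x)
        (by rw [mul_add, h1, h2'])
      obtain ⟨t, ht⟩ := (hmin i).2 (Complex.I • (x - star x))
        (by
          rw [IsSelfAdjoint, star_smul, star_sub, star_star, Complex.star_def, Complex.conj_I,
            neg_smul, ← smul_neg, neg_sub])
        (by rw [mul_smul_comm, mul_sub, h1, h2'])
      refine ⟨(2 : ℂ)⁻¹ * (s - Complex.I * t), ?_⟩
      rw [mul_smul, sub_smul, mul_smul, ← hs, ← ht, smul_smul, Complex.I_mul_I, neg_one_smul,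
        sub_neg_eq_add, add_add_sub_cancel, ← two_smul ℂ x, smul_smul,
        inv_mul_cancel₀ (two_ne_zero), one_smul]
    have hentry : ∀ i l, ∃ z : ℂ, (c i ≠ c l → z = 0) ∧
        p i * y * p l = z • (u i * star (u l)) := by
      intro i l
      by_cases hil : c i = c l
      · obtain ⟨z, hz⟩ := hscalar (c i) (star (u i) * y * u l)
          (by rw [← mul_assoc, ← mul_assoc, hup'])
          (by rw [mul_assoc, hil, hup])
        refine ⟨z, fun h => absurd hil h, ?_⟩
        calc p i * y * p l = u i * (star (u i) * y * u l) * star (u l) := by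
              rw [← hu2, ← hu2]; noncomm_ring
          _ = z • (u i * star (u l)) := by
              rw [hz, mul_smul_comm, smul_mul_assoc, hup]
      · refine ⟨0, fun _ => rfl, ?_⟩
        rw [zero_smul]
        by_contra hne
        obtain ⟨v, hv1, hv2⟩ := exists_partialIsometry_of_isMinimalProj (hmin i) (hmin l) hne
          (by rw [← mul_assoc, ← mul_assoc, hid]) (by rw [mul_assoc, hid])
        exact hil (hcc i l ⟨v, hv1, hv2⟩)
    choose Y hY0 hY using hentry
    refine ⟨Y, hY0, ?_⟩
    calc frameSum u Y = ∑ i, ∑ l, p i * y * p l := by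
          refine Finset.sum_congr rfl fun i _ => Finset.sum_congr rfl fun l _ => ?_
          rw [hY]
      _ = (∑ i, p i) * y * ∑ l, p l := by
          simp only [Finset.sum_mul, Finset.mul_sum]
          rw [Finset.sum_comm]
      _ = y := by rw [hsum, one_mul, mul_one]

end FiniteDimensional

/-! ### Approximation of hyperfinite tuples by matrix units -/

/-- Every self-adjoint contraction is the bounded transform of an element of its own functional
calculus: `s = 2t / (1 + t²)` for `t = s / (1 + √(1 - s²))`. -/
theorem exists_bddTransform_preimage {𝒜 : Type*} [CStarAlgebra 𝒜] {x : 𝒜}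
    (hx : IsSelfAdjoint x) (hx1 : ‖x‖ ≤ 1) :
    ∃ z : 𝒜, x * (1 + star z * z) = 2 * z ∧ ∀ t, Commute x t → Commute z t := by
  set h : ℝ → ℝ := fun s => s / (1 + √(1 - s ^ 2)) with hh
  have hpos : ∀ s : ℝ, 0 < 1 + √(1 - s ^ 2) := fun s => by positivity
  have hcont : Continuous h :=
    continuous_id.div (by fun_prop) fun s => (hpos s).ne'
  refine ⟨cfc h x, ?_, fun t ht => hx.commute_cfc ht h⟩
  have hsa : star (cfc h x) = cfc h x := (cfc_predicate h x : IsSelfAdjoint _).star_eq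
  have h1 : cfc (fun s : ℝ => s * (1 + h s * h s)) x = cfc (fun s : ℝ => 2 * h s) x := by
    refine cfc_congr fun s hs => ?_
    have hs1 : |s| ≤ 1 := by
      have hnt : Nontrivial 𝒜 := by
        by_contra hnt
        rw [not_nontrivial_iff_subsingleton] at hnt
        rw [spectrum.of_subsingleton] at hs
        exact hs
      exact (spectrum.norm_le_norm_of_mem hs).trans hx1
    have h2 : 0 ≤ 1 - s ^ 2 := by
      have := (sq_le_one_iff_abs_le_one s).2 hs1
      linarith
    have h3 := Real.sq_sqrt h2
    have h4 := hpos s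
    simp only [hh]
    set q := √(1 - s ^ 2)
    field_simp
    have h5 : s ^ 2 = 1 - q ^ 2 := by linarith
    rw [h5]
    ring
  have e1 : cfc (fun s : ℝ => s * (1 + h s * h s)) x = x * (1 + cfc h x * cfc h x) := by
    rw [cfc_mul (fun s : ℝ => s) (fun s => 1 + h s * h s) x (by fun_prop) (by fun_prop),
      cfc_id' ℝ x, cfc_add x (fun _ : ℝ => (1 : ℝ)) (fun s => h s * h s) (by fun_prop) (by fun_prop),
      cfc_mul h h x (by fun_prop) (by fun_prop), cfc_const_one ℝ x]
  have e2 : cfc (fun s : ℝ => 2 * h s) x = 2 * cfc h x := by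
    rw [cfc_const_mul (2 : ℝ) h x (by fun_prop), two_smul, two_mul]
  rw [hsa, ← e1, h1, e2]

theorem IsMatrixUnitFrame.map {ι R S : Type*} [Fintype ι] [Ring R] [StarRing R] [Algebra ℂ R]
    [Ring S] [StarRing S] [Algebra ℂ S] {c : ι → ι} {u : ι → R} (h : IsMatrixUnitFrame c u)
    (f : R →⋆ₐ[ℂ] S) : IsMatrixUnitFrame c fun i => f (u i) where
  orthogonal i j hij := by rw [← map_star, ← map_mul, h.orthogonal i j hij, map_zero]
  initial i := by rw [← map_star, ← map_star, ← map_mul, ← map_mul, h.initial]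
  partial_isometry i := by rw [← map_star, ← map_mul, ← map_mul, h.partial_isometry]
  sum_final := by simp only [← map_star, ← map_mul, ← map_sum, h.sum_final, map_one]

theorem map_frameSum {ι R S : Type*} [Fintype ι] [Ring R] [StarRing R] [Algebra ℂ R]
    [Ring S] [StarRing S] [Algebra ℂ S] (f : R →⋆ₐ[ℂ] S) (u : ι → R) (y : Matrix ι ι ℂ) :
    f (frameSum u y) = frameSum (fun i => f (u i)) y := by
  simp only [frameSum, map_sum, map_smul, map_mul, map_star]

theorem frameSum_conjTranspose {ι R : Type*} [Fintype ι] [Ring R] [StarRing R] [Algebra ℂ R]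
    [StarModule ℂ R] (u : ι → R) (y : Matrix ι ι ℂ) :
    frameSum u y.conjTranspose = star (frameSum u y) := by
  simp only [frameSum, star_sum, star_smul, star_mul, star_star, Matrix.conjTranspose_apply]
  rw [Finset.sum_comm]

theorem frameSum_add {ι R : Type*} [Fintype ι] [Ring R] [StarRing R] [Algebra ℂ R]
    (u : ι → R) (y y' : Matrix ι ι ℂ) :
    frameSum u (y + y') = frameSum u y + frameSum u y' := by
  simp only [frameSum, Matrix.add_apply, add_smul, Finset.sum_add_distrib]

theorem frameSum_smul {ι R : Type*} [Fintype ι] [Ring R] [StarRing R] [Algebra ℂ R]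
    (u : ι → R) (a : ℂ) (y : Matrix ι ι ℂ) :
    frameSum u (a • y) = a • frameSum u y := by
  simp only [frameSum, Matrix.smul_apply, smul_assoc, Finset.smul_sum]

section

variable {H : Type*} [NormedAddCommGroup H] [InnerProductSpace ℂ H] [CompleteSpace H]

theorem subset_generatedVN (S : Set (H →L[ℂ] H)) : S ⊆ (generatedVN S : Set (H →L[ℂ] H)) :=
  (generatedVN_le_iff S _).1 le_rfl

theorem mem_generatedVN_of_commute {S : Set (H →L[ℂ] H)} {x z : H →L[ℂ] H} (hx : x ∈ S)
    (hz : ∀ t, Commute x t → Commute z t) : z ∈ generatedVN S := by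
  change z ∈ (generatedVN S : Set (H →L[ℂ] H))
  rw [coe_generatedVN]
  intro t ht
  exact (hz t (ht x (Or.inl hx))).symm.eq

/-- The *-algebra of polynomials in a self-adjoint tuple. -/
noncomputable def polynomialStarSubalgebra {κ : Type*} (X : κ → H →L[ℂ] H)
    (hX : ∀ k, IsSelfAdjoint (X k)) : StarSubalgebra ℂ (H →L[ℂ] H) where
  toSubalgebra := (FreeAlgebra.lift ℂ X).range
  star_mem' := by
    rintro _ ⟨P, rfl⟩
    obtain ⟨Q, K, h⟩ := AdjointBound.exists 0 P
    exact ⟨Q, h.lift_eq_star hX⟩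

theorem coe_lift_toStarSubalgebra {κ : Type*} {M : VonNeumannAlgebra H}
    (X : κ → M.toStarSubalgebra) (P : FreeAlgebra ℂ κ) :
    ((FreeAlgebra.lift ℂ X P : M.toStarSubalgebra) : H →L[ℂ] H) =
      FreeAlgebra.lift ℂ (fun k => (X k : H →L[ℂ] H)) P := by
  have : (M.toStarSubalgebra.toSubalgebra.val).comp (FreeAlgebra.lift ℂ X) =
      FreeAlgebra.lift ℂ (fun k => (X k : H →L[ℂ] H)) := by
    apply FreeAlgebra.hom_ext
    funext k
    simp only [Function.comp_apply, AlgHom.comp_apply, FreeAlgebra.lift_ι_apply]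
    rfl
  exact congrArg (fun f => f P) this

variable {M : VonNeumannAlgebra H} {τ : M.toStarSubalgebra →ₗ[ℂ] ℂ}

theorem IsNormalTracialState.exists_polynomial (hτ : IsNormalTracialState M τ) {κ : Type*}
    {X : κ → M.toStarSubalgebra} (hX : ∀ k, IsSelfAdjoint (X k)) {z : M.toStarSubalgebra}
    (hz : (z : H →L[ℂ] H) ∈ generatedVN (Set.range fun k => (X k : H →L[ℂ] H)))
    {ε : ℝ} (hε : 0 < ε) : ∃ P, norm2 τ (FreeAlgebra.lift ℂ X P - z) < ε := by
  have hX' : ∀ k, IsSelfAdjoint (X k : H →L[ℂ] H) := fun k => congrArg Subtype.val (hX k)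
  set 𝒟 := polynomialStarSubalgebra (fun k => (X k : H →L[ℂ] H)) hX' with h𝒟
  have h1 : 𝒟 ≤ M.toStarSubalgebra := by
    rintro _ ⟨P, rfl⟩
    change FreeAlgebra.lift ℂ (fun k => (X k : H →L[ℂ] H)) P ∈ _
    rw [← coe_lift_toStarSubalgebra]
    exact Subtype.mem _
  have h2 : generatedVN (Set.range fun k => (X k : H →L[ℂ] H)) ≤
      generatedVN (𝒟 : Set (H →L[ℂ] H)) := by
    rw [generatedVN_le_iff]
    rintro _ ⟨k, rfl⟩
    refine subset_generatedVN _ ?_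
    exact ⟨FreeAlgebra.ι ℂ k, by simp⟩
  obtain ⟨d, ⟨P, hP⟩, hd⟩ := hτ.exists_norm2_sub_lt 𝒟 h1 (h2 hz) hε
  refine ⟨P, ?_⟩
  have : FreeAlgebra.lift ℂ X P = d := by
    apply Subtype.ext
    rw [coe_lift_toStarSubalgebra]
    exact hP
  rwa [this]

/-- A tuple `X` is approximated in 2-norm, boundedly in norm, by linear combinations of matrix units,
and these are 2-norm limits of polynomials in `X`. -/
def HasFrameApprox {κ 𝒜 : Type*} [CStarAlgebra 𝒜] (φ : 𝒜 →ₗ[ℂ] ℂ) (X : κ → 𝒜) : Prop :=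
  ∃ K : ℝ, ∀ ε : ℝ, 0 < ε → ∃ (D : ℕ) (c : Fin D → Fin D) (u : Fin D → 𝒜)
    (Y : κ → Matrix (Fin D) (Fin D) ℂ), IsMatrixUnitFrame c u ∧
    (∀ k i l, c i ≠ c l → Y k i l = 0) ∧ (∀ k, (Y k).IsHermitian) ∧
    (∀ k, ‖frameSum u (Y k)‖ ≤ K) ∧ (∀ k, norm2 φ (X k - frameSum u (Y k)) < ε) ∧
    ∀ i, ∀ η : ℝ, 0 < η → ∃ P, norm2 φ (FreeAlgebra.lift ℂ X P - u i) < η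

/-- This is where hyperfiniteness enters: everything about the limit tuple that is used afterwards is
contained in `HasFrameApprox`. -/
theorem IsNormalTracialState.hasFrameApprox (hτ : IsNormalTracialState M τ) {κ : Type*}
    [Fintype κ] {X : κ → M.toStarSubalgebra} (hX : ∀ k, IsSelfAdjoint (X k))
    (hyp : IsHyperfinite (generatedVN (Set.range fun k => (X k : H →L[ℂ] H)))) :
    HasFrameApprox τ X := by
  obtain ⟨B, hBmono, hBfin, hBgen⟩ := hyp
  have hφ := hτ.isTracialState
  set W := generatedVN (Set.range fun k => (X k : H →L[ℂ] H)) with hW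
  have hWM : W ≤ M := by
    rw [hW, generatedVN_le_iff]
    rintro _ ⟨k, rfl⟩
    exact (X k).2
  have hBW : ∀ k, ∀ x ∈ B k, x ∈ W := fun k x hx => by
    rw [← hBgen]
    exact subset_generatedVN _ (Set.mem_iUnion.2 ⟨k, hx⟩)
  have hBM : ∀ k, B k ≤ M.toStarSubalgebra := fun k x hx => hWM (hBW k x hx)
  have h𝒟 : ((⨆ k, B k : StarSubalgebra ℂ (H →L[ℂ] H)) : Set (H →L[ℂ] H)) =
      ⋃ k, (B k : Set (H →L[ℂ] H)) :=
    StarSubalgebra.coe_iSup_of_directed hBmono.directed_le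
  obtain ⟨c₀, hc₀, hXc⟩ : ∃ c₀ : ℝ, 0 < c₀ ∧ ∀ k, ‖X k‖ ≤ c₀ := by
    refine ⟨1 + ∑ k, ‖X k‖, by positivity, fun k => ?_⟩
    have := Finset.single_le_sum (f := fun k => ‖X k‖) (fun k _ => norm_nonneg _)
      (Finset.mem_univ k)
    linarith
  have hc₀' : (c₀ : ℂ) ≠ 0 := by exact_mod_cast hc₀.ne'
  -- `X k = c₀ • bddTransform (z k)` with `z k` in the von Neumann algebra generated by `X`.
  have hz : ∀ k, ∃ z : M.toStarSubalgebra, (z : H →L[ℂ] H) ∈ W ∧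
      bddTransform z = (c₀ : ℂ)⁻¹ • X k := by
    intro k
    have hsa : IsSelfAdjoint ((c₀ : ℂ)⁻¹ • (X k : H →L[ℂ] H)) := by
      rw [IsSelfAdjoint, star_smul, Complex.star_def, map_inv₀, Complex.conj_ofReal]
      congr 1
      exact congrArg Subtype.val (hX k)
    have hnorm : ‖(c₀ : ℂ)⁻¹ • (X k : H →L[ℂ] H)‖ ≤ 1 := by
      rw [norm_smul, norm_inv, Complex.norm_real, Real.norm_of_nonneg hc₀.le,
        inv_mul_le_iff₀ hc₀, mul_one]
      exact hXc k
    obtain ⟨z, hz1, hz2⟩ := exists_bddTransform_preimage hsa hnorm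
    have hzW : z ∈ W := mem_generatedVN_of_commute (Set.mem_range_self k) fun t ht =>
      hz2 t (ht.smul_left _)
    refine ⟨⟨z, hWM hzW⟩, hzW, bddTransform_eq (Subtype.ext ?_)⟩
    rw [two_mul] at hz1 ⊢
    exact hz1
  choose z hzW hzX using hz
  refine ⟨c₀ * 4, fun ε hε => ?_⟩
  set η : ℝ := ε / (28 * c₀) with hη
  have hη0 : 0 < η := by positivity
  have hd : ∀ k, ∃ d : M.toStarSubalgebra, (∃ l, (d : H →L[ℂ] H) ∈ B l) ∧
      norm2 τ (d - z k) < η := by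
    intro k
    have h1 : (⨆ k, B k : StarSubalgebra ℂ (H →L[ℂ] H)) ≤ M.toStarSubalgebra := iSup_le hBM
    have h2 : (z k : H →L[ℂ] H) ∈
        generatedVN ((⨆ k, B k : StarSubalgebra ℂ (H →L[ℂ] H)) : Set (H →L[ℂ] H)) := by
      rw [h𝒟, hBgen]
      exact hzW k
    obtain ⟨d, hd1, hd2⟩ := hτ.exists_norm2_sub_lt _ h1 h2 hη0
    have hd3 : (d : H →L[ℂ] H) ∈
      ((⨆ k, B k : StarSubalgebra ℂ (H →L[ℂ] H)) : Set (H →L[ℂ] H)) := hd1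
    rw [h𝒟, Set.mem_iUnion] at hd3
    exact ⟨d, hd3, hd2⟩
  choose d hdB hdz using hd
  choose l hl using hdB
  set L := Finset.univ.sup l with hL
  have hdL : ∀ k, (d k : H →L[ℂ] H) ∈ B L := fun k =>
    hBmono (Finset.le_sup (Finset.mem_univ k)) (hl k)
  have := hBfin L
  have hclosed : IsClosed (B L : Set (H →L[ℂ] H)) :=
    (Subalgebra.toSubmodule (B L).toSubalgebra).closed_of_finiteDimensional
  obtain ⟨D, c, v, hv, hspan⟩ := exists_matrixUnitFrame (B L)
  set incl : B L →⋆ₐ[ℂ] M.toStarSubalgebra := StarSubalgebra.inclusion (hBM L) with hincl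
  have hex : ∀ k, ∃ b : B L, ‖incl b‖ ≤ 4 ∧ norm2 τ (incl b - bddTransform (z k)) ≤ 14 * η := by
    intro k
    obtain ⟨n, hn⟩ := exists_forall_norm_bddApprox_error_le (‖d k‖ ^ 2) (sq_nonneg _)
      (ε := min 1 η) (by positivity)
    refine ⟨bddApprox (‖d k‖ ^ 2) n ⟨d k, hdL k⟩ (star ⟨d k, hdL k⟩), ?_⟩
    have h1 : incl (bddApprox (‖d k‖ ^ 2) n ⟨d k, hdL k⟩ (star ⟨d k, hdL k⟩)) =
        bddApprox (‖d k‖ ^ 2) n (d k) (star (d k)) :=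
      map_bddApprox incl.toAlgHom _ _ _ _
    rw [h1]
    have h2 := (norm_bddTransform_sub_bddApprox_le (x := d k) le_rfl n).trans hn
    have h3 := norm_bddTransform_le (d k)
    have h4 := norm_sub_norm_le (bddApprox (‖d k‖ ^ 2) n (d k) (star (d k))) (bddTransform (d k))
    rw [norm_sub_rev] at h4
    have h5 := hφ.norm2_sub_le_add (bddApprox (‖d k‖ ^ 2) n (d k) (star (d k)))
      (bddTransform (d k)) (bddTransform (z k))
    have h6 := hφ.norm2_bddTransform_sub_le (d k) (z k)
    have h7 := hφ.norm2_le (bddTransform (d k) - bddApprox (‖d k‖ ^ 2) n (d k) (star (d k)))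
    rw [norm2_sub_comm] at h7
    have h8 := hdz k
    have h9 := min_le_left 1 η
    have h10 := min_le_right 1 η
    constructor <;> linarith
  choose b hb4 hbz using hex
  choose Y₀ hY₀ hYb using fun k => hspan (b k)
  refine ⟨D, c, fun i => incl (v i),
    fun k => ((c₀ : ℂ) * (2 : ℂ)⁻¹) • (Y₀ k + (Y₀ k).conjTranspose), hv.map incl, ?_, ?_, ?_, ?_, ?_⟩
  · intro k i l hil
    simp [hY₀ k i l hil, hY₀ k l i hil.symm]
  · intro k
    rw [Matrix.IsHermitian, Matrix.conjTranspose_smul, Matrix.conjTranspose_add,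
      Matrix.conjTranspose_conjTranspose, add_comm]
    congr 1
    simp
  all_goals
    have hsum : ∀ k, frameSum (fun i => incl (v i)) (((c₀ : ℂ) * (2 : ℂ)⁻¹) •
        (Y₀ k + (Y₀ k).conjTranspose)) =
        ((c₀ : ℂ) * (2 : ℂ)⁻¹) • (incl (b k) + star (incl (b k))) := by
      intro k
      rw [frameSum_smul, frameSum_add, frameSum_conjTranspose, ← map_frameSum, hYb]
    have hcn : ‖(c₀ : ℂ) * (2 : ℂ)⁻¹‖ = c₀ / 2 := by
      rw [norm_mul, norm_inv, Complex.norm_real, Real.norm_of_nonneg hc₀.le, Complex.norm_ofNat]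
      rfl
  · intro k
    rw [hsum, norm_smul, hcn]
    have := norm_add_le (incl (b k)) (star (incl (b k)))
    rw [norm_star] at this
    nlinarith [hb4 k]
  · intro k
    rw [hsum]
    have h1 : X k = ((c₀ : ℂ) * (2 : ℂ)⁻¹) • (bddTransform (z k) + star (bddTransform (z k))) := by
      rw [hzX, star_smul, (hX k).star_eq, Complex.star_def, map_inv₀, Complex.conj_ofReal,
        ← two_smul ℂ, smul_smul, smul_smul]
      rw [show (c₀ : ℂ) * 2⁻¹ * 2 * (c₀ : ℂ)⁻¹ = 1 by field_simp, one_smul]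
    have h2 : X k - ((c₀ : ℂ) * (2 : ℂ)⁻¹) • (incl (b k) + star (incl (b k))) =
        -(((c₀ : ℂ) * (2 : ℂ)⁻¹) • ((incl (b k) - bddTransform (z k)) +
          star (incl (b k) - bddTransform (z k)))) := by
      conv_lhs => rw [h1]
      rw [← smul_sub, ← smul_neg, star_sub]
      congr 1
      abel
    rw [h2, norm2_neg, norm2_smul, hcn]
    have h3 := hφ.norm2_add_le (incl (b k) - bddTransform (z k))
      (star (incl (b k) - bddTransform (z k)))
    rw [hφ.norm2_star] at h3
    have h4 := hbz k
    have h5 : c₀ * (14 * η) = ε / 2 := by rw [hη]; field_simp; norm_num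
    nlinarith
  · intro i η' hη'
    exact hτ.exists_polynomial hX (hBW L _ (v i).2) hη'

end

/-! ### Microstates: truncation and stability of moments -/

/-- The filter of pairs `(m, δ)` with `m → ∞`, `δ ↘ 0`, along which moments are compared. -/
def lawFilter : Filter (ℕ × ℝ) := atTop ×ˢ 𝓝[>] 0

instance : lawFilter.NeBot := by unfold lawFilter; infer_instance

theorem eventually_lawFilter (m : ℕ) {δ : ℝ} (hδ : 0 < δ) :
    ∀ᶠ p in lawFilter, m ≤ p.1 ∧ 0 < p.2 ∧ p.2 ≤ δ := by
  have h1 : ∀ᶠ p : ℕ × ℝ in lawFilter, m ≤ p.1 :=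
    tendsto_fst.eventually (eventually_ge_atTop m)
  have h2 : ∀ᶠ p : ℕ × ℝ in lawFilter, 0 < p.2 :=
    tendsto_snd.eventually (eventually_mem_nhdsWithin (a := (0 : ℝ)) (s := Ioi 0))
  have h3 : ∀ᶠ p : ℕ × ℝ in lawFilter, p.2 < δ :=
    tendsto_snd.eventually (eventually_nhdsWithin_of_eventually_nhds (eventually_lt_nhds hδ))
  filter_upwards [h1, h2, h3] with p hp1 hp2 hp3 using ⟨hp1, hp2, hp3.le⟩

theorem exists_of_eventually_lawFilter {Q : ℕ × ℝ → Prop} (h : ∀ᶠ p in lawFilter, Q p) :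
    ∃ m : ℕ, ∃ δ : ℝ, 0 < δ ∧ Q (m, δ) := by
  obtain ⟨⟨m, δ⟩, h1, -, h2, -⟩ := (h.and (eventually_lawFilter 0 one_pos)).exists
  exact ⟨m, δ, h2, h1⟩

section

variable {κ 𝒜 : Type*} [CStarAlgebra 𝒜] {φ : 𝒜 →ₗ[ℂ] ℂ} {X : κ → 𝒜}

theorem MomentClose.mono {ℬ : Type*} [Ring ℬ] [Algebra ℂ ℬ] {ψ : ℬ →ₗ[ℂ] ℂ} {A : κ → ℬ}
    {m m' : ℕ} {δ δ' : ℝ} (h : MomentClose φ X ψ A m δ) (hm : m' ≤ m) (hδ : δ ≤ δ') :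
    MomentClose φ X ψ A m' δ' :=
  fun w hw => (h w (hw.trans hm)).trans_le hδ

theorem eventually_norm_lift_sub_lt (φ : 𝒜 →ₗ[ℂ] ℂ) (X : κ → 𝒜) (P : FreeAlgebra ℂ κ) {ε : ℝ}
    (hε : 0 < ε) :
    ∀ᶠ p in lawFilter, ∀ {ℬ : Type*} [CStarAlgebra ℬ] (ψ : ℬ →ₗ[ℂ] ℂ) (A : κ → ℬ),
      MomentClose φ X ψ A p.1 p.2 →
      ‖ψ (FreeAlgebra.lift ℂ A P) - φ (FreeAlgebra.lift ℂ X P)‖ < ε := by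
  obtain ⟨K, m, hK, h⟩ := exists_momentClose_bound P
  filter_upwards [eventually_lawFilter m (δ := ε / (K + 1)) (by positivity)] with p hp ℬ _ ψ A hA
  refine (h φ X ψ A _ (hA.mono hp.1 hp.2.2)).trans_lt ?_
  rw [mul_div_assoc', div_lt_iff₀ (by positivity)]
  nlinarith

theorem eventually_norm2_lift_lt (hφ : IsTracialState φ) (hX : ∀ k, IsSelfAdjoint (X k))
    (P : FreeAlgebra ℂ κ) {η : ℝ} (hP : norm2 φ (FreeAlgebra.lift ℂ X P) < η) :
    ∀ᶠ p in lawFilter, ∀ {ℬ : Type*} [CStarAlgebra ℬ] {ψ : ℬ →ₗ[ℂ] ℂ} {A : κ → ℬ},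
      IsTracialState ψ → (∀ k, IsSelfAdjoint (A k)) → MomentClose φ X ψ A p.1 p.2 →
      norm2 ψ (FreeAlgebra.lift ℂ A P) < η := by
  obtain ⟨Q, K, h⟩ := AdjointBound.exists 0 P
  have hη : 0 < η := (norm2_nonneg _).trans_lt hP
  have h1 : norm2 φ (FreeAlgebra.lift ℂ X P) ^ 2 < η ^ 2 :=
    pow_lt_pow_left₀ hP (norm2_nonneg _) two_ne_zero
  filter_upwards [eventually_norm_lift_sub_lt φ X (Q * P) (sub_pos.2 h1)] with p hp ℬ _ ψ A hψ hA hc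
  have h2 := hp ψ A hc
  rw [map_mul (FreeAlgebra.lift ℂ A), map_mul (FreeAlgebra.lift ℂ X), h.lift_eq_star hX, h.lift_eq_star hA, ← hφ.ofReal_norm2_sq,
    ← hψ.ofReal_norm2_sq, ← Complex.ofReal_sub, Complex.norm_real, Real.norm_eq_abs] at h2
  have h3 := (le_abs_self _).trans_lt h2
  exact lt_of_pow_lt_pow_left₀ 2 hη.le (by linarith)

theorem norm_word_le {ℬ : Type*} [CStarAlgebra ℬ] {b : κ → ℬ} {c : ℝ} (hc : 0 ≤ c)
    (hb : ∀ k, ‖b k‖ ≤ c) (w : List κ) : ‖(w.map b).prod‖ ≤ c ^ w.length := by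
  induction w with
  | nil => simpa using norm_one_le_one
  | cons y u ihu =>
    simp only [List.map_cons, List.prod_cons, List.length_cons, pow_succ']
    exact (norm_mul_le _ _).trans (by gcongr; exact hb y)

theorem star_word {ℬ : Type*} [CStarAlgebra ℬ] {b : κ → ℬ} (hb : ∀ k, IsSelfAdjoint (b k))
    (w : List κ) : star (w.map b).prod = (w.reverse.map b).prod := by
  induction w with
  | nil => simp
  | cons y u ihu => simp [ihu, (hb y).star_eq]

/-- The 2-norm of words in a microstate is controlled by the norms of the limit variables. -/
theorem norm2_word_sq_le (hφ : IsTracialState φ) {c : ℝ} (hc : 1 ≤ c) (hXc : ∀ k, ‖X k‖ ≤ c)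
    {ℬ : Type*} [CStarAlgebra ℬ] {ψ : ℬ →ₗ[ℂ] ℂ} {A : κ → ℬ} (hψ : IsTracialState ψ)
    (hA : ∀ k, IsSelfAdjoint (A k)) {m : ℕ} {δ : ℝ} (hδ : δ ≤ 1)
    (h : MomentClose φ X ψ A (2 * m) δ) {v : List κ} (hv : v.length ≤ m) :
    norm2 ψ (v.map A).prod ≤ c ^ (2 * m) + 1 := by
  have h1 := h (v.reverse ++ v) (by simp; omega)
  have h2 : ‖φ (((v.reverse ++ v).map X).prod)‖ ≤ c ^ (2 * m) := by
    refine (hφ.norm_map_le _).trans ((hφ.norm2_le _).trans ?_)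
    refine (norm_word_le (by linarith) hXc _).trans (pow_le_pow_right₀ hc ?_)
    simp; omega
  have h3 : norm2 ψ (v.map A).prod ^ 2 ≤ c ^ (2 * m) + 1 := by
    rw [hψ.norm2_sq, star_word hA, ← List.prod_append, ← List.map_append]
    refine (Complex.re_le_norm _).trans ?_
    have := norm_sub_norm_le (ψ (((v.reverse ++ v).map A).prod)) (φ (((v.reverse ++ v).map X).prod))
    linarith
  have h4 : 1 ≤ c ^ (2 * m) := one_le_pow₀ hc
  nlinarith [norm2_nonneg (φ := ψ) (v.map A).prod]

/-- Bounded tuples 2-norm close to a microstate are microstates. -/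
theorem exists_eventually_momentClose (hφ : IsTracialState φ) {c : ℝ} (hc : 1 ≤ c)
    (hXc : ∀ k, ‖X k‖ ≤ c) (m : ℕ) {δ : ℝ} (hδ : 0 < δ) :
    ∃ ε : ℝ, 0 < ε ∧ ∀ᶠ p in lawFilter, ∀ {ℬ : Type*} [CStarAlgebra ℬ] {ψ : ℬ →ₗ[ℂ] ℂ}
      {A A' : κ → ℬ}, IsTracialState ψ → (∀ k, IsSelfAdjoint (A k)) →
      MomentClose φ X ψ A p.1 p.2 → (∀ k, ‖A' k‖ ≤ c) → (∀ k, norm2 ψ (A k - A' k) ≤ ε) →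
      MomentClose φ X ψ A' m δ := by
  set L : ℝ := c ^ (2 * m) + 1 with hL
  have hc0 : 0 < c := by linarith
  have hLpos : 0 < L := by positivity
  refine ⟨δ / (2 * (m * (L * c ^ m) + 1)), by positivity, ?_⟩
  filter_upwards [eventually_lawFilter (2 * m) (δ := min 1 (δ / 2)) (by positivity)] with
    p hp ℬ _ ψ A A' hψ hA hclose hA' hAA' w hw
  have h1 := hclose.mono hp.1 (hp.2.2.trans (min_le_left _ _))
  have h2 := hψ.norm_map_word_sub_le (a := A) (b := A') (m := m) hc (by positivity)
    (fun v hv => norm2_word_sq_le hφ hc hXc hψ hA le_rfl h1 hv.le) hA' hAA' hw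
  have h3 := hclose w (by omega)
  have h4 : (m : ℝ) * (L * (δ / (2 * (m * (L * c ^ m) + 1)) * c ^ m)) < δ / 2 := by
    have : (m : ℝ) * (L * (δ / (2 * (m * (L * c ^ m) + 1)) * c ^ m)) =
        δ / 2 * ((m * (L * c ^ m)) / (m * (L * c ^ m) + 1)) := by
      field_simp
    rw [this]
    refine mul_lt_of_lt_one_right (by positivity) ?_
    rw [div_lt_one (by positivity)]
    linarith
  have h5 := norm_sub_le_norm_sub_add_norm_sub (ψ ((w.map A').prod)) (ψ ((w.map A).prod))
    (φ ((w.map X).prod))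
  rw [norm_sub_rev (ψ ((w.map A').prod)) (ψ ((w.map A).prod))] at h5
  rw [← hL] at h2
  have h6 := hp.2.2.trans (min_le_right _ _)
  linarith

end

theorem IsTracialState.re_map_cfc_nonneg {ℬ : Type*} [CStarAlgebra ℬ] {ψ : ℬ →ₗ[ℂ] ℂ}
    (hψ : IsTracialState ψ) (a : ℬ) {f : ℝ → ℝ} (hf : Continuous f)
    (h : ∀ t, 0 ≤ f t) : 0 ≤ (ψ (cfc f a)).re := by
  have hs : Continuous fun t => √(f t) := by fun_prop
  have hsa : star (cfc (fun t => √(f t)) a) = cfc (fun t => √(f t)) a :=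
    (cfc_predicate (fun t => √(f t)) a : IsSelfAdjoint _).star_eq
  have h1 : star (cfc (fun t => √(f t)) a) * cfc (fun t => √(f t)) a = cfc f a := by
    rw [hsa, ← cfc_mul _ _ a hs.continuousOn hs.continuousOn]
    congr 1
    ext t
    exact Real.mul_self_sqrt (h t)
  rw [← h1]
  exact hψ.re_nonneg _

/-- Cutting off a self-adjoint element at `c` changes it in 2-norm by an amount controlled by its
moments. -/
theorem IsTracialState.exists_truncation {ℬ : Type*} [CStarAlgebra ℬ] {ψ : ℬ →ₗ[ℂ] ℂ}
    (hψ : IsTracialState ψ) {a : ℬ} (ha : IsSelfAdjoint a) {c : ℝ} (hc : 0 ≤ c) :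
    ∃ a' : ℬ, IsSelfAdjoint a' ∧ ‖a'‖ ≤ c ∧ ∀ (θ : ℝ) (p : ℕ), 0 < θ →
      norm2 ψ (a - a') ^ 2 ≤ θ ^ 2 + (ψ (a ^ (2 * p + 2))).re / (c + θ) ^ (2 * p) := by
  set f : ℝ → ℝ := fun t => max (-c) (min t c) with hf
  have hfc : Continuous f := by fun_prop
  have hsa : IsSelfAdjoint (cfc f a) := cfc_predicate f a
  refine ⟨cfc f a, hsa, norm_cfc_le hc fun t _ => ?_, fun θ p hθ => ?_⟩
  · rw [Real.norm_eq_abs, abs_le]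
    exact ⟨le_max_left _ _, max_le (by linarith) (min_le_right _ _)⟩
  · set D : ℝ := (c + θ) ^ (2 * p) with hD
    have hD0 : 0 < D := by positivity
    set g : ℝ → ℝ := fun t => θ ^ 2 + D⁻¹ * t ^ (2 * p + 2) - (t - f t) * (t - f t) with hg
    have hgc : Continuous g := by fun_prop
    have hg0 : ∀ t, 0 ≤ g t := by
      intro t
      have hd : |t - f t| ≤ |t| ∧ (|t| ≤ c + θ → |t - f t| ≤ θ) := by
        simp only [hf]
        rcases le_total t c with h1 | h1
        · rw [min_eq_left h1]
          rcases le_total (-c) t with h2 | h2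
          · rw [max_eq_right h2]; simp [hθ.le]
          · rw [max_eq_left h2]
            constructor
            · rw [abs_of_nonpos (by linarith), abs_of_nonpos (by linarith)]; linarith
            · intro h3
              rw [abs_of_nonpos (by linarith : t ≤ 0)] at h3
              rw [abs_of_nonpos (by linarith)]; linarith
        · rw [min_eq_right h1, max_eq_right (by linarith)]
          constructor
          · rw [abs_of_nonneg (by linarith), abs_of_nonneg (by linarith)]; linarith
          · intro h3
            rw [abs_of_nonneg (by linarith : 0 ≤ t)] at h3
            rw [abs_of_nonneg (by linarith)]; linarith
      have he : t ^ (2 * p + 2) = (t ^ 2) ^ p * t ^ 2 := by rw [← pow_mul, pow_add]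
      simp only [hg]
      rw [← sq, he]
      by_cases h : |t| ≤ c + θ
      · have h1 : (t - f t) ^ 2 ≤ θ ^ 2 := by
          rw [← sq_abs]
          exact pow_le_pow_left₀ (abs_nonneg _) (hd.2 h) 2
        have h2 : 0 ≤ D⁻¹ * ((t ^ 2) ^ p * t ^ 2) := by positivity
        linarith
      · push Not at h
        have h1 : (t - f t) ^ 2 ≤ t ^ 2 := sq_le_sq.2 hd.1
        have h2 : D ≤ (t ^ 2) ^ p := by
          rw [hD, pow_mul]
          refine pow_le_pow_left₀ (by positivity) ?_ p
          rw [← sq_abs t]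
          exact pow_le_pow_left₀ (by positivity) h.le 2
        have h3 : t ^ 2 ≤ D⁻¹ * ((t ^ 2) ^ p * t ^ 2) := by
          rw [← mul_assoc]
          refine le_mul_of_one_le_left (sq_nonneg _) ?_
          rwa [inv_mul_eq_div, one_le_div hD0]
        nlinarith [sq_nonneg θ]
    have h1 := hψ.re_map_cfc_nonneg a hgc hg0
    have e1 : cfc (fun t => t - f t) a = a - cfc f a := by
      rw [cfc_sub (fun t => t) f a (by fun_prop) (by fun_prop), cfc_id' ℝ a]
    have e2 : cfc g a = ((θ ^ 2 : ℝ) : ℂ) • (1 : ℬ) + ((D⁻¹ : ℝ) : ℂ) • a ^ (2 * p + 2) -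
        star (a - cfc f a) * (a - cfc f a) := by
      rw [star_sub, ha.star_eq, hsa.star_eq, ← e1,
        ← cfc_mul _ _ a (by fun_prop) (by fun_prop), Complex.coe_smul, Complex.coe_smul,
        ← Algebra.algebraMap_eq_smul_one, ← cfc_const (θ ^ 2) a,
        ← cfc_pow_id (R := ℝ) a (2 * p + 2), ← cfc_smul _ _ a (by fun_prop),
        ← cfc_add a _ _ (by fun_prop) (by fun_prop), ← cfc_sub _ _ a (by fun_prop) (by fun_prop)]
      congr 1
    rw [e2, map_sub, map_add, map_smul, map_smul, hψ.map_one, Complex.sub_re, Complex.add_re,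
      smul_eq_mul, smul_eq_mul, Complex.re_ofReal_mul, Complex.re_ofReal_mul, Complex.one_re,
      mul_one, ← hψ.norm2_sq] at h1
    rw [div_eq_inv_mul]
    linarith

/-- Microstates can be cut off at the norms of the limit variables, at a small cost in 2-norm,
and remain microstates. -/
theorem eventually_exists_truncation {κ 𝒜 : Type*} [Fintype κ] [CStarAlgebra 𝒜]
    {φ : 𝒜 →ₗ[ℂ] ℂ} {X : κ → 𝒜} (hφ : IsTracialState φ)
    (m : ℕ) {δ ε : ℝ} (hδ : 0 < δ) (hε : 0 < ε) :
    ∀ᶠ p in lawFilter, ∀ {ℬ : Type*} [CStarAlgebra ℬ] {ψ : ℬ →ₗ[ℂ] ℂ} {A : κ → ℬ},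
      IsTracialState ψ → (∀ k, IsSelfAdjoint (A k)) → MomentClose φ X ψ A p.1 p.2 →
      ∃ A' : κ → ℬ, (∀ k, IsSelfAdjoint (A' k)) ∧ (∀ k, ‖A' k‖ ≤ ‖X k‖) ∧
        (∀ k, norm2 ψ (A k - A' k) ≤ ε) ∧ MomentClose φ X ψ A' m δ := by
  obtain ⟨c₀, hc₀, hXc⟩ : ∃ c₀ : ℝ, 1 ≤ c₀ ∧ ∀ k, ‖X k‖ ≤ c₀ := by
    refine ⟨1 + ∑ k, ‖X k‖, ?_, fun k => ?_⟩
    · have : 0 ≤ ∑ k, ‖X k‖ := by positivity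
      linarith
    · have := Finset.single_le_sum (f := fun k => ‖X k‖) (fun k _ => norm_nonneg _)
        (Finset.mem_univ k)
      linarith
  obtain ⟨ε₁, hε₁, hstab⟩ := exists_eventually_momentClose hφ hc₀ hXc m hδ
  set ε₂ := min ε ε₁ with hε₂
  have hε₂0 : 0 < ε₂ := by positivity
  set θ := ε₂ / 2 with hθ
  have hθ0 : 0 < θ := by positivity
  have hp : ∀ k, ∃ p : ℕ, ‖X k‖ ^ 2 * (‖X k‖ / (‖X k‖ + θ)) ^ (2 * p) < θ ^ 2 := by
    intro k
    have h1 : (‖X k‖ / (‖X k‖ + θ)) ^ 2 < 1 := by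
      have : ‖X k‖ / (‖X k‖ + θ) < 1 := by
        rw [div_lt_one (by positivity)]
        linarith
      exact pow_lt_one₀ (by positivity) this two_ne_zero
    have h2 := (tendsto_pow_atTop_nhds_zero_of_lt_one (by positivity) h1).const_mul (‖X k‖ ^ 2)
    rw [mul_zero] at h2
    obtain ⟨p, hp⟩ := (h2.eventually (gt_mem_nhds (by positivity : 0 < θ ^ 2))).exists
    exact ⟨p, by rwa [pow_mul]⟩
  choose q hq using hp
  have hev : ∀ k, ∀ᶠ p in lawFilter, 2 * q k + 2 ≤ p.1 ∧ 0 < p.2 ∧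
      p.2 ≤ (‖X k‖ + θ) ^ (2 * q k) * θ ^ 2 := fun k =>
    eventually_lawFilter _ (by positivity)
  filter_upwards [hstab, eventually_all.2 hev] with p hp1 hp2 ℬ _ ψ A hψ hA hclose
  choose A' hA'1 hA'2 hA'3 using fun k => hψ.exists_truncation (hA k) (norm_nonneg (X k))
  have hle : ∀ k, norm2 ψ (A k - A' k) ≤ ε₂ := by
    intro k
    have h1 := hA'3 k θ (q k) hθ0
    obtain ⟨h2, h3, h4⟩ := hp2 k
    have h5 := hclose (List.replicate (2 * q k + 2) k) (by simpa using h2)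
    simp only [List.map_replicate, List.prod_replicate] at h5
    have h6 : ‖φ (X k ^ (2 * q k + 2))‖ ≤ ‖X k‖ ^ (2 * q k + 2) :=
      (hφ.norm_map_le _).trans ((hφ.norm2_le _).trans (norm_pow_le' _ (by omega)))
    have hD0 : 0 < (‖X k‖ + θ) ^ (2 * q k) := by positivity
    have h7 : (ψ (A k ^ (2 * q k + 2))).re / (‖X k‖ + θ) ^ (2 * q k) ≤ 2 * θ ^ 2 := by
      rw [div_le_iff₀ hD0]
      have h8 := norm_sub_norm_le (ψ (A k ^ (2 * q k + 2))) (φ (X k ^ (2 * q k + 2)))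
      have h9 := Complex.re_le_norm (ψ (A k ^ (2 * q k + 2)))
      have h10 := (hq k).le
      rw [div_pow, mul_div_assoc', div_le_iff₀ hD0] at h10
      have h11 : ‖X k‖ ^ (2 * q k + 2) = ‖X k‖ ^ 2 * ‖X k‖ ^ (2 * q k) := by
        rw [add_comm, pow_add]
      nlinarith
    refine le_of_sq_le_sq ?_ hε₂0.le
    have h12 : ε₂ ^ 2 = 4 * θ ^ 2 := by rw [hθ]; ring
    nlinarith [sq_nonneg θ]
  exact ⟨A', hA'1, hA'2, fun k => (hle k).trans (min_le_left _ _),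
    hp1 hψ hA hclose (fun k => (hA'2 k).trans (hXc k)) fun k => (hle k).trans (min_le_right _ _)⟩

/-! ### Matrices in the normalized Hilbert–Schmidt norm -/

section MatrixNorm

open scoped Matrix.Norms.L2Operator

/-- The normalized trace as a linear functional. -/
noncomputable def ntrState (N : ℕ) : Matrix (Fin N) (Fin N) ℂ →ₗ[ℂ] ℂ where
  toFun := ntr
  map_add' A B := by simp [ntr, Matrix.trace_add, mul_add]
  map_smul' c A := by simp [ntr, Matrix.trace_smul, mul_left_comm]

theorem ntrState_apply {N : ℕ} (A : Matrix (Fin N) (Fin N) ℂ) :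
    ntrState N A = (N : ℂ)⁻¹ * A.trace := rfl

theorem ntrState_star_mul_self {N : ℕ} (A : Matrix (Fin N) (Fin N) ℂ) :
    ntrState N (star A * A) = (((N : ℝ)⁻¹ * ∑ i, ∑ j, ‖A i j‖ ^ 2 : ℝ) : ℂ) := by
  rw [ntrState_apply, Matrix.trace]
  push_cast
  congr 1
  simp only [Matrix.diag_apply, Matrix.mul_apply, Matrix.star_apply]
  rw [Finset.sum_comm]
  refine Finset.sum_congr rfl fun i _ => Finset.sum_congr rfl fun j _ => ?_
  rw [Complex.star_def, ← Complex.normSq_eq_conj_mul_self, Complex.normSq_eq_norm_sq]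
  push_cast
  rfl

theorem isTracialState_ntrState {N : ℕ} (hN : N ≠ 0) : IsTracialState (ntrState N) where
  map_one := by
    rw [ntrState_apply, Matrix.trace_one, Fintype.card_fin, inv_mul_cancel₀ (by exact_mod_cast hN)]
  nonneg A := by
    rw [ntrState_star_mul_self, Complex.zero_le_real]
    positivity
  trace A B := by rw [ntrState_apply, ntrState_apply, Matrix.trace_mul_comm]

theorem norm2_diagonal_sq {N : ℕ} (d : Fin N → ℂ) :
    norm2 (ntrState N) (Matrix.diagonal d) ^ 2 = (N : ℝ)⁻¹ * ∑ i, ‖d i‖ ^ 2 := by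
  rw [norm2, ntrState_star_mul_self, Complex.ofReal_re, Real.sq_sqrt (by positivity)]
  congr 1
  refine Finset.sum_congr rfl fun i _ => ?_
  rw [Finset.sum_eq_single i]
  · simp
  · intro j _ hj
    simp [Matrix.diagonal_apply_ne _ hj.symm]
  · simp

theorem norm2_diagonal_mono {N : ℕ} {d e : Fin N → ℂ} {K : ℝ} (hK : 0 ≤ K)
    (h : ∀ i, ‖d i‖ ≤ K * ‖e i‖) :
    norm2 (ntrState N) (Matrix.diagonal d) ≤ K * norm2 (ntrState N) (Matrix.diagonal e) := by
  refine le_of_sq_le_sq ?_ (mul_nonneg hK (norm2_nonneg _))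
  rw [mul_pow, norm2_diagonal_sq, norm2_diagonal_sq, mul_left_comm]
  gcongr
  rw [Finset.mul_sum]
  refine Finset.sum_le_sum fun i _ => ?_
  rw [← mul_pow]
  exact pow_le_pow_left₀ (norm_nonneg _) (h i) 2

theorem norm2_unitary_mul {𝒜 : Type*} [CStarAlgebra 𝒜] {φ : 𝒜 →ₗ[ℂ] ℂ} {V : 𝒜}
    (hV : V ∈ unitary 𝒜) (x : 𝒜) : norm2 φ (V * x) = norm2 φ x := by
  rw [norm2, norm2, star_mul]
  congr 3
  calc star x * star V * (V * x) = star x * (star V * V) * x := by noncomm_ring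
    _ = star x * x := by rw [Unitary.star_mul_self_of_mem hV, mul_one]

theorem IsTracialState.norm2_mul_unitary {𝒜 : Type*} [CStarAlgebra 𝒜] {φ : 𝒜 →ₗ[ℂ] ℂ}
    (hφ : IsTracialState φ) {V : 𝒜} (hV : V ∈ unitary 𝒜) (x : 𝒜) :
    norm2 φ (x * V) = norm2 φ x := by
  rw [← hφ.norm2_star, star_mul, norm2_unitary_mul (Unitary.star_mem hV), hφ.norm2_star]

theorem exists_unitary_diagonal {N : ℕ} {A : Matrix (Fin N) (Fin N) ℂ} (hA : A.IsHermitian) :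
    ∃ Q ∈ unitary (Matrix (Fin N) (Fin N) ℂ),
      A = Q * Matrix.diagonal (fun i => (hA.eigenvalues i : ℂ)) * star Q := by
  refine ⟨hA.eigenvectorUnitary, hA.eigenvectorUnitary.2, ?_⟩
  conv_lhs => rw [hA.spectral_theorem, Unitary.conjStarAlgAut_apply]
  rfl

/-- Polar decomposition: matrices that are nearly isometric in the Hilbert–Schmidt norm are close to
unitary matrices. -/
theorem exists_unitary_norm2_sub_le {N : ℕ} (hN : N ≠ 0) (T : Matrix (Fin N) (Fin N) ℂ) :
    ∃ W ∈ unitary (Matrix (Fin N) (Fin N) ℂ),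
      norm2 (ntrState N) (T - W) ≤ norm2 (ntrState N) (star T * T - 1) := by
  have hφ := isTracialState_ntrState hN
  have hpsd : (star T * T).PosSemidef := Matrix.posSemidef_conjTranspose_mul_self T
  obtain ⟨Q, hQ, hTQ⟩ := exists_unitary_diagonal hpsd.1
  set l := hpsd.1.eigenvalues with hl
  have hl0 : ∀ i, 0 ≤ l i := hpsd.eigenvalues_nonneg
  have hQ1 : star Q * Q = 1 := Unitary.star_mul_self_of_mem hQ
  have hQ2 : Q * star Q = 1 := Unitary.mul_star_self_of_mem hQ
  have hgram : star (T * Q) * (T * Q) = Matrix.diagonal (fun i => (l i : ℂ)) := by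
    calc star (T * Q) * (T * Q) = star Q * (star T * T) * Q := by
          rw [star_mul]; noncomm_ring
      _ = (star Q * Q) * Matrix.diagonal (fun i => (l i : ℂ)) * (star Q * Q) := by
          rw [hTQ]; noncomm_ring
      _ = _ := by rw [hQ1, one_mul, mul_one]
  set t : Fin N → EuclideanSpace ℂ (Fin N) := fun a => WithLp.toLp 2 fun i => (T * Q) i a with ht
  have hinner : ∀ a b, inner ℂ (t a) (t b) = if a = b then (l a : ℂ) else 0 := by
    intro a b
    have := congrFun (congrFun hgram a) b
    rw [Matrix.mul_apply, Matrix.diagonal_apply] at this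
    rw [← this, PiLp.inner_apply]
    refine Finset.sum_congr rfl fun i _ => ?_
    rw [Matrix.star_apply, RCLike.inner_apply, mul_comm]
    rfl
  have hnorm : ∀ a, ‖t a‖ = √(l a) := by
    intro a
    have h1 := hinner a a
    rw [if_pos rfl, inner_self_eq_norm_sq_to_K] at h1
    have h2 : ‖t a‖ ^ 2 = l a := by
      have := congrArg Complex.re h1
      simpa [← Complex.ofReal_pow] using this
    rw [← h2, Real.sqrt_sq (norm_nonneg _)]
  set v : Fin N → EuclideanSpace ℂ (Fin N) := fun a => ((√(l a) : ℝ) : ℂ)⁻¹ • t a with hv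
  have horth : Orthonormal ℂ (({a | l a ≠ 0} : Set (Fin N)).domRestrict v) := by
    constructor
    · rintro ⟨a, ha⟩
      change ‖v a‖ = 1
      have : √(l a) ≠ 0 := (Real.sqrt_pos.2 (lt_of_le_of_ne (hl0 a) (Ne.symm ha))).ne'
      rw [hv]
      simp only
      rw [norm_smul, hnorm, norm_inv, Complex.norm_real, Real.norm_of_nonneg (Real.sqrt_nonneg _),
        inv_mul_cancel₀ this]
    · rintro ⟨a, ha⟩ ⟨b, hb⟩ hab
      change inner ℂ (v a) (v b) = 0
      have hab' : a ≠ b := fun h => hab (Subtype.ext h)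
      simp only [hv]
      rw [inner_smul_left, inner_smul_right, hinner, if_neg hab', mul_zero, mul_zero]
  obtain ⟨b, hb⟩ := horth.exists_orthonormalBasis_extension_of_card_eq (by simp)
  set V : Matrix (Fin N) (Fin N) ℂ :=
    (EuclideanSpace.basisFun (Fin N) ℂ).toBasis.toMatrix b.toBasis with hVdef
  have hV : V ∈ unitary (Matrix (Fin N) (Fin N) ℂ) :=
    (EuclideanSpace.basisFun (Fin N) ℂ).toMatrix_orthonormalBasis_mem_unitary b
  have hVapp : ∀ i a, V i a = b a i := fun i a => by
    rw [hVdef, Module.Basis.toMatrix_apply]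
    simp
  have hTV : T * Q = V * Matrix.diagonal (fun a => ((√(l a) : ℝ) : ℂ)) := by
    ext i a
    rw [Matrix.mul_diagonal, hVapp]
    change t a i = _
    by_cases ha : l a = 0
    · have : t a = 0 := by rw [← norm_eq_zero, hnorm, ha, Real.sqrt_zero]
      rw [this, ha]
      simp
    · have h1 : ((√(l a) : ℝ) : ℂ) ≠ 0 := by
        exact_mod_cast (Real.sqrt_pos.2 (lt_of_le_of_ne (hl0 a) (Ne.symm ha))).ne'
      rw [hb a ha, hv]
      simp only [PiLp.smul_apply, smul_eq_mul]
      field_simp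
  refine ⟨V * star Q, mul_mem hV (Unitary.star_mem hQ), ?_⟩
  have e1 : norm2 (ntrState N) (T - V * star Q) =
      norm2 (ntrState N) (Matrix.diagonal (fun a => ((√(l a) - 1 : ℝ) : ℂ))) := by
    have h1 : T - V * star Q =
        V * Matrix.diagonal (fun a => ((√(l a) - 1 : ℝ) : ℂ)) * star Q := by
      have h2 : Matrix.diagonal (fun a => ((√(l a) - 1 : ℝ) : ℂ)) =
          Matrix.diagonal (fun a => ((√(l a) : ℝ) : ℂ)) - 1 := by
        rw [← Matrix.diagonal_one, Matrix.diagonal_sub]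
        simp
      rw [h2, mul_sub, ← hTV, mul_one, sub_mul, mul_assoc, hQ2, mul_one]
    rw [h1, hφ.norm2_mul_unitary (Unitary.star_mem hQ), norm2_unitary_mul hV]
  have e2 : norm2 (ntrState N) (star T * T - 1) =
      norm2 (ntrState N) (Matrix.diagonal (fun a => ((l a - 1 : ℝ) : ℂ))) := by
    have h1 : star T * T - 1 =
        Q * Matrix.diagonal (fun a => ((l a - 1 : ℝ) : ℂ)) * star Q := by
      have h2 : Matrix.diagonal (fun a => ((l a - 1 : ℝ) : ℂ)) =
          Matrix.diagonal (fun a => (l a : ℂ)) - 1 := by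
        rw [← Matrix.diagonal_one, Matrix.diagonal_sub]
        simp
      rw [h2, mul_sub, sub_mul, ← hTQ, mul_one, hQ2]
    rw [h1, hφ.norm2_mul_unitary (Unitary.star_mem hQ), norm2_unitary_mul hQ]
  rw [e1, e2, ← one_mul (norm2 _ (Matrix.diagonal (fun a => ((l a - 1 : ℝ) : ℂ))))]
  refine norm2_diagonal_mono zero_le_one fun a => ?_
  rw [Complex.norm_real, Complex.norm_real, one_mul, Real.norm_eq_abs, Real.norm_eq_abs]
  have h1 : l a - 1 = (√(l a) - 1) * (√(l a) + 1) := by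
    have := Real.mul_self_sqrt (hl0 a)
    linear_combination -this
  rw [h1, abs_mul]
  refine le_mul_of_one_le_right (abs_nonneg _) ?_
  have := Real.sqrt_nonneg (l a)
  rw [abs_of_nonneg (by linarith)]
  linarith

/-- The eigenvalues of a Hermitian matrix, rounded to `0` or `1` by a cut-off at `1 / 2`. -/
noncomputable def spectralCutoff {N : ℕ} {A : Matrix (Fin N) (Fin N) ℂ} (hA : A.IsHermitian)
    (i : Fin N) : ℝ := if 1 / 2 ≤ hA.eigenvalues i then 1 else 0

/-- Nearly idempotent Hermitian matrices with nearly equal traces are nearly unitarily conjugate: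
the unitary matches the eigenvectors, ordered by decreasing eigenvalue. -/
theorem exists_unitary_intertwiner {N : ℕ} (hN : N ≠ 0) {h k : Matrix (Fin N) (Fin N) ℂ}
    (hh : IsSelfAdjoint h) (hk : IsSelfAdjoint k) :
    ∃ Z ∈ unitary (Matrix (Fin N) (Fin N) ℂ), norm2 (ntrState N) (h * Z - Z * k) ≤
      2 * norm2 (ntrState N) (h * h - h) + 2 * norm2 (ntrState N) (k * k - k) +
      √(‖ntrState N h - ntrState N k‖ + 2 * norm2 (ntrState N) (h * h - h) +
        2 * norm2 (ntrState N) (k * k - k)) := by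
  have hφ := isTracialState_ntrState hN
  have hh' : h.IsHermitian := hh
  have hk' : k.IsHermitian := hk
  have key : ∀ {A : Matrix (Fin N) (Fin N) ℂ} (hA : A.IsHermitian),
      ∃ Q ∈ unitary (Matrix (Fin N) (Fin N) ℂ),
        A = Q * Matrix.diagonal (fun i => (hA.eigenvalues i : ℂ)) * star Q ∧
        norm2 (ntrState N) (Matrix.diagonal (fun i => (hA.eigenvalues i : ℂ)) -
          Matrix.diagonal (fun i => (spectralCutoff hA i : ℂ))) ≤ 2 * norm2 (ntrState N) (A * A - A) ∧
        ‖ntrState N A - ntrState N (Matrix.diagonal (fun i => (spectralCutoff hA i : ℂ)))‖ ≤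
          2 * norm2 (ntrState N) (A * A - A) := by
    intro A hA
    obtain ⟨Q, hQ, hAQ⟩ := exists_unitary_diagonal hA
    have hQ1 : star Q * Q = 1 := Unitary.star_mul_self_of_mem hQ
    have e1 : norm2 (ntrState N) (A * A - A) = norm2 (ntrState N)
        (Matrix.diagonal (fun i => ((hA.eigenvalues i ^ 2 - hA.eigenvalues i : ℝ) : ℂ))) := by
      have h1 : A * A - A = Q * Matrix.diagonal
          (fun i => ((hA.eigenvalues i ^ 2 - hA.eigenvalues i : ℝ) : ℂ)) * star Q := by
        have h2 : Matrix.diagonal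
            (fun i => ((hA.eigenvalues i ^ 2 - hA.eigenvalues i : ℝ) : ℂ)) =
            Matrix.diagonal (fun i => (hA.eigenvalues i : ℂ)) *
              Matrix.diagonal (fun i => (hA.eigenvalues i : ℂ)) -
            Matrix.diagonal (fun i => (hA.eigenvalues i : ℂ)) := by
          rw [Matrix.diagonal_mul_diagonal, Matrix.diagonal_sub]
          congr 1
          ext i
          push_cast
          ring
        rw [h2, mul_sub, sub_mul, ← hAQ]
        congr 1
        calc A * A = Q * Matrix.diagonal (fun i => (hA.eigenvalues i : ℂ)) * (star Q * Q) *
              Matrix.diagonal (fun i => (hA.eigenvalues i : ℂ)) * star Q := by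
              conv_lhs => rw [hAQ]
              noncomm_ring
          _ = _ := by rw [hQ1]; noncomm_ring
      rw [h1, hφ.norm2_mul_unitary (Unitary.star_mem hQ), norm2_unitary_mul hQ]
    have e2 : norm2 (ntrState N) (Matrix.diagonal (fun i => (hA.eigenvalues i : ℂ)) -
          Matrix.diagonal (fun i => (spectralCutoff hA i : ℂ))) ≤ 2 * norm2 (ntrState N) (A * A - A) := by
      rw [e1, Matrix.diagonal_sub]
      refine norm2_diagonal_mono zero_le_two fun i => ?_
      rw [← Complex.ofReal_sub, Complex.norm_real, Complex.norm_real, Real.norm_eq_abs,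
        Real.norm_eq_abs]
      set s := hA.eigenvalues i
      simp only [spectralCutoff]
      have h1 : s ^ 2 - s = s * (s - 1) := by ring
      rw [h1, abs_mul]
      split_ifs with hs
      · have : 1 / 2 ≤ |s| := hs.trans (le_abs_self _)
        nlinarith [abs_nonneg (s - 1)]
      · have : 1 / 2 ≤ |s - 1| := by
          rw [abs_sub_comm]
          exact le_trans (by linarith) (le_abs_self _)
        rw [sub_zero]
        nlinarith [abs_nonneg s]
    refine ⟨Q, hQ, hAQ, e2, ?_⟩
    have e3 : ntrState N A = ntrState N (Matrix.diagonal (fun i => (hA.eigenvalues i : ℂ))) := by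
      conv_lhs => rw [hAQ, hφ.trace, ← mul_assoc, hQ1, one_mul]
    rw [e3, ← map_sub]
    exact (hφ.norm_map_le _).trans e2
  obtain ⟨Q, hQ, hhQ, h1, h2⟩ := key hh'
  obtain ⟨R, hR, hkR, h3, h4⟩ := key hk'
  have hQ1 : star Q * Q = 1 := Unitary.star_mul_self_of_mem hQ
  have hR1 : star R * R = 1 := Unitary.star_mul_self_of_mem hR
  -- The cut-offs are indicator functions of initial segments, hence comparable.
  have hcomp : (∀ i, spectralCutoff hh' i ≤ spectralCutoff hk' i) ∨ (∀ i, spectralCutoff hk' i ≤ spectralCutoff hh' i) := by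
    by_contra hcon
    push Not at hcon
    obtain ⟨⟨i, hi⟩, ⟨j, hj⟩⟩ := hcon
    simp only [spectralCutoff] at hi hj
    have hi1 : 1 / 2 ≤ hh'.eigenvalues i ∧ ¬ 1 / 2 ≤ hk'.eigenvalues i := by
      split_ifs at hi with ha hb hb <;> first | exact ⟨hb, ha⟩ | (exfalso; linarith)
    have hj1 : 1 / 2 ≤ hk'.eigenvalues j ∧ ¬ 1 / 2 ≤ hh'.eigenvalues j := by
      split_ifs at hj with ha hb hb <;> first | exact ⟨hb, ha⟩ | (exfalso; linarith)
    rcases le_total ((Fintype.equivOfCardEq (Fintype.card_fin (Fintype.card (Fin N)))).symm i :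
      Fin (Fintype.card (Fin N)))
      ((Fintype.equivOfCardEq (Fintype.card_fin (Fintype.card (Fin N)))).symm j) with hij | hij
    · have := hk'.eigenvalues₀_antitone hij
      exact hi1.2 (hj1.1.trans this)
    · have := hh'.eigenvalues₀_antitone hij
      exact hj1.2 (hi1.1.trans this)
  have hdiff : norm2 (ntrState N) (Matrix.diagonal (fun i => (spectralCutoff hh' i : ℂ)) -
      Matrix.diagonal (fun i => (spectralCutoff hk' i : ℂ))) ^ 2 =
      ‖ntrState N (Matrix.diagonal (fun i => (spectralCutoff hh' i : ℂ))) -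
        ntrState N (Matrix.diagonal (fun i => (spectralCutoff hk' i : ℂ)))‖ := by
    rw [Matrix.diagonal_sub, norm2_diagonal_sq, ntrState_apply, ntrState_apply, ← mul_sub,
      Matrix.trace_diagonal, Matrix.trace_diagonal, ← Finset.sum_sub_distrib, norm_mul, norm_inv,
      Complex.norm_natCast]
    congr 1
    have h01 : ∀ i, ‖(spectralCutoff hh' i : ℂ) - (spectralCutoff hk' i : ℂ)‖ ^ 2 = |spectralCutoff hh' i - spectralCutoff hk' i| := by
      intro i
      rw [← Complex.ofReal_sub, Complex.norm_real, Real.norm_eq_abs]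
      simp only [spectralCutoff]
      split_ifs <;> norm_num
    simp only [h01]
    simp only [← Complex.ofReal_sub, ← Complex.ofReal_sum, Complex.norm_real, Real.norm_eq_abs]
    rcases hcomp with hc | hc
    · rw [abs_of_nonpos (Finset.sum_nonpos fun i _ => sub_nonpos.2 (hc i)), ← Finset.sum_neg_distrib]
      exact Finset.sum_congr rfl fun i _ => abs_of_nonpos (sub_nonpos.2 (hc i))
    · rw [abs_of_nonneg (Finset.sum_nonneg fun i _ => sub_nonneg.2 (hc i))]
      exact Finset.sum_congr rfl fun i _ => abs_of_nonneg (sub_nonneg.2 (hc i))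
  refine ⟨Q * star R, mul_mem hQ (Unitary.star_mem hR), ?_⟩
  have e1 : h * (Q * star R) - Q * star R * k =
      Q * (Matrix.diagonal (fun i => (hh'.eigenvalues i : ℂ)) -
        Matrix.diagonal (fun i => (hk'.eigenvalues i : ℂ))) * star R := by
    rw [mul_sub, sub_mul]
    congr 1
    · conv_lhs => rw [hhQ]
      calc _ = Q * Matrix.diagonal (fun i => (hh'.eigenvalues i : ℂ)) * (star Q * Q) * star R := by
            noncomm_ring
        _ = _ := by rw [hQ1, mul_one]
    · conv_lhs => rw [hkR]
      calc _ = Q * (star R * R) * Matrix.diagonal (fun i => (hk'.eigenvalues i : ℂ)) * star R := by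
            noncomm_ring
        _ = _ := by rw [hR1, mul_one]
  rw [e1, hφ.norm2_mul_unitary (Unitary.star_mem hR), norm2_unitary_mul hQ]
  have e2 := hφ.norm2_sub_le_add (Matrix.diagonal (fun i => (hh'.eigenvalues i : ℂ)))
    (Matrix.diagonal (fun i => (spectralCutoff hh' i : ℂ))) (Matrix.diagonal (fun i => (hk'.eigenvalues i : ℂ)))
  have e3 := hφ.norm2_sub_le_add (Matrix.diagonal (fun i => (spectralCutoff hh' i : ℂ)))
    (Matrix.diagonal (fun i => (spectralCutoff hk' i : ℂ))) (Matrix.diagonal (fun i => (hk'.eigenvalues i : ℂ)))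
  rw [norm2_sub_comm (Matrix.diagonal (fun i => (spectralCutoff hk' i : ℂ)))] at e3
  have e4 : norm2 (ntrState N) (Matrix.diagonal (fun i => (spectralCutoff hh' i : ℂ)) -
      Matrix.diagonal (fun i => (spectralCutoff hk' i : ℂ))) ≤
      √(‖ntrState N h - ntrState N k‖ + 2 * norm2 (ntrState N) (h * h - h) +
        2 * norm2 (ntrState N) (k * k - k)) := by
    refine Real.le_sqrt_of_sq_le ?_
    rw [hdiff]
    have e5 := norm_sub_le_norm_sub_add_norm_sub
      (ntrState N (Matrix.diagonal (fun i => (spectralCutoff hh' i : ℂ)))) (ntrState N h)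
      (ntrState N (Matrix.diagonal (fun i => (spectralCutoff hk' i : ℂ))))
    have e6 := norm_sub_le_norm_sub_add_norm_sub (ntrState N h) (ntrState N k)
      (ntrState N (Matrix.diagonal (fun i => (spectralCutoff hk' i : ℂ))))
    rw [norm_sub_rev (ntrState N (Matrix.diagonal (fun i => (spectralCutoff hh' i : ℂ)))) (ntrState N h)] at e5
    linarith
  linarith

end MatrixNorm

/-! ### Asymptotic equality in the 2-norm -/

section ApproxEq

open scoped Matrix.Norms.L2Operator

variable {J : Type*} {l : Filter J} {𝒜 : J → Type*} [∀ j, CStarAlgebra (𝒜 j)]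
  {φ : ∀ j, 𝒜 j →ₗ[ℂ] ℂ}

/-- Asymptotic equality along `l`, in the 2-norms, of families of elements of tracial C*-algebras. -/
def ApproxEq (l : Filter J) (φ : ∀ j, 𝒜 j →ₗ[ℂ] ℂ) (x y : ∀ j, 𝒜 j) : Prop :=
  Tendsto (fun j => norm2 (φ j) (x j - y j)) l (𝓝 0)

/-- A family of elements that is bounded in norm. -/
def NormBounded (x : ∀ j, 𝒜 j) : Prop := ∃ C, ∀ j, ‖x j‖ ≤ C

theorem NormBounded.mul {x y : ∀ j, 𝒜 j} (hx : NormBounded x) (hy : NormBounded y) :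
    NormBounded (x * y) := by
  obtain ⟨C, hC⟩ := hx
  obtain ⟨D, hD⟩ := hy
  exact ⟨C * D, fun j => (norm_mul_le _ _).trans
    (mul_le_mul (hC j) (hD j) (norm_nonneg _) ((norm_nonneg _).trans (hC j)))⟩

theorem NormBounded.star {x : ∀ j, 𝒜 j} (hx : NormBounded x) : NormBounded (star x) := by
  obtain ⟨C, hC⟩ := hx
  exact ⟨C, fun j => by rw [Pi.star_apply, norm_star]; exact hC j⟩

theorem normBounded_of_unitary {x : ∀ j, 𝒜 j} (hx : ∀ j, x j ∈ unitary (𝒜 j)) :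
    NormBounded x := by
  refine ⟨1, fun j => ?_⟩
  have h := CStarRing.norm_star_mul_self (x := x j)
  rw [Unitary.star_mul_self_of_mem (hx j)] at h
  have := norm_one_le_one (𝒜 := 𝒜 j)
  nlinarith [norm_nonneg (x j)]

theorem ApproxEq.refl (x : ∀ j, 𝒜 j) : ApproxEq l φ x x := by
  simp only [ApproxEq, sub_self, norm2_zero]
  exact tendsto_const_nhds

theorem ApproxEq.of_eq {x y : ∀ j, 𝒜 j} (h : x = y) : ApproxEq l φ x y := h ▸ ApproxEq.refl x

theorem ApproxEq.symm {x y : ∀ j, 𝒜 j} (h : ApproxEq l φ x y) : ApproxEq l φ y x := by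
  simpa only [ApproxEq, norm2_sub_comm] using h

theorem ApproxEq.of_le {x y : ∀ j, 𝒜 j} {f : J → ℝ} (hf : Tendsto f l (𝓝 0))
    (h : ∀ j, norm2 (φ j) (x j - y j) ≤ f j) : ApproxEq l φ x y :=
  squeeze_zero (fun _ => norm2_nonneg _) h hf

theorem ApproxEq.smul {x y : ∀ j, 𝒜 j} (a : ℂ) (h : ApproxEq l φ x y) : ApproxEq l φ (a • x) (a • y) := by
  have := Tendsto.const_mul ‖a‖ h
  rw [mul_zero] at this
  refine .of_le this fun j => ?_
  rw [Pi.smul_apply, Pi.smul_apply, ← smul_sub, norm2_smul]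

section

variable (hφ : ∀ j, IsTracialState (φ j)) {x y z x' y' : ∀ j, 𝒜 j}
include hφ

theorem ApproxEq.trans (h : ApproxEq l φ x y) (h' : ApproxEq l φ y z) : ApproxEq l φ x z := by
  have := Tendsto.add h h'
  rw [add_zero] at this
  exact .of_le this fun j => (hφ j).norm2_sub_le_add _ _ _

theorem ApproxEq.add (h : ApproxEq l φ x y) (h' : ApproxEq l φ x' y') :
    ApproxEq l φ (x + x') (y + y') := by
  have := Tendsto.add h h'
  rw [add_zero] at this
  refine .of_le this fun j => ?_
  rw [Pi.add_apply, Pi.add_apply, add_sub_add_comm]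
  exact (hφ j).norm2_add_le _ _

theorem ApproxEq.sum {ι : Type*} (s : Finset ι) {x y : ι → ∀ j, 𝒜 j}
    (h : ∀ i ∈ s, ApproxEq l φ (x i) (y i)) : ApproxEq l φ (∑ i ∈ s, x i) (∑ i ∈ s, y i) := by
  classical
  induction s using Finset.induction_on with
  | empty => exact .refl _
  | insert a s ha ih =>
    rw [Finset.sum_insert ha, Finset.sum_insert ha]
    exact (h a (Finset.mem_insert_self _ _)).add hφ
      (ih fun i hi => h i (Finset.mem_insert_of_mem hi))

theorem ApproxEq.mul_left (hz : NormBounded z) (h : ApproxEq l φ x y) :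
    ApproxEq l φ (z * x) (z * y) := by
  obtain ⟨C, hC⟩ := hz
  have := Tendsto.const_mul C h
  rw [mul_zero] at this
  refine .of_le this fun j => ?_
  rw [Pi.mul_apply, Pi.mul_apply, ← mul_sub]
  exact ((hφ j).norm2_mul_le _ _).trans (mul_le_mul_of_nonneg_right (hC j) (norm2_nonneg _))

theorem ApproxEq.star (h : ApproxEq l φ x y) : ApproxEq l φ (star x) (star y) := by
  refine .of_le h fun j => ?_
  rw [Pi.star_apply, Pi.star_apply, ← star_sub, (hφ j).norm2_star]

theorem ApproxEq.mul_right (hz : NormBounded z) (h : ApproxEq l φ x y) :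
    ApproxEq l φ (x * z) (y * z) := by
  have := ((h.star hφ).mul_left hφ hz.star).star hφ
  simpa using this

theorem ApproxEq.mul (hx : NormBounded x) (hy' : NormBounded y') (h : ApproxEq l φ x y)
    (h' : ApproxEq l φ x' y') : ApproxEq l φ (x * x') (y * y') :=
  (h'.mul_left hφ hx).trans hφ (h.mul_right hφ hy')

end

/-- Families that satisfy the relations of a matrix unit frame asymptotically. -/
structure IsApproxFrame {ι : Type*} [Fintype ι] (l : Filter J) (φ : ∀ j, 𝒜 j →ₗ[ℂ] ℂ) (c : ι → ι)
    (u : ι → ∀ j, 𝒜 j) : Prop where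
  bounded : ∀ i, NormBounded (u i)
  orthogonal : ∀ i j, i ≠ j → ApproxEq l φ (star (u i) * u j) 0
  initial : ∀ i, ApproxEq l φ (star (u i) * u i) (star (u (c i)) * u (c i))
  partial_isometry : ∀ i, ApproxEq l φ (u i * star (u i) * u i) (u i)
  sum_final : ApproxEq l φ (∑ i, u i * star (u i)) 1

theorem IsMatrixUnitFrame.isApproxFrame {ι : Type*} [Fintype ι] (hφ : ∀ j, IsTracialState (φ j))
    {c : ι → ι} {u₀ u : ι → ∀ j, 𝒜 j} (h : IsMatrixUnitFrame c u₀) (hu₀ : ∀ i, NormBounded (u₀ i))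
    (hu : ∀ i, NormBounded (u i)) (huu : ∀ i, ApproxEq l φ (u i) (u₀ i)) :
    IsApproxFrame l φ c u where
  bounded := hu
  orthogonal i j hij := by
    rw [← h.orthogonal i j hij]
    exact ((huu i).star hφ).mul hφ (hu i).star (hu₀ j) (huu j)
  initial i := by
    have := fun i => ((huu i).star hφ).mul hφ (hu i).star (hu₀ i) (huu i)
    exact (this i).trans hφ ((h.initial i) ▸ (this (c i)).symm)
  partial_isometry i := by
    refine ApproxEq.trans hφ ?_ (huu i).symm
    have h1 := ((huu i).mul hφ (hu i) (hu₀ i).star ((huu i).star hφ)).mul hφ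
      ((hu i).mul (hu i).star) (hu₀ i) (huu i)
    rwa [h.partial_isometry] at h1
  sum_final := by
    rw [← h.sum_final]
    exact ApproxEq.sum hφ _ fun i _ => (huu i).mul hφ (hu i) (hu₀ i).star ((huu i).star hφ)

/-- Two asymptotic frames of matrices with asymptotically equal traces are asymptotically unitarily
equivalent. The unitary is the polar part of `∑ uᵢ Z_{c i} vᵢ*`, where the unitary `Z s` carries
the initial projection of `v s` to that of `u s`. -/
theorem IsApproxFrame.exists_unitary {J : Type*} {l : Filter J} {N : J → ℕ} (hN : ∀ j, N j ≠ 0)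
    {ι : Type*} [Fintype ι] {c : ι → ι} {u v : ι → ∀ j, Matrix (Fin (N j)) (Fin (N j)) ℂ}
    (hu : IsApproxFrame l (fun j => ntrState (N j)) c u)
    (hv : IsApproxFrame l (fun j => ntrState (N j)) c v)
    (htr : ∀ i, Tendsto (fun j => ‖ntrState (N j) (star (u i j) * u i j) -
      ntrState (N j) (star (v i j) * v i j)‖) l (𝓝 0)) :
    ∃ W : ∀ j, Matrix (Fin (N j)) (Fin (N j)) ℂ, (∀ j, W j ∈ unitary _) ∧
      ∀ i k, c i = c k → ApproxEq l (fun j => ntrState (N j))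
        (u i * star (u k) * W) (W * (v i * star (v k))) := by
  classical
  set φ : ∀ j, Matrix (Fin (N j)) (Fin (N j)) ℂ →ₗ[ℂ] ℂ := fun j => ntrState (N j) with hφdef
  have hφ : ∀ j, IsTracialState (φ j) := fun j => isTracialState_ntrState (hN j)
  have hidem : ∀ {u : ι → ∀ j, Matrix (Fin (N j)) (Fin (N j)) ℂ}, IsApproxFrame l φ c u →
      ∀ i, ApproxEq l φ (star (u i) * u i * (star (u i) * u i)) (star (u i) * u i) := by
    intro u hu i
    have := (hu.partial_isometry i).mul_left hφ (hu.bounded i).star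
    simpa only [mul_assoc] using this
  choose Z hZ hZle using fun i j => exists_unitary_intertwiner (hN j)
    (IsSelfAdjoint.star_mul_self (u i j)) (IsSelfAdjoint.star_mul_self (v i j))
  have hZb : ∀ i, NormBounded (Z i) := fun i => normBounded_of_unitary (hZ i)
  have hZ1 : ∀ i, star (Z i) * Z i = 1 := fun i => funext fun j =>
    Unitary.star_mul_self_of_mem (hZ i j)
  have hZa : ∀ i, ApproxEq l φ (star (u i) * u i * Z i) (Z i * (star (v i) * v i)) := by
    intro i
    have h1 := (hidem hu i).const_mul 2
    have h2 := (hidem hv i).const_mul 2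
    have h3 := (h1.add h2).add ((((htr i).add h1).add h2).sqrt)
    simp only [mul_zero, add_zero, Real.sqrt_zero] at h3
    exact .of_le h3 fun j => hZle i j
  set T : ∀ j, Matrix (Fin (N j)) (Fin (N j)) ℂ := ∑ i, u i * Z (c i) * star (v i) with hT
  -- `T` is asymptotically isometric.
  have hTT : ApproxEq l φ (star T * T) 1 := by
    have e1 : star T * T = ∑ i, ∑ k, v i * star (Z (c i)) * (star (u i) * u k) *
        (Z (c k) * star (v k)) := by
      rw [hT, star_sum, Finset.sum_mul_sum]
      refine Finset.sum_congr rfl fun i _ => Finset.sum_congr rfl fun k _ => ?_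
      simp only [star_mul, star_star, mul_assoc]
    have e2 : ApproxEq l φ (star T * T) (∑ i, ∑ k, if i = k then v i * star (v i) else 0) := by
      rw [e1]
      refine ApproxEq.sum hφ _ fun i _ => ApproxEq.sum hφ _ fun k _ => ?_
      split_ifs with hik
      · subst hik
        have bZ := (hZb (c i)).mul (hv.bounded i).star
        have bZ' := (hv.bounded i).mul (hZb (c i)).star
        have a1 := ((hu.initial i).mul_left hφ bZ').mul_right hφ bZ
        have a2 := ((hZa (c i)).mul_left hφ bZ').mul_right hφ (hv.bounded i).star
        have a3 := ((hv.initial i).symm.mul_left hφ (hv.bounded i)).mul_right hφ (hv.bounded i).star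
        have a4 := (hv.partial_isometry i).mul_right hφ (hv.bounded i).star
        refine a1.trans hφ (ApproxEq.trans hφ (.of_eq ?_) (a2.trans hφ (ApproxEq.trans hφ (.of_eq ?_)
          (a3.trans hφ (ApproxEq.trans hφ (.of_eq ?_) a4)))))
        · simp only [mul_assoc]
        · calc _ = v i * (star (Z (c i)) * Z (c i)) * (star (v (c i)) * v (c i)) * star (v i) := by
                simp only [mul_assoc]
            _ = _ := by rw [hZ1, mul_one]
        · simp only [mul_assoc]
      · have a1 := ((hu.orthogonal i k hik).mul_left hφ
          ((hv.bounded i).mul (hZb (c i)).star)).mul_right hφ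
          ((hZb (c k)).mul (hv.bounded k).star)
        simpa only [mul_zero, zero_mul] using a1
    refine e2.trans hφ ?_
    simpa using hv.sum_final
  choose W hW hWle using fun j => exists_unitary_norm2_sub_le (hN j) (T j)
  have hTW : ApproxEq l φ T W := .of_le hTT fun j => hWle j
  refine ⟨W, hW, fun i k hik => ?_⟩
  have left : ApproxEq l φ (u i * star (u k) * T) (u i * Z (c i) * star (v k)) := by
    have e1 : u i * star (u k) * T = ∑ a, u i * (star (u k) * u a) * (Z (c a) * star (v a)) := by
      rw [hT, Finset.mul_sum]
      simp only [mul_assoc]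
    have e2 : ApproxEq l φ (u i * star (u k) * T)
        (∑ a, if a = k then u i * Z (c i) * star (v k) else 0) := by
      rw [e1]
      refine ApproxEq.sum hφ _ fun a _ => ?_
      split_ifs with hak
      · subst hak
        rw [← hik]
        have b := (hZb (c i)).mul (hv.bounded a).star
        have a1 := ((hu.initial a).mul_left hφ (hu.bounded i)).mul_right hφ b
        have a2 := ((hu.initial i).symm.mul_left hφ (hu.bounded i)).mul_right hφ b
        have a3 := (hu.partial_isometry i).mul_right hφ b
        rw [← hik] at a1
        refine a1.trans hφ (a2.trans hφ (ApproxEq.trans hφ (.of_eq ?_) (a3.trans hφ (.of_eq ?_))))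
        · simp only [mul_assoc]
        · simp only [mul_assoc]
      · have a1 := ((hu.orthogonal k a (Ne.symm hak)).mul_left hφ (hu.bounded i)).mul_right hφ
          ((hZb (c a)).mul (hv.bounded a).star)
        simpa only [mul_zero, zero_mul] using a1
    simpa using e2
  have right : ApproxEq l φ (T * (v i * star (v k))) (u i * Z (c i) * star (v k)) := by
    have e1 : T * (v i * star (v k)) = ∑ a, u a * Z (c a) * (star (v a) * v i) * star (v k) := by
      rw [hT, Finset.sum_mul]
      simp only [mul_assoc]
    have e2 : ApproxEq l φ (T * (v i * star (v k)))
        (∑ a, if a = i then u i * Z (c i) * star (v k) else 0) := by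
      rw [e1]
      refine ApproxEq.sum hφ _ fun a _ => ?_
      split_ifs with hai
      · subst hai
        have b := (hu.bounded a).mul (hZb (c a))
        have a1 := ((hv.initial a).mul_left hφ b).mul_right hφ (hv.bounded k).star
        have a2 := ((hv.initial k).symm.mul_left hφ b).mul_right hφ (hv.bounded k).star
        have a3 := ((hv.partial_isometry k).star hφ).mul_left hφ b
        rw [← hik] at a2
        refine a1.trans hφ (a2.trans hφ (ApproxEq.trans hφ (.of_eq ?_) a3))
        simp only [star_mul, star_star, mul_assoc]
      · have a1 := ((hv.orthogonal a i hai).mul_left hφ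
          ((hu.bounded a).mul (hZb (c a)))).mul_right hφ (hv.bounded k).star
        simpa only [mul_zero, zero_mul] using a1
    simpa using e2
  have h1 := hTW.symm.mul_left hφ ((hu.bounded i).mul (hu.bounded k).star)
  have h2 := hTW.mul_right hφ ((hv.bounded i).mul (hv.bounded k).star)
  exact h1.trans hφ (left.trans hφ (right.symm.trans hφ h2))

end ApproxEq

/-! ### Microstates of a hyperfinite tuple are asymptotically unitarily equivalent -/

section UnitaryEquivalence

open scoped Matrix.Norms.L2Operator

/-- The relations of a matrix unit frame hold up to `η` in 2-norm. -/
structure IsFrameUpTo {ι 𝒜 : Type*} [Fintype ι] [CStarAlgebra 𝒜] (η : ℝ) (φ : 𝒜 →ₗ[ℂ] ℂ)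
    (c : ι → ι) (u : ι → 𝒜) : Prop where
  orthogonal : ∀ i j, i ≠ j → norm2 φ (star (u i) * u j) < η
  initial : ∀ i, norm2 φ (star (u i) * u i - star (u (c i)) * u (c i)) < η
  partial_isometry : ∀ i, norm2 φ (u i * star (u i) * u i - u i) < η
  sum_final : norm2 φ (∑ i, u i * star (u i) - 1) < η

theorem IsApproxFrame.eventually_isFrameUpTo {J : Type*} {l : Filter J} {𝒜 : J → Type*}
    [∀ j, CStarAlgebra (𝒜 j)] {φ : ∀ j, 𝒜 j →ₗ[ℂ] ℂ} {ι : Type*} [Fintype ι] {c : ι → ι}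
    {u : ι → ∀ j, 𝒜 j} (h : IsApproxFrame l φ c u) {η : ℝ} (hη : 0 < η) :
    ∀ᶠ j in l, IsFrameUpTo η (φ j) c fun i => u i j := by
  have h1 : ∀ᶠ j in l, ∀ i k, i ≠ k → norm2 (φ j) (star (u i j) * u k j) < η := by
    simp only [eventually_all]
    intro i k hik
    have := (h.orthogonal i k hik).eventually (gt_mem_nhds hη)
    simpa using this
  have h2 := eventually_all.2 fun i => (h.initial i).eventually (gt_mem_nhds hη)
  have h3 := eventually_all.2 fun i => (h.partial_isometry i).eventually (gt_mem_nhds hη)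
  have h4 := h.sum_final.eventually (gt_mem_nhds hη)
  filter_upwards [h1, h2, h3, h4] with j h1 h2 h3 h4
  refine ⟨h1, h2, h3, ?_⟩
  simpa using h4

theorem isApproxFrame_of_isFrameUpTo {J : Type*} {l : Filter J} {𝒜 : J → Type*}
    [∀ j, CStarAlgebra (𝒜 j)] {φ : ∀ j, 𝒜 j →ₗ[ℂ] ℂ} {ι : Type*} [Fintype ι] {c : ι → ι}
    {u : ι → ∀ j, 𝒜 j} {η : J → ℝ} (hη : Tendsto η l (𝓝 0)) (hu : ∀ i, NormBounded (u i))
    (h : ∀ j, IsFrameUpTo (η j) (φ j) c fun i => u i j) : IsApproxFrame l φ c u where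
  bounded := hu
  orthogonal i k hik := .of_le hη fun j => by simpa using ((h j).orthogonal i k hik).le
  initial i := .of_le hη fun j => ((h j).initial i).le
  partial_isometry i := .of_le hη fun j => ((h j).partial_isometry i).le
  sum_final := .of_le hη fun j => by simpa using (h j).sum_final.le

theorem exists_unitary_of_isFrameUpTo {ι : Type*} [Fintype ι] (c : ι → ι) (K : ℝ) {ε : ℝ}
    (hε : 0 < ε) : ∃ η > 0, ∀ (N : ℕ) (u v : ι → Matrix (Fin N) (Fin N) ℂ), N ≠ 0 →
      (∀ i, ‖u i‖ ≤ K) → (∀ i, ‖v i‖ ≤ K) →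
      IsFrameUpTo η (ntrState N) c u → IsFrameUpTo η (ntrState N) c v →
      (∀ i, ‖ntrState N (star (u i) * u i) - ntrState N (star (v i) * v i)‖ < η) →
      ∃ W ∈ unitary (Matrix (Fin N) (Fin N) ℂ), ∀ i k, c i = c k →
        norm2 (ntrState N) (u i * star (u k) * W - W * (v i * star (v k))) < ε := by
  -- The index type consists of all admissible configurations, with `η → 0`.
  set good : (ℝ × Σ N : ℕ, (ι → Matrix (Fin N) (Fin N) ℂ) × (ι → Matrix (Fin N) (Fin N) ℂ)) →
      Prop := fun d => d.2.1 ≠ 0 ∧ (∀ i, ‖d.2.2.1 i‖ ≤ K) ∧ (∀ i, ‖d.2.2.2 i‖ ≤ K) ∧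
      IsFrameUpTo d.1 (ntrState d.2.1) c d.2.2.1 ∧ IsFrameUpTo d.1 (ntrState d.2.1) c d.2.2.2 ∧
      ∀ i, ‖ntrState d.2.1 (star (d.2.2.1 i) * d.2.2.1 i) -
        ntrState d.2.1 (star (d.2.2.2 i) * d.2.2.2 i)‖ < d.1 with hgood
  set l : Filter (Subtype good) := comap (fun d => d.1.1) (𝓝[>] 0) with hl
  have hη : Tendsto (fun d : Subtype good => d.1.1) l (𝓝 0) :=
    tendsto_comap.mono_right nhdsWithin_le_nhds
  have hu := isApproxFrame_of_isFrameUpTo (u := fun i (d : Subtype good) => d.1.2.2.1 i) hη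
    (fun i => ⟨K, fun d => d.2.2.1 i⟩) fun d => d.2.2.2.2.1
  have hv := isApproxFrame_of_isFrameUpTo (u := fun i (d : Subtype good) => d.1.2.2.2 i) hη
    (fun i => ⟨K, fun d => d.2.2.2.1 i⟩) fun d => d.2.2.2.2.2.1
  obtain ⟨W, hW, hWuv⟩ := hu.exists_unitary (fun d => d.2.1) hv fun i =>
    squeeze_zero (fun _ => norm_nonneg _) (fun d => (d.2.2.2.2.2.2 i).le) hη
  have h1 : ∀ᶠ d in l, ∀ i k, c i = c k → norm2 (ntrState d.1.2.1)
      (d.1.2.2.1 i * star (d.1.2.2.1 k) * W d - W d * (d.1.2.2.2 i * star (d.1.2.2.2 k))) < ε := by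
    simp only [eventually_all]
    exact fun i k hik => (hWuv i k hik).eventually (gt_mem_nhds hε)
  rw [hl, eventually_comap] at h1
  obtain ⟨η, h2, h3⟩ := (h1.and self_mem_nhdsWithin).exists
  exact ⟨η, h3, fun N u v hN hu hv hu' hv' htr => ⟨_, hW ⟨(η, ⟨N, (u, v)⟩),
    hN, hu, hv, hu', hv', htr⟩, h2 ⟨(η, ⟨N, (u, v)⟩), hN, hu, hv, hu', hv', htr⟩ rfl⟩⟩

/-- A frame in the 2-norm closure of the polynomials is approximated by bounded polynomials. -/
theorem IsMatrixUnitFrame.exists_polynomials {κ 𝒜 : Type*} [CStarAlgebra 𝒜] {φ : 𝒜 →ₗ[ℂ] ℂ}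
    {X : κ → 𝒜} (hφ : IsTracialState φ) (hX : ∀ k, IsSelfAdjoint (X k)) {b : ℝ}
    (hXb : ∀ k, ‖X k‖ ≤ b) {ι : Type*} [Fintype ι] {c : ι → ι} {u : ι → 𝒜}
    (h : IsMatrixUnitFrame c u)
    (hu : ∀ i, ∀ η : ℝ, 0 < η → ∃ P, norm2 φ (FreeAlgebra.lift ℂ X P - u i) < η)
    {η : ℝ} (hη : 0 < η) {ν : Type*} [Finite ν] (Y : ν → Matrix ι ι ℂ) :
    ∃ R : ι → FreeAlgebra ℂ κ, (∀ i, UniformlyBounded b (R i)) ∧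
      IsFrameUpTo η φ c (fun i => FreeAlgebra.lift ℂ X (R i)) ∧
      ∀ k, norm2 φ (frameSum u (Y k) - frameSum (fun i => FreeAlgebra.lift ℂ X (R i)) (Y k)) < η := by
  have h1 : ∀ (n : ℕ) i, ∃ R, UniformlyBounded b R ∧
      norm2 φ (FreeAlgebra.lift ℂ X R - u i) < 1 / ((n : ℝ) + 1) := by
    intro n i
    have := hφ.exists_uniformlyBounded hX hXb (hu i) (ε := 1 / ((n : ℝ) + 1)) (by positivity)
    rwa [bddTransform_of_partialIsometry (h.partial_isometry i)] at this
  choose R hR hRu using h1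
  set v : ι → ℕ → 𝒜 := fun i n => FreeAlgebra.lift ℂ X (R n i) with hv
  set u₀ : ι → ℕ → 𝒜 := fun i _ => u i with hu₀
  have hφ' : ∀ _ : ℕ, IsTracialState φ := fun _ => hφ
  have hvu : ∀ i, ApproxEq atTop (fun _ => φ) (v i) (u₀ i) := fun i =>
    .of_le tendsto_one_div_add_atTop_nhds_zero_nat fun n => (hRu n i).le
  have hvb : ∀ i, NormBounded (v i) := fun i => ⟨4, fun n => (hR n i).norm_lift_le hX hXb⟩
  have hub : ∀ i, NormBounded (u₀ i) := fun i => ⟨‖u i‖, fun _ => le_rfl⟩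
  have hframe : IsMatrixUnitFrame c u₀ := ⟨fun i j hij => funext fun _ => h.orthogonal i j hij,
    fun i => funext fun _ => h.initial i, fun i => funext fun _ => h.partial_isometry i,
    by
      funext n
      simpa [hu₀] using h.sum_final⟩
  have e1 := (hframe.isApproxFrame hφ' hub hvb hvu).eventually_isFrameUpTo hη
  have e2 : ∀ᶠ n in atTop, ∀ k, norm2 φ (frameSum u (Y k) - frameSum (fun i => v i n) (Y k)) < η := by
    refine eventually_all.2 fun k => ?_
    have h2 : ApproxEq atTop (fun _ => φ) (frameSum u₀ (Y k)) (frameSum v (Y k)) :=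
      ApproxEq.sum hφ' _ fun i _ => ApproxEq.sum hφ' _ fun j _ => ApproxEq.smul _
        ((hvu i).symm.mul hφ' (hub i) (hvb j).star ((hvu j).symm.star hφ'))
    have h3 := h2.eventually (gt_mem_nhds hη)
    simpa [frameSum] using h3
  obtain ⟨n, h2, h3⟩ := (e1.and e2).exists
  exact ⟨R n, hR n, h2, h3⟩

/-- Polynomial tuples that form a frame up to `η` in the limit do so in all good microstates. -/
theorem eventually_isFrameUpTo {κ 𝒜 : Type*} [CStarAlgebra 𝒜] {φ : 𝒜 →ₗ[ℂ] ℂ}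
    {X : κ → 𝒜} (hφ : IsTracialState φ) (hX : ∀ k, IsSelfAdjoint (X k)) {ι : Type*} [Fintype ι]
    {c : ι → ι} {R : ι → FreeAlgebra ℂ κ} {η : ℝ}
    (h : IsFrameUpTo η φ c fun i => FreeAlgebra.lift ℂ X (R i)) :
    ∀ᶠ p in lawFilter, ∀ {ℬ : Type*} [CStarAlgebra ℬ] {ψ : ℬ →ₗ[ℂ] ℂ} {A : κ → ℬ},
      IsTracialState ψ → (∀ k, IsSelfAdjoint (A k)) → MomentClose φ X ψ A p.1 p.2 →
      IsFrameUpTo η ψ c fun i => FreeAlgebra.lift ℂ A (R i) := by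
  choose Q K hQ using fun i => AdjointBound.exists 0 (R i)
  have h1 : ∀ i j, i ≠ j → _ := fun i j hij => eventually_norm2_lift_lt hφ hX (Q i * R j) (η := η)
    (by simpa [(hQ i).lift_eq_star hX] using h.orthogonal i j hij)
  have h2 : ∀ i, _ := fun i => eventually_norm2_lift_lt hφ hX
    (Q i * R i - Q (c i) * R (c i)) (η := η)
    (by simpa [(hQ _).lift_eq_star hX] using h.initial i)
  have h3 : ∀ i, _ := fun i => eventually_norm2_lift_lt hφ hX (R i * Q i * R i - R i) (η := η)
    (by simpa [(hQ _).lift_eq_star hX] using h.partial_isometry i)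
  have h4 := eventually_norm2_lift_lt hφ hX (∑ i, R i * Q i - 1) (η := η)
    (by simpa [(hQ _).lift_eq_star hX] using h.sum_final)
  filter_upwards [eventually_all.2 fun i => eventually_all.2 fun j => eventually_all.2 (h1 i j),
    eventually_all.2 h2, eventually_all.2 h3, h4] with p h1 h2 h3 h4 ℬ _ ψ A hψ hA hc
  exact ⟨fun i j hij => by simpa [(hQ _).lift_eq_star hA] using h1 i j hij hψ hA hc,
    fun i => by simpa [(hQ _).lift_eq_star hA] using h2 i hψ hA hc,
    fun i => by simpa [(hQ _).lift_eq_star hA] using h3 i hψ hA hc,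
    by simpa [(hQ _).lift_eq_star hA] using h4 hψ hA hc⟩

theorem norm2_frameSum_intertwine_le {N : ℕ} (hN : N ≠ 0) {ι : Type*} [Fintype ι] {c : ι → ι}
    {u v : ι → Matrix (Fin N) (Fin N) ℂ} {W : Matrix (Fin N) (Fin N) ℂ} {ε : ℝ}
    (h : ∀ i k, c i = c k →
      norm2 (ntrState N) (u i * star (u k) * W - W * (v i * star (v k))) ≤ ε)
    {y : Matrix ι ι ℂ} (hy : ∀ i k, c i ≠ c k → y i k = 0) :
    norm2 (ntrState N) (frameSum u y * W - W * frameSum v y) ≤ (∑ i, ∑ k, ‖y i k‖) * ε := by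
  have hφ := isTracialState_ntrState hN
  have e : frameSum u y * W - W * frameSum v y =
      ∑ i, ∑ k, y i k • (u i * star (u k) * W - W * (v i * star (v k))) := by
    simp only [frameSum, Finset.sum_mul, Finset.mul_sum, ← Finset.sum_sub_distrib, smul_sub,
      smul_mul_assoc, mul_smul_comm]
  rw [e, Finset.sum_mul]
  refine (hφ.norm2_sum_le _ _).trans (Finset.sum_le_sum fun i _ => ?_)
  rw [Finset.sum_mul]
  refine (hφ.norm2_sum_le _ _).trans (Finset.sum_le_sum fun k _ => ?_)
  rw [norm2_smul]
  by_cases hik : c i = c k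
  · exact mul_le_mul_of_nonneg_left (h i k hik) (norm_nonneg _)
  · rw [hy i k hik, norm_zero, zero_mul, zero_mul]

/-- Bounded microstates of a tuple with frame approximations are unitarily conjugate up to a small
error in 2-norm. -/
theorem HasFrameApprox.eventually_exists_unitary {κ 𝒜 : Type*} [Finite κ] [CStarAlgebra 𝒜]
    {φ : 𝒜 →ₗ[ℂ] ℂ} {X : κ → 𝒜} (h : HasFrameApprox φ X) (hφ : IsTracialState φ)
    (hX : ∀ k, IsSelfAdjoint (X k)) {b : ℝ} (hXb : ∀ k, ‖X k‖ ≤ b) {ε : ℝ} (hε : 0 < ε) :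
    ∀ᶠ p in lawFilter, ∀ (N : ℕ) (A B : κ → Matrix (Fin N) (Fin N) ℂ), N ≠ 0 →
      (∀ k, IsSelfAdjoint (A k)) → (∀ k, IsSelfAdjoint (B k)) →
      (∀ k, ‖A k‖ ≤ b) → (∀ k, ‖B k‖ ≤ b) →
      MomentClose φ X (ntrState N) A p.1 p.2 → MomentClose φ X (ntrState N) B p.1 p.2 →
      ∃ W ∈ unitary (Matrix (Fin N) (Fin N) ℂ),
        ∀ k, norm2 (ntrState N) (A k * W - W * B k) < ε := by
  have : Fintype κ := Fintype.ofFinite κ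
  obtain ⟨K, hK⟩ := h
  obtain ⟨D, c, u, Y, hframe, hblock, -, -, hXY, hpoly⟩ := hK (ε / 8) (by positivity)
  set S : ℝ := ∑ k, ∑ i, ∑ j, ‖Y k i j‖ with hS
  have hS0 : 0 ≤ S := by positivity
  obtain ⟨η, hη, hW⟩ := exists_unitary_of_isFrameUpTo c 4 (ε := ε / (4 * (S + 1))) (by positivity)
  obtain ⟨R, hRb, hRf, hRY⟩ := hframe.exists_polynomials hφ hX hXb hpoly
    (η := min η (ε / 8)) (by positivity) Y
  choose Q L hQ using fun i => AdjointBound.exists 0 (R i)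
  have e1 := eventually_isFrameUpTo hφ hX hRf
  have e2 := eventually_all.2 fun i =>
    eventually_norm_lift_sub_lt φ X (Q i * R i) (ε := η / 2) (by positivity)
  have e3 := eventually_all.2 fun k => eventually_norm2_lift_lt hφ hX
    (FreeAlgebra.ι ℂ k - ∑ i, ∑ j, Y k i j • (R i * Q j)) (η := ε / 4) (by
      have h1 := hφ.norm2_sub_le_add (X k) (frameSum u (Y k))
        (frameSum (fun i => FreeAlgebra.lift ℂ X (R i)) (Y k))
      have h2 : FreeAlgebra.lift ℂ X (FreeAlgebra.ι ℂ k - ∑ i, ∑ j, Y k i j • (R i * Q j)) =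
          X k - frameSum (fun i => FreeAlgebra.lift ℂ X (R i)) (Y k) := by
        simp [frameSum, (hQ _).lift_eq_star hX]
      rw [h2]
      have h3 := hXY k
      have h4 := (hRY k).trans_le (min_le_right _ _)
      linarith)
  filter_upwards [e1, e2, e3] with p e1 e2 e3 N A B hN hA hB hAb hBb hAc hBc
  have hψ := isTracialState_ntrState hN
  have mono : ∀ {u : _ → Matrix (Fin N) (Fin N) ℂ}, IsFrameUpTo (min η (ε / 8)) (ntrState N) c u →
      IsFrameUpTo η (ntrState N) c u := fun h =>
    ⟨fun i j hij => (h.orthogonal i j hij).trans_le (min_le_left _ _),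
      fun i => (h.initial i).trans_le (min_le_left _ _),
      fun i => (h.partial_isometry i).trans_le (min_le_left _ _),
      h.sum_final.trans_le (min_le_left _ _)⟩
  obtain ⟨W, hWu, hWε⟩ := hW N (fun i => FreeAlgebra.lift ℂ A (R i))
    (fun i => FreeAlgebra.lift ℂ B (R i)) hN (fun i => (hRb i).norm_lift_le hA hAb)
    (fun i => (hRb i).norm_lift_le hB hBb) (mono (e1 hψ hA hAc)) (mono (e1 hψ hB hBc)) (by
      intro i
      have h1 := e2 i (ntrState N) A hAc
      have h2 := e2 i (ntrState N) B hBc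
      simp only [map_mul, (hQ i).lift_eq_star hA] at h1
      simp only [map_mul, (hQ i).lift_eq_star hB] at h2
      rw [norm_sub_rev] at h2
      have h3 := norm_sub_le_norm_sub_add_norm_sub
        (ntrState N (star (FreeAlgebra.lift ℂ A (R i)) * FreeAlgebra.lift ℂ A (R i)))
        (φ (FreeAlgebra.lift ℂ X (Q i) * FreeAlgebra.lift ℂ X (R i)))
        (ntrState N (star (FreeAlgebra.lift ℂ B (R i)) * FreeAlgebra.lift ℂ B (R i)))
      linarith)
  refine ⟨W, hWu, fun k => ?_⟩
  set FA := frameSum (fun i => FreeAlgebra.lift ℂ A (R i)) (Y k) with hFA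
  set FB := frameSum (fun i => FreeAlgebra.lift ℂ B (R i)) (Y k) with hFB
  have h1 : norm2 (ntrState N) (A k - FA) < ε / 4 := by
    have := e3 k hψ hA hAc
    simpa [frameSum, (hQ _).lift_eq_star hA, hFA] using this
  have h2 : norm2 (ntrState N) (B k - FB) < ε / 4 := by
    have := e3 k hψ hB hBc
    simpa [frameSum, (hQ _).lift_eq_star hB, hFB] using this
  have h3 : norm2 (ntrState N) (FA * W - W * FB) ≤ ε / 4 := by
    refine (norm2_frameSum_intertwine_le hN (fun i k hik => (hWε i k hik).le) (hblock k)).trans ?_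
    have h4 : ∑ i, ∑ j, ‖Y k i j‖ ≤ S :=
      Finset.single_le_sum (f := fun k => ∑ i, ∑ j, ‖Y k i j‖) (fun k _ => by positivity)
        (Finset.mem_univ k)
    calc _ ≤ S * (ε / (4 * (S + 1))) := mul_le_mul_of_nonneg_right h4 (by positivity)
      _ = ε / 4 * (S / (S + 1)) := by field_simp
      _ ≤ ε / 4 := mul_le_of_le_one_right (by positivity) (by
          rw [div_le_one (by positivity)]; linarith)
  have h4 : A k * W - W * B k = (A k - FA) * W + (FA * W - W * FB) - W * (B k - FB) := by
    noncomm_ring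
  rw [h4]
  have h5 := hψ.norm2_sub_le ((A k - FA) * W + (FA * W - W * FB)) (W * (B k - FB))
  have h6 := hψ.norm2_add_le ((A k - FA) * W) (FA * W - W * FB)
  rw [hψ.norm2_mul_unitary hWu] at h6
  rw [norm2_unitary_mul hWu] at h5
  linarith

end UnitaryEquivalence

/-! ### Matrix models of hyperfinite tuples -/

section Models

open scoped Matrix.Norms.L2Operator

section FrameSum

variable {ι κ R : Type*} [Fintype ι] [Ring R] [StarRing R] [Algebra ℂ R] {c : ι → ι} {u : ι → R}
  (ho : ∀ i j, i ≠ j → star (u i) * u j = 0)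
  (hi : ∀ i, star (u i) * u i = star (u (c i)) * u (c i))
  (hp : ∀ i, u i * star (u i) * u i = u i)
include ho hi hp

theorem frameSum_mul {y z : Matrix ι ι ℂ} (hy : ∀ i l, c i ≠ c l → y i l = 0) :
    frameSum u y * frameSum u z = frameSum u (y * z) := by
  classical
  have h1 : ∀ i l a b, (y i l • (u i * star (u l))) * (z a b • (u a * star (u b))) =
      if l = a then (y i l * z l b) • (u i * star (u b)) else 0 := by
    intro i l a b
    have e : (y i l • (u i * star (u l))) * (z a b • (u a * star (u b))) =
        (y i l * z a b) • (u i * (star (u l) * u a) * star (u b)) := by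
      rw [smul_mul_smul_comm]
      simp only [mul_assoc]
    rw [e]
    split_ifs with hla
    · subst hla
      by_cases hil : c i = c l
      · rw [hi l, ← hil, ← hi i, ← mul_assoc (u i), hp]
      · rw [hy i l hil, zero_mul, zero_smul, zero_smul]
    · rw [ho l a hla, mul_zero, zero_mul, smul_zero]
  simp only [frameSum]
  rw [Finset.sum_mul]
  refine Finset.sum_congr rfl fun i _ => ?_
  rw [Finset.sum_mul_sum]
  simp only [Finset.mul_sum, h1]
  simp only [Matrix.mul_apply, Finset.sum_smul]
  rw [Finset.sum_comm (s := Finset.univ) (t := Finset.univ)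
    (f := fun b l => (y i l * z l b) • (u i * star (u b)))]
  refine Finset.sum_congr rfl fun l _ => ?_
  rw [Finset.sum_comm]
  refine Finset.sum_congr rfl fun b _ => ?_
  simp

theorem frameSum_word {Y : κ → Matrix ι ι ℂ} [DecidableEq ι]
    (hY : ∀ k i l, c i ≠ c l → Y k i l = 0) {w : List κ} (hw : w ≠ []) :
    (w.map fun k => frameSum u (Y k)).prod = frameSum u (w.map Y).prod := by
  induction w with
  | nil => exact absurd rfl hw
  | cons k w ih =>
    rcases eq_or_ne w [] with rfl | hw'
    · simp
    · rw [List.map_cons, List.prod_cons, List.map_cons, List.prod_cons, ih hw',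
        frameSum_mul ho hi hp (hY k)]

omit hi hp in
theorem map_frameSum_of_trace {φ : R →ₗ[ℂ] ℂ} (hφ : ∀ x y, φ (x * y) = φ (y * x))
    (y : Matrix ι ι ℂ) : φ (frameSum u y) = ∑ i, y i i * φ (star (u i) * u i) := by
  simp only [frameSum, map_sum, map_smul, smul_eq_mul]
  refine Finset.sum_congr rfl fun i _ => ?_
  rw [Finset.sum_eq_single i]
  · rw [hφ]
  · intro l _ hl
    rw [hφ, ho l i hl, map_zero, mul_zero]
  · simp

end FrameSum

/-- Partial isometries of rank `r i` with pairwise orthogonal ranges, whose initial spaces are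
spanned by the first `r i` basis vectors. -/
theorem exists_matrix_frame {ι : Type*} [Fintype ι] {N : ℕ} (r : ι → ℕ) (hr : ∑ i, r i ≤ N) :
    ∃ u : ι → Matrix (Fin N) (Fin N) ℂ, (∀ i j, i ≠ j → star (u i) * u j = 0) ∧
      (∀ i, star (u i) * u i = Matrix.diagonal fun b : Fin N => if (b : ℕ) < r i then 1 else 0) ∧
      ∀ i, u i * star (u i) * u i = u i := by
  classical
  obtain ⟨f⟩ : Nonempty ((Σ i, Fin (r i)) ↪ Fin N) :=
    Function.Embedding.nonempty_of_card_le (by simpa using hr)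
  set g : ι → Fin N → Fin N := fun i b => if h : (b : ℕ) < r i then f ⟨i, ⟨b, h⟩⟩ else b with hg
  have hinj : ∀ i j (b b' : Fin N), (b : ℕ) < r i → (b' : ℕ) < r j → g i b = g j b' →
      i = j ∧ b = b' := by
    intro i j b b' hb hb' h
    simp only [hg, dif_pos hb, dif_pos hb'] at h
    have h1 := f.injective h
    obtain rfl : i = j := congrArg Sigma.fst h1
    refine ⟨rfl, ?_⟩
    have h2 := eq_of_heq (Sigma.mk.inj h1).2
    exact Fin.ext (congrArg (fun x : Fin (r i) => (x : ℕ)) h2)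
  set u : ι → Matrix (Fin N) (Fin N) ℂ := fun i =>
    Matrix.of fun a b => if (b : ℕ) < r i ∧ a = g i b then 1 else 0 with hu
  have hgram : ∀ i j b b', (star (u i) * u j) b b' =
      if ((b : ℕ) < r i ∧ (b' : ℕ) < r j) ∧ g i b = g j b' then 1 else 0 := by
    intro i j b b'
    rw [Matrix.mul_apply]
    have h1 : ∀ a, star (u i) b a * u j a b' = if a = g i b then
        (if ((b : ℕ) < r i ∧ (b' : ℕ) < r j) ∧ g i b = g j b' then 1 else 0) else 0 := by
      intro a
      rw [Matrix.star_apply]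
      simp only [hu, Matrix.of_apply]
      by_cases ha : a = g i b
      · subst ha
        by_cases hb : (b : ℕ) < r i <;> by_cases hb' : (b' : ℕ) < r j <;> simp [hb, hb']
      · simp [ha]
    simp only [h1, Finset.sum_ite_eq', Finset.mem_univ, if_true]
  have hdiag : ∀ i, star (u i) * u i =
      Matrix.diagonal fun b : Fin N => if (b : ℕ) < r i then 1 else 0 := by
    intro i
    ext b b'
    rw [hgram, Matrix.diagonal_apply]
    by_cases hbb : b = b'
    · subst hbb
      simp
    · rw [if_neg hbb, if_neg]
      rintro ⟨⟨h1, h2⟩, h3⟩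
      exact hbb (hinj i i b b' h1 h2 h3).2
  refine ⟨u, fun i j hij => ?_, hdiag, fun i => ?_⟩
  · ext b b'
    rw [hgram, if_neg]
    · rfl
    rintro ⟨⟨h1, h2⟩, h3⟩
    exact hij (hinj i j b b' h1 h2 h3).1
  · rw [mul_assoc, hdiag]
    ext a b
    rw [Matrix.mul_diagonal]
    simp only [hu, Matrix.of_apply]
    by_cases hb : (b : ℕ) < r i <;> simp [hb]

theorem IsMatrixUnitFrame.sum_re_map {ι 𝒜 : Type*} [Fintype ι] [CStarAlgebra 𝒜] {φ : 𝒜 →ₗ[ℂ] ℂ}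
    (hφ : IsTracialState φ) {c : ι → ι} {u : ι → 𝒜} (h : IsMatrixUnitFrame c u) :
    ∑ i, (φ (star (u i) * u i)).re = 1 := by
  have h1 := congrArg φ h.sum_final
  simp only [map_sum, hφ.map_one, hφ.trace (u _)] at h1
  simpa using congrArg Complex.re h1

/-- Elements of a finite-dimensional tracial *-algebra have matrix models: matrix units of trace `t`
are modelled by matrix units of rank `⌊t N⌋`. -/
theorem IsMatrixUnitFrame.exists_models {ι κ 𝒜 : Type*} [Fintype ι] [DecidableEq ι]
    [CStarAlgebra 𝒜] {φ : 𝒜 →ₗ[ℂ] ℂ} (hφ : IsTracialState φ) {c : ι → ι} {u : ι → 𝒜}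
    (h : IsMatrixUnitFrame c u) {Y : κ → Matrix ι ι ℂ} (hY : ∀ k i l, c i ≠ c l → Y k i l = 0)
    (hYh : ∀ k, (Y k).IsHermitian) :
    ∃ A : (N : ℕ) → κ → Matrix (Fin N) (Fin N) ℂ, (∀ N k, IsSelfAdjoint (A N k)) ∧
      ∀ w : List κ, Tendsto (fun N => ntrState N (w.map (A N)).prod) atTop
        (𝓝 (φ (w.map fun k => frameSum u (Y k)).prod)) := by
  set t : ι → ℝ := fun i => (φ (star (u i) * u i)).re with ht
  have ht0 : ∀ i, 0 ≤ t i := fun i => hφ.re_nonneg _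
  have htc : ∀ i, t i = t (c i) := fun i => by simp only [ht]; rw [h.initial]
  have hle : ∀ N : ℕ, ∑ i, ⌊t i * N⌋₊ ≤ N := by
    intro N
    have h1 : ((∑ i, ⌊t i * N⌋₊ : ℕ) : ℝ) ≤ N := by
      push_cast
      calc ∑ i, (⌊t i * N⌋₊ : ℝ) ≤ ∑ i, t i * N :=
            Finset.sum_le_sum fun i _ => Nat.floor_le (mul_nonneg (ht0 i) (Nat.cast_nonneg _))
        _ = N := by rw [← Finset.sum_mul, h.sum_re_map hφ, one_mul]
    exact_mod_cast h1
  choose v hvo hvd hvp using fun N : ℕ => exists_matrix_frame (fun i => ⌊t i * N⌋₊) (hle N)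
  have hvi : ∀ N i, star (v N i) * v N i = star (v N (c i)) * v N (c i) := by
    intro N i
    rw [hvd, hvd, htc]
  have htrace : ∀ i, Tendsto (fun N => ntrState N (star (v N i) * v N i)) atTop
      (𝓝 (φ (star (u i) * u i))) := by
    intro i
    have e1 : φ (star (u i) * u i) = ((t i : ℝ) : ℂ) := by
      rw [← hφ.ofReal_norm2_sq, hφ.norm2_sq]
    have e2 : ∀ N : ℕ, ntrState N (star (v N i) * v N i) = (((⌊t i * N⌋₊ : ℝ) / N : ℝ) : ℂ) := by
      intro N
      have h1 : ⌊t i * N⌋₊ ≤ N :=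
        (Finset.single_le_sum (f := fun i => ⌊t i * N⌋₊) (fun _ _ => Nat.zero_le _)
          (Finset.mem_univ i)).trans (hle N)
      rw [hvd, ntrState_apply, Matrix.trace_diagonal, Finset.sum_ite, Finset.sum_const_zero,
        add_zero, Finset.sum_const, Fin.card_filter_val_lt, min_eq_right h1]
      push_cast
      rw [nsmul_one, div_eq_inv_mul]
    rw [e1]
    simp only [e2]
    refine (Complex.continuous_ofReal.tendsto _).comp ?_
    exact (tendsto_nat_floor_mul_div_atTop (ht0 i)).comp tendsto_natCast_atTop_atTop
  refine ⟨fun N k => frameSum (v N) (Y k), fun N k => ?_, fun w => ?_⟩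
  · rw [IsSelfAdjoint, ← frameSum_conjTranspose, hYh k]
  · rcases eq_or_ne w [] with rfl | hw
    · simp only [List.map_nil, List.prod_nil, hφ.map_one]
      refine tendsto_const_nhds.congr' ?_
      filter_upwards [eventually_ne_atTop 0] with N hN
      exact (isTracialState_ntrState hN).map_one.symm
    · have e1 : ∀ N, ntrState N (w.map fun k => frameSum (v N) (Y k)).prod =
          ∑ i, (w.map Y).prod i i * ntrState N (star (v N i) * v N i) := by
        intro N
        rw [frameSum_word (hvo N) (hvi N) (hvp N) hY hw]
        refine map_frameSum_of_trace (hvo N) (fun x y => ?_) _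
        rw [ntrState_apply, ntrState_apply, Matrix.trace_mul_comm]
      rw [frameSum_word h.orthogonal h.initial h.partial_isometry hY hw,
        map_frameSum_of_trace h.orthogonal hφ.trace]
      simp only [e1]
      exact tendsto_finsetSum _ fun i _ => (htrace i).const_mul _

theorem HasFrameApprox.eventually_exists_momentClose {κ 𝒜 : Type*} [Finite κ] [CStarAlgebra 𝒜]
    {φ : 𝒜 →ₗ[ℂ] ℂ} {X : κ → 𝒜} (h : HasFrameApprox φ X) (hφ : IsTracialState φ) (m : ℕ) {δ : ℝ}
    (hδ : 0 < δ) : ∀ᶠ N : ℕ in atTop, ∃ A : κ → Matrix (Fin N) (Fin N) ℂ,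
      (∀ k, IsSelfAdjoint (A k)) ∧ MomentClose φ X (ntrState N) A m δ := by
  have : Fintype κ := Fintype.ofFinite κ
  obtain ⟨K, hK⟩ := h
  set b : ℝ := 1 + |K| + ∑ k, ‖X k‖ with hb
  have hS : 0 ≤ ∑ k, ‖X k‖ := by positivity
  have hb1 : 1 ≤ b := by have := abs_nonneg K; linarith
  have hXb : ∀ k, ‖X k‖ ≤ b := fun k => by
    have := Finset.single_le_sum (f := fun k => ‖X k‖) (fun k _ => norm_nonneg _)
      (Finset.mem_univ k)
    have := abs_nonneg K
    linarith
  set C : ℝ := m * (b ^ m * b ^ m) + 1 with hC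
  have hC0 : 0 < C := by positivity
  obtain ⟨D, c, u, Y, hframe, hblock, hherm, hYK, hXY, -⟩ := hK (δ / (2 * C)) (by positivity)
  obtain ⟨A, hA, hAw⟩ := hframe.exists_models hφ hblock hherm
  have h1 : ∀ w ∈ {w : List κ | w.length ≤ m}, ∀ᶠ N in atTop,
      ‖ntrState N (w.map (A N)).prod - φ (w.map fun k => frameSum u (Y k)).prod‖ < δ / 2 := by
    intro w _
    have := (tendsto_iff_norm_sub_tendsto_zero.1 (hAw w)).eventually
      (gt_mem_nhds (half_pos hδ))
    exact this
  have h2 := (List.finite_length_le κ m).eventually_all.2 h1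
  filter_upwards [h2] with N hN
  refine ⟨A N, hA N, fun w hw => ?_⟩
  have h3 := hN w hw
  have h4 := hφ.norm_map_word_sub_le (a := X) (b := fun k => frameSum u (Y k)) (m := m) hb1
    (by positivity : 0 ≤ δ / (2 * C)) (L := b ^ m)
    (fun v hv => (hφ.norm2_le _).trans ((norm_word_le (by linarith) hXb v).trans
      (pow_le_pow_right₀ hb1 hv.le)))
    (fun k => (hYK k).trans (by have := le_abs_self K; linarith)) (fun k => (hXY k).le) hw
  have h5 : (m : ℝ) * (b ^ m * (δ / (2 * C) * b ^ m)) ≤ δ / 2 := by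
    have : (m : ℝ) * (b ^ m * (δ / (2 * C) * b ^ m)) = δ / 2 * ((m * (b ^ m * b ^ m)) / C) := by
      field_simp
    rw [this]
    refine mul_le_of_le_one_right (by positivity) ?_
    rw [div_le_one hC0]
    linarith
  have h6 := norm_sub_le_norm_sub_add_norm_sub (ntrState N (w.map (A N)).prod)
    (φ (w.map fun k => frameSum u (Y k)).prod) (φ (w.map X).prod)
  rw [norm_sub_rev] at h4
  linarith

/-- A tuple with frame approximations is the limit in moments of matrix tuples that obey the same
norm bounds. -/
theorem HasFrameApprox.exists_approximating {κ 𝒜 : Type*} [Finite κ] [CStarAlgebra 𝒜]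
    {φ : 𝒜 →ₗ[ℂ] ℂ} {X : κ → 𝒜} (h : HasFrameApprox φ X) (hφ : IsTracialState φ) :
    ∃ A : (N : ℕ) → κ → Matrix (Fin N) (Fin N) ℂ, (∀ N k, IsSelfAdjoint (A N k)) ∧
      (∀ N k, ‖A N k‖ ≤ ‖X k‖) ∧ ∀ P : FreeAlgebra ℂ κ,
        Tendsto (fun N => ntrState N (FreeAlgebra.lift ℂ (A N) P)) atTop
          (𝓝 (φ (FreeAlgebra.lift ℂ X P))) := by
  classical
  have : Fintype κ := Fintype.ofFinite κ
  set Q : ℕ → ℕ → Prop := fun k N => ∃ A : κ → Matrix (Fin N) (Fin N) ℂ,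
    (∀ k, IsSelfAdjoint (A k)) ∧ (∀ k, ‖A k‖ ≤ ‖X k‖) ∧
      MomentClose φ X (ntrState N) A k (1 / ((k : ℝ) + 1)) with hQ
  have hev : ∀ k, ∀ᶠ N in atTop, Q k N := by
    intro k
    obtain ⟨m, δ, hδ, htrunc⟩ := exists_of_eventually_lawFilter
      (eventually_exists_truncation (X := X) hφ k (δ := 1 / ((k : ℝ) + 1)) (by positivity) one_pos)
    filter_upwards [h.eventually_exists_momentClose hφ m hδ, eventually_ne_atTop 0] with N hN hN0
    obtain ⟨A, hA, hAc⟩ := hN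
    obtain ⟨A', h1, h2, -, h3⟩ := htrunc (isTracialState_ntrState hN0) hA hAc
    exact ⟨A', h1, h2, h3⟩
  -- For each `N`, the best order of approximation available up to order `N`.
  set g : ℕ → ℕ := fun N => Nat.findGreatest (fun k => Q k N) N with hg
  have hgt : Tendsto g atTop atTop := by
    refine tendsto_atTop.2 fun k => ?_
    filter_upwards [hev k, eventually_ge_atTop k] with N h1 h2
    exact Nat.le_findGreatest h2 h1
  have hgQ : ∀ᶠ N in atTop, Q (g N) N := by
    filter_upwards [hev 0] with N h1
    exact Nat.findGreatest_spec (P := fun k => Q k N) (Nat.zero_le N) h1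
  have hex : ∀ N, ∃ A : κ → Matrix (Fin N) (Fin N) ℂ, (∀ k, IsSelfAdjoint (A k)) ∧
      (∀ k, ‖A k‖ ≤ ‖X k‖) ∧
      (Q (g N) N → MomentClose φ X (ntrState N) A (g N) (1 / ((g N : ℝ) + 1))) := by
    intro N
    by_cases hN : Q (g N) N
    · obtain ⟨A, h1, h2, h3⟩ := hN
      exact ⟨A, h1, h2, fun _ => h3⟩
    · exact ⟨fun _ => 0, fun _ => .zero _, fun k => by simp, fun h => absurd h hN⟩
  choose A hA1 hA2 hA3 using hex
  refine ⟨A, hA1, hA2, fun P => ?_⟩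
  rw [tendsto_iff_norm_sub_tendsto_zero]
  refine (tendsto_order.2 ⟨fun a ha => Eventually.of_forall fun N =>
    ha.trans_le (norm_nonneg _), fun ε hε => ?_⟩)
  obtain ⟨m, δ, hδ, hP⟩ := exists_of_eventually_lawFilter (eventually_norm_lift_sub_lt φ X P hε)
  have h1 := (tendsto_one_div_add_atTop_nhds_zero_nat (𝕜 := ℝ)).comp hgt
  filter_upwards [hgQ, hgt.eventually_ge_atTop m, h1.eventually (gt_mem_nhds hδ)] with N h1 h2 h3
  exact hP _ _ ((hA3 N h1).mono h2 h3.le)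

end Models

/-! ### Orbital microstates -/

section OrbitalMicrostates

open scoped Matrix.Norms.L2Operator

theorem lift_word {κ R : Type*} [Ring R] [Algebra ℂ R] (a : κ → R) (w : List κ) :
    FreeAlgebra.lift ℂ a (w.map (FreeAlgebra.ι ℂ)).prod = (w.map a).prod := by
  rw [map_list_prod, List.map_map]
  congr 2
  ext k
  simp

theorem unitary_conj_word {κ R : Type*} [Ring R] [StarRing R] {V : R} (hV : star V * V = 1)
    (hV' : V * star V = 1) (a : κ → R) (w : List κ) :
    (w.map fun k => V * a k * star V).prod = V * (w.map a).prod * star V := by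
  induction w with
  | nil => simp [hV']
  | cons k w ih =>
    simp only [List.map_cons, List.prod_cons, ih]
    calc V * a k * star V * (V * (w.map a).prod * star V) =
          V * a k * (star V * V) * (w.map a).prod * star V := by noncomm_ring
      _ = _ := by rw [hV]; noncomm_ring

theorem ntrState_unitary_conj {N : ℕ} {V : Matrix (Fin N) (Fin N) ℂ} (hV : star V * V = 1)
    (A : Matrix (Fin N) (Fin N) ℂ) : ntrState N (V * A * star V) = ntrState N A := by
  rw [ntrState_apply, Matrix.trace_mul_comm, ← mul_assoc, hV, one_mul, ntrState_apply]

theorem norm_unitary_conj_le {𝒜 : Type*} [CStarAlgebra 𝒜] {V : 𝒜} (hV : V ∈ unitary 𝒜) (a : 𝒜) :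
    ‖V * a * star V‖ ≤ ‖a‖ := by
  rw [CStarRing.norm_mul_mem_unitary _ (Unitary.star_mem hV), CStarRing.norm_mem_unitary_mul _ hV]

theorem continuous_conj {N : ℕ} : Continuous fun p : U N × Msa N => conj p.1 p.2 := by
  refine Continuous.subtype_mk ?_ _
  fun_prop

theorem continuous_Phi {n : ℕ} {r : Fin n → ℕ} {N : ℕ} :
    Continuous (Phi : (Fin n → U N) × MultiMat r N → MultiMat r N) :=
  continuous_pi fun i => continuous_pi fun j => continuous_conj.comp
    (f := fun p : (Fin n → U N) × MultiMat r N => (p.1 i, p.2 i j)) (by fun_prop)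

section

variable {H : Type*} [NormedAddCommGroup H] [InnerProductSpace ℂ H] [CompleteSpace H]
  {M : VonNeumannAlgebra H} {τ : M.toStarSubalgebra →ₗ[ℂ] ℂ}
  {n : ℕ} {r : Fin n → ℕ} {X : (i : Fin n) → Fin (r i) → M.toStarSubalgebra}

theorem mem_microstates_iff (hτ : IsTracialState τ) {R : ℝ≥0∞} {N m : ℕ} {δ : ℝ} (hN : N ≠ 0)
    (hδ : 0 < δ) {A : MultiMat r N} :
    A ∈ microstates τ X R N m δ ↔
      (∀ i j, ENNReal.ofReal (opNorm (A i j : Matrix (Fin N) (Fin N) ℂ)) ≤ R) ∧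
      MomentClose τ (fun p : Σ i : Fin n, Fin (r i) => X p.1 p.2) (ntrState N)
        (fun p => (A p.1 p.2 : Matrix (Fin N) (Fin N) ℂ)) m δ := by
  refine and_congr_right fun _ => ⟨fun h w hw => ?_, fun h w _ hw => h w hw⟩
  rcases eq_or_ne w [] with rfl | hw0
  · rw [List.map_nil, List.prod_nil, List.map_nil, List.prod_nil, hτ.map_one,
      (isTracialState_ntrState hN).map_one, sub_self, norm_zero]
    exact hδ
  · exact h w hw0 hw

theorem isOpen_microstates_top (N m : ℕ) (δ : ℝ) : IsOpen (microstates τ X ∞ N m δ) := by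
  have h1 : microstates τ X ∞ N m δ = ⋂ w ∈ {w : List (Σ i : Fin n, Fin (r i)) | w.length ≤ m},
      {A : MultiMat r N | w ≠ [] →
        ‖ntr (w.map fun p => (A p.1 p.2 : Matrix (Fin N) (Fin N) ℂ)).prod -
          τ (w.map fun p => X p.1 p.2).prod‖ < δ} := by
    ext A
    simp only [microstates, le_top, implies_true, true_and, mem_iInter, mem_ofPred_eq]
    exact ⟨fun h w hw h0 => h w h0 hw, fun h w h0 hw => h w hw h0⟩
  rw [h1]
  refine (List.finite_length_le _ m).isOpen_biInter fun w _ => ?_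
  by_cases h0 : w = []
  · simp [h0]
  · simp only [ne_eq, h0, not_false_eq_true, forall_const]
    refine isOpen_lt ?_ continuous_const
    refine (Continuous.sub ?_ continuous_const).norm
    have h2 : Continuous fun A : MultiMat r N =>
        (w.map fun p => (A p.1 p.2 : Matrix (Fin N) (Fin N) ℂ)).prod :=
      continuous_list_prod w fun p _ => by fun_prop
    exact continuous_const.mul h2.matrix_trace

/-- The Haar measure of the compact group `U(N)` is also right-invariant, by uniqueness. -/
instance isMulRightInvariant_haarU (N : ℕ) : (haarU N).IsMulRightInvariant := by
  have : (haarU N).IsHaarMeasure := by unfold haarU; infer_instance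
  refine ⟨fun g => ?_⟩
  have : IsProbabilityMeasure ((haarU N).map (· * g)) :=
    Measure.isProbabilityMeasure_map (measurable_mul_const g).aemeasurable
  exact Measure.isHaarMeasure_eq_of_isProbabilityMeasure _ _

theorem measurePreserving_mul_right_pi_haarU {n N : ℕ} (W : Fin n → U N) :
    MeasurePreserving (fun V : Fin n → U N => V * W) (Measure.pi fun _ => haarU N)
      (Measure.pi fun _ => haarU N) :=
  measurePreserving_pi (fun _ : Fin n => haarU N) (fun _ : Fin n => haarU N)
    fun i => measurePreserving_mul_right (haarU N) (W i)

theorem isOpen_orbMicrostates {N : ℕ} (A : MultiMat r N) (m : ℕ) (δ : ℝ) :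
    IsOpen (orbMicrostates τ X A m δ) :=
  (isOpen_microstates_top N m δ).preimage
    (continuous_Phi.comp (f := fun V : Fin n → U N => (V, A)) (by fun_prop))

/-- If each `X i` has frame approximations, then the orbital microstates of any multi-matrix are
contained in a translate of those of an approximating sequence: only the unitary orbits of the
components matter. -/
theorem exists_eventually_orbMicrostates_subset (hτ : IsTracialState τ)
    (hX : ∀ i j, IsSelfAdjoint (X i j)) (hframe : ∀ i, HasFrameApprox τ (X i))
    {Ξ : (i : Fin n) → (N : ℕ) → Fin (r i) → Msa N} (hΞ : IsApproximating τ X Ξ) (m : ℕ) {δ : ℝ}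
    (hδ : 0 < δ) : ∃ m' : ℕ, ∃ δ' : ℝ, 0 < δ' ∧ ∀ᶠ N : ℕ in atTop, ∀ A : MultiMat r N,
      (orbMicrostates τ X A m' δ').Nonempty → ∃ W : Fin n → U N,
        ∀ V ∈ orbMicrostates τ X A m' δ', V * W ∈ orbMicrostates τ X (fun i => Ξ i N) m δ := by
  set b : ℝ := 1 + ∑ i, ∑ j, ‖X i j‖ with hb
  have hb1 : 1 ≤ b := le_add_of_nonneg_right (by positivity)
  have hXb : ∀ i j, ‖X i j‖ ≤ b := fun i j => by
    have h1 := Finset.single_le_sum (f := fun j => ‖X i j‖) (fun k _ => norm_nonneg _)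
      (Finset.mem_univ j)
    have h2 := Finset.single_le_sum (f := fun i => ∑ j, ‖X i j‖) (fun k _ => by positivity)
      (Finset.mem_univ i)
    linarith
  obtain ⟨ε, hε, hstab⟩ := exists_eventually_momentClose
    (X := fun p : Σ i : Fin n, Fin (r i) => X p.1 p.2) hτ hb1 (fun p => hXb p.1 p.2) m hδ
  choose m₁ δ₁ hδ₁ hunit using fun i => exists_of_eventually_lawFilter
    ((hframe i).eventually_exists_unitary hτ (hX i) (hXb i) (half_pos hε))
  have htrunc := eventually_all.2 fun i => eventually_exists_truncation (X := X i) hτ (m₁ i)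
    (hδ₁ i) (half_pos hε)
  obtain ⟨m', δ', hδ', hstab', htrunc'⟩ := exists_of_eventually_lawFilter (hstab.and htrunc)
  refine ⟨m', δ', hδ', ?_⟩
  have hΞm : ∀ i, ∀ᶠ N in atTop, MomentClose τ (X i) (ntrState N)
      (fun j => (Ξ i N j : Matrix (Fin N) (Fin N) ℂ)) (m₁ i) (δ₁ i) := by
    intro i
    refine (List.finite_length_le (Fin (r i)) (m₁ i)).eventually_all.2 fun w _ => ?_
    have h1 := (tendsto_iff_norm_sub_tendsto_zero.1
      (hΞ.tendsto i (w.map (FreeAlgebra.ι ℂ)).prod)).eventually (gt_mem_nhds (hδ₁ i))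
    filter_upwards [h1] with N hN
    rwa [lift_word, lift_word] at hN
  filter_upwards [eventually_all.2 hΞm, eventually_ne_atTop 0] with N hΞN hN A hA
  have hψ := isTracialState_ntrState hN
  obtain ⟨V₀, hV₀⟩ := hA
  have hunitary : ∀ V : U N, star (V : Matrix (Fin N) (Fin N) ℂ) * V = 1 ∧
      (V : Matrix (Fin N) (Fin N) ℂ) * star (V : Matrix (Fin N) (Fin N) ℂ) = 1 := fun V =>
    ⟨Unitary.star_mul_self_of_mem V.2, Unitary.mul_star_self_of_mem V.2⟩
  have hΞb : ∀ i j, ‖(Ξ i N j : Matrix (Fin N) (Fin N) ℂ)‖ ≤ b := fun i j =>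
    (hΞ.norm_le i N j).trans (hXb i j)
  -- The components of `A` are microstates since joint moments of a component are invariant.
  have hAi : ∀ i, MomentClose τ (X i) (ntrState N)
      (fun j => (A i j : Matrix (Fin N) (Fin N) ℂ)) m' δ' := by
    intro i w hw
    have h1 := ((mem_microstates_iff hτ hN hδ').1 hV₀).2 (w.map (Sigma.mk i)) (by simpa using hw)
    simp only [List.map_map, Function.comp_def] at h1
    have h2 := unitary_conj_word (hunitary (V₀ i)).1 (hunitary (V₀ i)).2
      (fun j => (A i j : Matrix (Fin N) (Fin N) ℂ)) w
    simp only [Phi, conj] at h1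
    rwa [h2, ntrState_unitary_conj (hunitary (V₀ i)).1] at h1
  have hW : ∀ i, ∃ W : U N, ∀ j, norm2 (ntrState N) ((A i j : Matrix (Fin N) (Fin N) ℂ) * W -
      W * (Ξ i N j : Matrix (Fin N) (Fin N) ℂ)) ≤ ε := by
    intro i
    obtain ⟨A', hA'1, hA'2, hA'3, hA'4⟩ := htrunc' i hψ (fun j => (A i j).2) (hAi i)
    obtain ⟨W, hW, hWε⟩ := hunit i N A' (fun j => (Ξ i N j : Matrix (Fin N) (Fin N) ℂ)) hN hA'1
      (fun j => (Ξ i N j).2) (fun j => (hA'2 j).trans (hXb i j)) (hΞb i) hA'4 (hΞN i)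
    refine ⟨⟨W, hW⟩, fun j => ?_⟩
    have h1 := hψ.norm2_add_le (((A i j : Matrix (Fin N) (Fin N) ℂ) - A' j) * W)
      (A' j * W - W * (Ξ i N j : Matrix (Fin N) (Fin N) ℂ))
    rw [hψ.norm2_mul_unitary hW, ← add_sub_assoc, sub_mul, sub_add_cancel] at h1
    have h2 := hA'3 j
    have h3 := hWε j
    change norm2 (ntrState N) ((A i j : Matrix (Fin N) (Fin N) ℂ) * W -
      W * (Ξ i N j : Matrix (Fin N) (Fin N) ℂ)) ≤ ε
    linarith
  choose W hWε using hW
  refine ⟨W, fun V hV => (mem_microstates_iff hτ hN hδ).2 ⟨fun _ _ => le_top, ?_⟩⟩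
  refine hstab' hψ (fun p => (Phi (V, A) p.1 p.2).2) ((mem_microstates_iff hτ hN hδ').1 hV).2
    (fun p => ?_) fun p => ?_
  · exact (norm_unitary_conj_le (V p.1 * W p.1).2 _).trans (hΞb p.1 p.2)
  · obtain ⟨i, j⟩ := p
    have h1 : ((Phi (V, A) i j : Msa N) : Matrix (Fin N) (Fin N) ℂ) -
        ((Phi (V * W, fun i => Ξ i N) i j : Msa N) : Matrix (Fin N) (Fin N) ℂ) =
        (V i : Matrix (Fin N) (Fin N) ℂ) * ((A i j : Matrix (Fin N) (Fin N) ℂ) * W i -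
          W i * (Ξ i N j : Matrix (Fin N) (Fin N) ℂ)) * star (V i * W i : Matrix (Fin N) (Fin N) ℂ) := by
      change (V i : Matrix (Fin N) (Fin N) ℂ) * (A i j : Matrix (Fin N) (Fin N) ℂ) *
        star (V i : Matrix (Fin N) (Fin N) ℂ) - (V i * W i : Matrix (Fin N) (Fin N) ℂ) *
        (Ξ i N j : Matrix (Fin N) (Fin N) ℂ) * star (V i * W i : Matrix (Fin N) (Fin N) ℂ) = _
      rw [mul_sub, sub_mul, star_mul]
      congr 1
      · calc _ = (V i : Matrix (Fin N) (Fin N) ℂ) * (A i j : Matrix (Fin N) (Fin N) ℂ) *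
              (W i * star (W i : Matrix (Fin N) (Fin N) ℂ)) *
              star (V i : Matrix (Fin N) (Fin N) ℂ) := by rw [(hunitary (W i)).2, mul_one]
          _ = _ := by simp only [mul_assoc]
      · simp only [mul_assoc]
    change norm2 (ntrState N) (((Phi (V, A) i j : Msa N) : Matrix (Fin N) (Fin N) ℂ) -
        ((Phi (V * W, fun i => Ξ i N) i j : Msa N) : Matrix (Fin N) (Fin N) ℂ)) ≤ ε
    rw [h1, hψ.norm2_mul_unitary (Unitary.star_mem (mul_mem (V i).2 (W i).2)),
      norm2_unitary_mul (V i).2]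
    exact hWε i j

/-! ### Comparison of the two entropies -/

theorem prod_le_of_forall_section_le {α β : Type*} [MeasurableSpace α] [MeasurableSpace β]
    {γ : Measure α} [SFinite γ] {μ : Measure β} [IsProbabilityMeasure μ] {S : Set (α × β)}
    (hS : MeasurableSet S) {b : ℝ≥0∞} (h : ∀ y, γ ((fun x => (x, y)) ⁻¹' S) ≤ b) :
    (γ.prod μ) S ≤ b := by
  rw [Measure.prod_apply_symm hS]
  exact (lintegral_mono h).trans (by rw [lintegral_const, measure_univ, mul_one])

/-- The measure that enters `chiOrbR` is an average over `A` of the measures of the orbital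
microstates of `A`, each of which is at most that of the orbital microstates of `Ξ`. -/
theorem chiOrbR_le_chiOrbOld (hτ : IsTracialState τ)
    (hX : ∀ i j, IsSelfAdjoint (X i j)) (hframe : ∀ i, HasFrameApprox τ (X i))
    {Ξ : (i : Fin n) → (N : ℕ) → Fin (r i) → Msa N} (hΞ : IsApproximating τ X Ξ) (R : ℝ≥0∞) :
    chiOrbR τ X R ≤ chiOrbOld τ X Ξ := by
  refine le_iInf fun m => le_iInf fun δ => le_iInf fun hδ => ?_
  obtain ⟨m', δ', hδ', hsub⟩ := exists_eventually_orbMicrostates_subset hτ hX hframe hΞ m hδ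
  refine (iInf_le_of_le m' (iInf_le_of_le δ' (iInf_le _ hδ'))).trans (limsup_le_limsup ?_)
  filter_upwards [hsub] with N hN
  refine mul_le_mul_of_nonneg_left ?_ (by exact_mod_cast inv_nonneg.2 (sq_nonneg (N : ℝ)))
  refine iSup₂_le fun μ hμ => ENNReal.log_monotone ?_
  set γ : Measure (Fin n → U N) := Measure.pi fun _ => haarU N with hγ
  have hle : ∀ A : MultiMat r N, γ (orbMicrostates τ X A m' δ') ≤
      γ (orbMicrostates τ X (fun i => Ξ i N) m δ) := by
    intro A
    rcases (orbMicrostates τ X A m' δ').eq_empty_or_nonempty with h0 | h0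
    · rw [h0, measure_empty]
      exact zero_le
    · obtain ⟨W, hW⟩ := hN A h0
      rw [← (measurePreserving_mul_right_pi_haarU W).measure_preimage
        (isOpen_orbMicrostates _ m δ).measurableSet.nullMeasurableSet]
      exact measure_mono hW
  calc (γ.prod μ) (Phi ⁻¹' microstates τ X R N m' δ')
      ≤ (γ.prod μ) (Phi ⁻¹' microstates τ X ∞ N m' δ') :=
        measure_mono fun p hp => ⟨fun _ _ => le_top, hp.2⟩
    _ ≤ _ := prod_le_of_forall_section_le ((isOpen_microstates_top N m' δ').preimage
          continuous_Phi).measurableSet hle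

theorem chiOrbOld_le_chiOrbR {Ξ : (i : Fin n) → (N : ℕ) → Fin (r i) → Msa N}
    (hΞ : IsApproximating τ X Ξ) {R : ℝ≥0∞}
    (hR : ∀ i j, ENNReal.ofReal ‖(X i j : H →L[ℂ] H)‖ ≤ R) :
    chiOrbOld τ X Ξ ≤ chiOrbR τ X R := by
  refine iInf_mono fun m => iInf_mono fun δ => iInf_mono fun _ => limsup_le_limsup ?_
  refine Eventually.of_forall fun N =>
    mul_le_mul_of_nonneg_left ?_ (by exact_mod_cast inv_nonneg.2 (sq_nonneg (N : ℝ)))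
  refine le_iSup₂_of_le (Measure.dirac fun i => Ξ i N) inferInstance (ENNReal.log_monotone ?_)
  rw [Measure.prod_dirac]
  refine le_trans (measure_mono fun V hV => ?_)
    (Measure.le_map_apply measurable_prodMk_right.aemeasurable _)
  refine ⟨fun i j => le_trans (ENNReal.ofReal_le_ofReal ?_) (hR i j), hV.2⟩
  exact (norm_unitary_conj_le (V i).2 _).trans (hΞ.norm_le i N j)

end

end OrbitalMicrostates

end OrbitalFreeEntropy

theorem proposition2p3
    {H : Type*} [NormedAddCommGroup H] [InnerProductSpace ℂ H] [CompleteSpace H]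
    (M : VonNeumannAlgebra H) (τ : M.toStarSubalgebra →ₗ[ℂ] ℂ)
    (hτ : OrbitalFreeEntropy.IsNormalTracialState M τ)
    {n : ℕ} (r : Fin n → ℕ) (X : (i : Fin n) → Fin (r i) → M.toStarSubalgebra)
    (hX : ∀ i j, IsSelfAdjoint (X i j))
    (hyp : ∀ i, OrbitalFreeEntropy.IsHyperfinite
      (OrbitalFreeEntropy.generatedVN (Set.range fun j => (X i j : H →L[ℂ] H)))) :
    (∃ Ξ, OrbitalFreeEntropy.IsApproximating τ X Ξ) ∧
    ∀ Ξ, OrbitalFreeEntropy.IsApproximating τ X Ξ →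
      (∀ R : ℝ≥0∞, 0 < R → (∀ i j, ENNReal.ofReal ‖(X i j : H →L[ℂ] H)‖ ≤ R) →
        OrbitalFreeEntropy.chiOrbR τ X R = OrbitalFreeEntropy.chiOrbOld τ X Ξ) ∧
      OrbitalFreeEntropy.chiOrb τ X = OrbitalFreeEntropy.chiOrbOld τ X Ξ := by
  have := OrbitalFreeEntropy.isClosed_toStarSubalgebra M
  have hτ' := hτ.isTracialState
  have hframe : ∀ i, OrbitalFreeEntropy.HasFrameApprox τ (X i) := fun i =>
    hτ.hasFrameApprox (hX i) (hyp i)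
  refine ⟨?_, fun Ξ hΞ => ?_⟩
  · choose A hA hAX hAP using fun i => (hframe i).exists_approximating hτ'
    exact ⟨fun i N j => ⟨A i N j, hA i N j⟩, fun i N j => hAX i N j, fun i P => hAP i P⟩
  · have key : ∀ R : ℝ≥0∞, (∀ i j, ENNReal.ofReal ‖(X i j : H →L[ℂ] H)‖ ≤ R) →
        OrbitalFreeEntropy.chiOrbR τ X R = OrbitalFreeEntropy.chiOrbOld τ X Ξ := fun R hR =>
      le_antisymm (OrbitalFreeEntropy.chiOrbR_le_chiOrbOld hτ' hX hframe hΞ R)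
        (OrbitalFreeEntropy.chiOrbOld_le_chiOrbR hΞ hR)
    refine ⟨fun R _ hR => key R hR, le_antisymm ?_ ?_⟩
    · exact iSup_le fun R => iSup₂_le fun _ _ =>
        OrbitalFreeEntropy.chiOrbR_le_chiOrbOld hτ' hX hframe hΞ R
    · set b : ℝ := 1 + ∑ i, ∑ j, ‖(X i j : H →L[ℂ] H)‖ with hb
      have hb0 : 0 < b := by positivity
      have hR : ∀ i j, ENNReal.ofReal ‖(X i j : H →L[ℂ] H)‖ ≤ ENNReal.ofReal b := by
        intro i j
        refine ENNReal.ofReal_le_ofReal ?_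
        have h1 := Finset.single_le_sum (f := fun j => ‖(X i j : H →L[ℂ] H)‖)
          (fun k _ => norm_nonneg _) (Finset.mem_univ j)
        have h2 := Finset.single_le_sum (f := fun i => ∑ j, ‖(X i j : H →L[ℂ] H)‖)
          (fun k _ => by positivity) (Finset.mem_univ i)
        linarith
      exact (key _ hR).ge.trans (le_iSup_of_le (ENNReal.ofReal b)
        (le_iSup₂_of_le (ENNReal.ofReal_pos.2 hb0) ENNReal.ofReal_lt_top le_rfl))
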